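/- **Setting.** Fix $\delta>0$. For integers $n,k\ge 1$, $q\in[0,1]$ and $\rho>0$, let $G_B(n,k,q,\rho)$ be the set of laws of random graphs on $[n]$ obtained as follows. Fix positive integers $k_1,k_2$ with $k_1+k_2\le n$ and $\frac k2-k^{1-\delta}\le k_1,k_2\le \frac k2+k^{1-\delta}$; put $S=[k_1]$ and $T=[k_1+k_2]\setminus[k_1]$; include the edges independently, each edge inside $S$ or inside $T$ with some probability at least $q+\rho$, each edge between $S$ and $T$ with some probability at most $q-\rho$ (these probabilities may differ from edge to edge), and every other edge with probability $q$; finally permute the vertices by a uniformly random permutation. The detection problem $\textsc{SSBM}_D(n,k,q,\rho)$ is to test $H_0: G\sim G(n,q)$ against $H_1: G\sim P$ for some $P\in G_B(n,k,q,\rho)$. The Type I$+$II error of a randomized test $A$ is $\mathbb P_{H_0}[A(G)=1]+\sup_{P\in H_1}\mathbb P_{G\sim P}[A(G)=0]$. A sequence of randomized tests $A_i$, the $i$-th one acting on graphs with $N_i$ vertices, runs in polynomial time if $A_i$ is a sequence of elementary steps (read one adjacency bit, toss a fair coin, apply a binary Boolean operation to two previously computed bits) whose number is bounded by a fixed polynomial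 in $N_i$. (The algorithm may depend on $i$ in an arbitrary way.) The *PC conjecture with density $p$* says: for every sequence of randomized polynomial-time tests $A_n$ on $n$-vertex graphs and every sequence of positive integers $k_n$ with $\limsup_{n\to\infty}\log_n k_n<\frac12$, one has $\liminf_{n\to\infty}\big(\mathbb P_{G\sim G(n,p)}[A_n(G)=1]+\mathbb P_{G\sim G(n,k_n,p)}[A_n(G)=0]\big)\ge 1$, where $G(n,k,p)$ is $G(n,p)$ with a clique planted on a uniformly random $k$-subset of the vertices. **Theorem.** Let $\alpha\in[0,2)$, $\beta\in(\delta,1-3\delta)$ with $\beta<\frac12+\alpha$, and let $q\in(0,1)$. There is a sequence of parameters $(N_n,K_n,q_n,\rho_n)_{n\in\mathbb N}$ with $1\le K_n\le N_n$, $\rho_n>0$, $0\le q_n-\rho_n$, $q_n+\rho_n\le 1$, $G_B(N_n,K_n,q_n,\rho_n)\neq\emptyset$ and $N_n\to\infty$, such that: 1. the parameters are in the regime $q=\Theta(1)$, $\rho=\tilde\Theta(N^{-\alpha})$, $K=\tilde\Theta(N^{\beta})$, that is, $$\lim_{n\to\infty}\frac{\log\rho_n^{-1}}{\log N_n}=\alpha,\qquad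 \lim_{n\to\infty}\frac{\log K_n}{\log N_n}=\beta,\qquad \lim_{n\to\infty}q_n=q;$$ 2. assuming the PC conjecture with density $p=\frac12$, for every sequence of randomized polynomial-time tests $\phi_n$ on graphs with $N_n$ vertices, the Type I$+$II error of $\phi_n$ on $\textsc{SSBM}_D(N_n,K_n,q_n,\rho_n)$ satisfies $\liminf_{n\to\infty}(\text{error})\ge 1$; in particular its asymptotic Type I$+$II error (the $\limsup$) is at least $1$. -/

import Mathlib

open MeasureTheory Filter Topology unitInterval
open scoped ENNReal

/-! ### Randomized polynomial-time algorithms on graphs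

An algorithm on `n`-vertex graphs is a finite list of elementary bit operations, executed one after
the other; each step appends one bit to the memory. The running time is the number of steps. -/

/-- One elementary step of an algorithm whose input is a graph on `Fin n`. -/
inductive GraphInstr (n : ℕ) : Type
  /-- read one bit of the adjacency matrix of the input -/
  | edge (u v : Fin n) : GraphInstr n
  /-- toss a fresh fair coin -/
  | toss : GraphInstr n
  /-- apply a binary Boolean operation to the bits computed in steps `i` and `j` -/
  | gate (f : Bool → Bool → Bool) (i j : ℕ) : GraphInstr n

/-- A randomized algorithm with input a graph on `Fin n` and output a bit. -/
abbrev GraphAlgorithm (n : ℕ) : Type := List (GraphInstr n)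

namespace GraphAlgorithm

/-- Running time: the number of elementary steps. -/
def time {n : ℕ} (A : GraphAlgorithm n) : ℕ := A.length

open Classical in
/-- The bit produced by one step, given the input graph, the random bit available at this step, and
the bits produced so far (an address that is not yet in use reads as `false`). -/
noncomputable def stepValue {n : ℕ} (G : SimpleGraph (Fin n)) (coin : Bool) (mem : List Bool) :
    GraphInstr n → Bool
  | .edge u v => decide (G.Adj u v)
  | .toss => coin
  | .gate f i j => f (mem.getD i false) (mem.getD j false)

/-- The memory after executing a list of steps; the step that is executed at time `t` has access to
the random bit `ω t`. -/
noncomputable def exec {n : ℕ} (G : SimpleGraph (Fin n)) (ω : ℕ → Bool) :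
    List (GraphInstr n) → List Bool → List Bool
  | [], mem => mem
  | c :: cs, mem => exec G ω cs (mem ++ [stepValue G (ω mem.length) mem c])

/-- The output `A(G; ω)`: the bit computed in the last step (`false` if there is no step). -/
noncomputable def output {n : ℕ} (A : GraphAlgorithm n) (G : SimpleGraph (Fin n))
    (ω : Fin A.time → Bool) : Bool :=
  (exec G (fun t => if h : t < A.time then ω ⟨t, h⟩ else false) A []).getLastD false

/-- The probability, over uniformly random bits, that `A` outputs `b` on the fixed input `G`. -/
noncomputable def outputProb {n : ℕ} (A : GraphAlgorithm n) (G : SimpleGraph (Fin n)) (b : Bool) :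
    ℝ≥0∞ :=
  ((Finset.univ.filter fun ω : Fin A.time → Bool => A.output G ω = b).card : ℝ≥0∞) / 2 ^ A.time

end GraphAlgorithm

/-- A sequence of randomized tests `A i`, the `i`-th one on graphs with `N i` vertices, runs in
polynomial time if the running time of `A i` is at most a fixed polynomial in `N i`. -/
def RunsInPolyTime {N : ℕ → ℕ} (A : ∀ i, GraphAlgorithm (N i)) : Prop :=
  ∃ c : Polynomial ℕ, ∀ i, (A i).time ≤ c.eval (N i)

/-! ### Detection problems -/

/-- A detection problem on `n`-vertex graphs: a simple hypothesis `H₀` against a (possibly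
composite) hypothesis `H₁`. -/
structure DetectionProblem (n : ℕ) where
  H₀ : Measure (SimpleGraph (Fin n))
  H₁ : Set (Measure (SimpleGraph (Fin n)))

/-- Type I+II error: `ℙ_{H₀}[A = 1] + sup_{P ∈ H₁} ℙ_P[A = 0]`. -/
noncomputable def DetectionProblem.error {n : ℕ} (D : DetectionProblem n) (A : GraphAlgorithm n) :
    ℝ≥0∞ :=
  (∫⁻ G, A.outputProb G true ∂D.H₀) + ⨆ P ∈ D.H₁, ∫⁻ G, A.outputProb G false ∂P

/-! ### Planted clique -/

/-- The law of `G(n, p)` with a clique planted on a uniformly random `k`-subset of the vertices. -/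
noncomputable def plantedClique (n k : ℕ) (p : I) : Measure (SimpleGraph (Fin n)) :=
  ((n.choose k : ℝ≥0∞)⁻¹) • ∑ S ∈ Finset.powersetCard k (Finset.univ : Finset (Fin n)),
    (SimpleGraph.binomialRandom (Fin n) p).map
      fun G => G ⊔ SimpleGraph.fromRel fun u v => u ∈ S ∧ v ∈ S

/-- Planted clique detection: `G(n, p)` against `G(n, k, p)`. -/
noncomputable def plantedCliqueDetection (n k : ℕ) (p : I) : DetectionProblem n where
  H₀ := SimpleGraph.binomialRandom (Fin n) p
  H₁ := {plantedClique n k p}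

/-- The planted clique conjecture at edge density `p`. -/
def PlantedCliqueConjecture (p : I) : Prop :=
  ∀ (A : ∀ n : ℕ, GraphAlgorithm n) (k : ℕ → ℕ),
    RunsInPolyTime (N := fun n => n) A →
    (∀ n, 0 < k n) →
    limsup (fun n : ℕ => ((Real.log (k n) / Real.log n : ℝ) : EReal)) atTop < ((1 / 2 : ℝ) : EReal) →
    1 ≤ liminf (fun n : ℕ => (plantedCliqueDetection n (k n) p).error (A n)) atTop

/-! ### The subgraph stochastic block model -/

/-- The random graph in which each edge `e` is present independently with probability `p e`
(the values of `p` on the diagonal of `Sym2 (Fin n)` are irrelevant). -/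
noncomputable def inhomogeneousRandomGraph {n : ℕ} (p : Sym2 (Fin n) → I) :
    Measure (SimpleGraph (Fin n)) :=
  (Measure.pi fun e => ProbabilityTheory.bernoulliMeasure true false (p e)).map
    fun x => SimpleGraph.fromEdgeSet {e | x e = true}

/-- The law of a random graph after a uniformly random permutation of its vertices. -/
noncomputable def randomlyPermuted {n : ℕ} (P : Measure (SimpleGraph (Fin n))) :
    Measure (SimpleGraph (Fin n)) :=
  ((n.factorial : ℝ≥0∞)⁻¹) • ∑ τ : Equiv.Perm (Fin n), P.map fun G => G.map τ.toEmbedding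

/-- `p` is an admissible table of edge probabilities for the communities
`S = {0, …, k₁ - 1}` and `T = {k₁, …, k₁ + k₂ - 1}`. -/
structure IsBlockProbability {n : ℕ} (k₁ k₂ : ℕ) (q ρ : ℝ) (p : Sym2 (Fin n) → I) : Prop where
  within_S : ∀ u v : Fin n, u ≠ v → u.val < k₁ → v.val < k₁ → q + ρ ≤ p s(u, v)
  within_T : ∀ u v : Fin n, u ≠ v → k₁ ≤ u.val → u.val < k₁ + k₂ → k₁ ≤ v.val → v.val < k₁ + k₂ →
    q + ρ ≤ p s(u, v)
  between : ∀ u v : Fin n, u.val < k₁ → k₁ ≤ v.val → v.val < k₁ + k₂ → p s(u, v) ≤ q - ρ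
  other : ∀ u v : Fin n, u ≠ v → k₁ + k₂ ≤ v.val → (p s(u, v) : ℝ) = q

/-- The set `G_B(n, k, q, ρ)` of laws of the subgraph stochastic block model, with tolerance
exponent `δ` for the sizes of the two communities. -/
def subgraphSBM (δ : ℝ) (n k : ℕ) (q ρ : ℝ) : Set (Measure (SimpleGraph (Fin n))) :=
  {P | ∃ k₁ k₂ : ℕ, 0 < k₁ ∧ 0 < k₂ ∧ k₁ + k₂ ≤ n ∧
    (k : ℝ) / 2 - (k : ℝ) ^ (1 - δ) ≤ k₁ ∧ (k₁ : ℝ) ≤ (k : ℝ) / 2 + (k : ℝ) ^ (1 - δ) ∧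
    (k : ℝ) / 2 - (k : ℝ) ^ (1 - δ) ≤ k₂ ∧ (k₂ : ℝ) ≤ (k : ℝ) / 2 + (k : ℝ) ^ (1 - δ) ∧
    ∃ p : Sym2 (Fin n) → I, IsBlockProbability k₁ k₂ q ρ p ∧
      P = randomlyPermuted (inhomogeneousRandomGraph p)}

/-- Detection in the subgraph stochastic block model: `G(n, q)` against `G_B(n, k, q, ρ)`. -/
noncomputable def ssbmDetection (δ : ℝ) (n k : ℕ) (q : I) (ρ : ℝ) : DetectionProblem n where
  H₀ := SimpleGraph.binomialRandom (Fin n) q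
  H₁ := subgraphSBM δ n k q ρ

/-! ### Circuits -/

namespace GraphAlgorithm

/-! The proof is an average-case reduction: a good test for the block model on `N` vertices, with `n
≤ N ≤ 4 * n`, would yield a good test for a planted clique of size `2k ≈ n^κ` with `κ < 1/2`.

Suppose a symmetric Gaussian matrix carries the mean `μ 1_S 1_Sᵀ`, diagonal included. Conjugation by
an orthogonal matrix `R` preserves the noise and turns the mean into `μ (R 1_S)(R 1_S)ᵀ`. Let `R` be
block diagonal with normalized Hadamard blocks of order `2^l ≈ n^x`. Up to the factor `2^(-l/2)`, `R
1_S` is an integer vector `A`; each nonconstant Hadamard column has as many `+1` as `-1`, and if few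
vertices of `S` share a block, `A` is positive on about `K/2` rows and negative on about `K/2`,
where `K = k 2^l`. The mean `μ 2^(-l) A_u A_v` is at least `μ 2^(-l)` inside the two sign classes,
at most `-μ 2^(-l)` between them, and zero elsewhere. Thresholding at the `q`-quantile gives the
block model with a gap of order `μ 2^(-l)` (`exists_isBlockProbability`,
`mul_card_le_two_mul_card_pos`, `exists_sparse_sign_matrix`). The model only asks for a gap of at
least `ρ`, so `x ≤ α` suffices.

Three obstacles lie between a graph and such a matrix. The adjacency matrix has no planted diagonal.
A random vertex set `D` is therefore kept, and membership in `D` serves as the diagonal bit. A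
clique `C` then leaves a complete planted block on `C ∩ D`; the absence of `C \ D` from `D` is
detectable only with advantage controlled by `k²/n`, by a second moment computation
(`sum_two_pow_card_inter_le`, `sum_inter_le_sum_inter_union`). Here `κ < 1/2` is used. Bits must
become Gaussians. `N(0,1)` is the midpoint of two laws, one of which is `N(μ,1)` conditioned on a
half-line (`exists_gaussian_split`), so fair bits give exactly standard Gaussians, and planted bits
give laws dominated by `N(μ,1)` up to a factor close to `1`. With `μ` of order `1 / log n`, the
product of these factors over the planted pairs tends to `1`. The model of computation has only
bits. The matrix is truncated and rounded to a grid; integer sums are compared with a threshold by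
dynamic programming (`computableWithin_threshold_list`). Since algorithms may depend on `n`
arbitrarily, all random choices of the reduction, real ones included, are replaced by one fixed seed
that is no worse than average (`exists_seed_le`).

`exists_reduction` adds up the losses, `exists_ssbm_reduction` specializes to Hadamard blocks, and
`exists_exponents` chooses `x + κ = β` so that all losses vanish. -/

theorem exec_append {n : ℕ} (G : SimpleGraph (Fin n)) (ω : ℕ → Bool) (A B : List (GraphInstr n))
    (mem : List Bool) : exec G ω (A ++ B) mem = exec G ω B (exec G ω A mem) := by
  induction A generalizing mem with
  | nil => rfl
  | cons c cs ih => exact ih _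

theorem length_exec {n : ℕ} (G : SimpleGraph (Fin n)) (ω : ℕ → Bool) (A : List (GraphInstr n))
    (mem : List Bool) : (exec G ω A mem).length = mem.length + A.length := by
  induction A generalizing mem with
  | nil => rfl
  | cons c cs ih => simp only [exec, ih, List.length_append, List.length_cons, List.length_nil]; ring

/-- The deterministic program `A` computes the list of bits `bs` (as functions of the input). -/
def Computes {n : ℕ} (A : GraphAlgorithm n) (bs : List (SimpleGraph (Fin n) → Bool)) : Prop :=
  ∀ G ω, exec G ω A [] = bs.map fun b => b G

theorem Computes.length_eq {n : ℕ} {A : GraphAlgorithm n} {bs : List (SimpleGraph (Fin n) → Bool)}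
    (h : A.Computes bs) : A.length = bs.length := by
  have := congrArg List.length (h ⊥ fun _ => false)
  simpa [length_exec] using this

/-- Some program computes the list of bits `bs`. -/
def Computable {n : ℕ} (bs : List (SimpleGraph (Fin n) → Bool)) : Prop :=
  ∃ A : GraphAlgorithm n, A.Computes bs

theorem computable_nil {n : ℕ} : Computable (n := n) [] := ⟨[], fun _ _ => rfl⟩

open Classical in
theorem Computable.edge {n : ℕ} {bs : List (SimpleGraph (Fin n) → Bool)} (h : Computable bs)
    (u v : Fin n) : Computable (bs ++ [fun G => decide (G.Adj u v)]) := by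
  obtain ⟨A, hA⟩ := h
  refine ⟨A ++ [.edge u v], fun G ω => ?_⟩
  rw [exec_append, hA]
  simp [exec, stepValue]

theorem Computable.gate {n : ℕ} {bs : List (SimpleGraph (Fin n) → Bool)} (h : Computable bs)
    (f : Bool → Bool → Bool) {a b : SimpleGraph (Fin n) → Bool} (ha : a ∈ bs) (hb : b ∈ bs) :
    Computable (bs ++ [fun G => f (a G) (b G)]) := by
  obtain ⟨A, hA⟩ := h
  obtain ⟨i, hi, rfl⟩ := List.getElem_of_mem ha
  obtain ⟨j, hj, rfl⟩ := List.getElem_of_mem hb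
  refine ⟨A ++ [.gate f i j], fun G ω => ?_⟩
  rw [exec_append, hA]
  simp [exec, stepValue, hi, hj]

theorem Computable.const {n : ℕ} {bs : List (SimpleGraph (Fin n) → Bool)} (h : Computable bs)
    (c : Bool) : Computable (bs ++ [fun _ => c]) := by
  obtain ⟨A, hA⟩ := h
  -- The addresses are immaterial, since the gate ignores its arguments; they need not even be in
  -- use.
  refine ⟨A ++ [.gate (fun _ _ => c) 0 0], fun G ω => ?_⟩
  rw [exec_append, hA]
  simp [exec, stepValue]

/-- From every computed list of bits one can compute the bits `h i` in at most `c` further steps. -/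
def ComputableWithin {n : ℕ} {ι : Type*} (c : ℕ) (h : ι → SimpleGraph (Fin n) → Bool) : Prop :=
  ∀ bs, Computable bs → ∃ bs', Computable (bs ++ bs') ∧ bs'.length ≤ c ∧ ∀ i, h i ∈ bs ++ bs'

theorem ComputableWithin.mono {n : ℕ} {ι : Type*} {c c' : ℕ} {h : ι → SimpleGraph (Fin n) → Bool}
    (hc : ComputableWithin c h) (hcc : c ≤ c') : ComputableWithin c' h := fun bs hbs => by
  obtain ⟨bs', h1, h2, h3⟩ := hc bs hbs
  exact ⟨bs', h1, h2.trans hcc, h3⟩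

theorem computableWithin_const {n : ℕ} (c : Bool) :
    ComputableWithin (n := n) 1 (fun (_ : Unit) _ => c) := fun bs hbs =>
  ⟨_, hbs.const c, by simp, by simp⟩

open Classical in
theorem computableWithin_edge {n : ℕ} (u v : Fin n) :
    ComputableWithin 1 (fun (_ : Unit) G => decide (G.Adj u v)) := fun bs hbs =>
  ⟨_, hbs.edge u v, by simp, by simp⟩

/-- Bits stay in memory, so a later stage reads the earlier ones for free and the step counts add.
-/
theorem ComputableWithin.bind {n : ℕ} {ι κ : Type*} {c d : ℕ}
    {h : ι → SimpleGraph (Fin n) → Bool} {h' : κ → SimpleGraph (Fin n) → Bool}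
    (hc : ComputableWithin c h)
    (hd : ∀ bs, Computable bs → (∀ i, h i ∈ bs) →
      ∃ bs', Computable (bs ++ bs') ∧ bs'.length ≤ d ∧ ∀ i, h' i ∈ bs ++ bs') :
    ComputableWithin (c + d) h' := fun bs hbs => by
  obtain ⟨b1, h1, h2, h3⟩ := hc bs hbs
  obtain ⟨b2, h4, h5, h6⟩ := hd _ h1 h3
  refine ⟨b1 ++ b2, by simpa using h4, ?_, by simpa using h6⟩
  simp only [List.length_append]; omega

theorem ComputableWithin.finset {n : ℕ} {ι : Type*} {c : ℕ}
    {h : ι → SimpleGraph (Fin n) → Bool} (hc : ∀ i, ComputableWithin c fun _ : Unit => h i)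
    (s : Finset ι) : ComputableWithin (s.card * c) fun i : s => h i := by
  classical
  induction s using Finset.induction_on with
  | empty => exact fun bs hbs => ⟨[], by simpa using hbs, by simp, fun i => absurd i.2 (Finset.notMem_empty _)⟩
  | insert a s ha ih =>
    rw [Finset.card_insert_of_notMem ha, add_mul, one_mul]
    refine ih.bind fun bs hbs hmem => ?_
    obtain ⟨b, h1, h2, h3⟩ := hc a bs hbs
    refine ⟨b, h1, h2, fun i => ?_⟩
    rcases Finset.mem_insert.1 i.2 with hi | hi
    · rw [hi]; exact h3 ()
    · exact List.mem_append_left _ (hmem ⟨i, hi⟩)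

theorem ComputableWithin.fintype {n : ℕ} {ι : Type*} [Fintype ι] {c : ℕ}
    {h : ι → SimpleGraph (Fin n) → Bool} (hc : ∀ i, ComputableWithin c fun _ : Unit => h i) :
    ComputableWithin (Fintype.card ι * c) h := fun bs hbs => by
  obtain ⟨b, h1, h2, h3⟩ := ComputableWithin.finset hc Finset.univ bs hbs
  exact ⟨b, h1, h2, fun i => h3 ⟨i, Finset.mem_univ i⟩⟩

theorem Computable.mux {n : ℕ} {bs : List (SimpleGraph (Fin n) → Bool)} (h : Computable bs)
    {x a b : SimpleGraph (Fin n) → Bool} (hx : x ∈ bs) (ha : a ∈ bs) (hb : b ∈ bs) :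
    ∃ bs', Computable (bs ++ bs') ∧ bs'.length ≤ 3 ∧
      (fun G => bif x G then a G else b G) ∈ bs ++ bs' := by
  have h1 := h.gate (· && ·) hx ha
  have h2 := h1.gate (fun p q => !p && q) (List.mem_append_left _ hx) (List.mem_append_left _ hb)
  have h3 := h2.gate (· || ·) (a := fun G => x G && a G) (b := fun G => !x G && b G)
    (by simp) (by simp)
  refine ⟨_, by simpa using h3, by simp, ?_⟩
  simp only [List.mem_append, List.mem_cons]
  right; right; right; left
  funext G
  cases x G <;> simp

theorem Computable.mux_finset {n : ℕ} {ι : Type*} (s : Finset ι)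
    {bs : List (SimpleGraph (Fin n) → Bool)} (h : Computable bs)
    {x : SimpleGraph (Fin n) → Bool} {a b : ι → SimpleGraph (Fin n) → Bool} (hx : x ∈ bs)
    (ha : ∀ i ∈ s, a i ∈ bs) (hb : ∀ i ∈ s, b i ∈ bs) :
    ∃ bs', Computable (bs ++ bs') ∧ bs'.length ≤ s.card * 3 ∧
      ∀ i ∈ s, (fun G => bif x G then a i G else b i G) ∈ bs ++ bs' := by
  classical
  induction s using Finset.induction_on with
  | empty => exact ⟨[], by simpa using h, by simp, by simp⟩
  | insert j s hj ih =>
    obtain ⟨b1, h1, h2, h3⟩ := ih (fun i hi => ha i (Finset.mem_insert_of_mem hi))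
      (fun i hi => hb i (Finset.mem_insert_of_mem hi))
    obtain ⟨b2, h4, h5, h6⟩ := h1.mux (List.mem_append_left _ hx)
      (List.mem_append_left _ (ha j (by simp))) (List.mem_append_left _ (hb j (by simp)))
    refine ⟨b1 ++ b2, by simpa using h4, ?_, fun i hi => ?_⟩
    · rw [Finset.card_insert_of_notMem hj, List.length_append]; omega
    · rw [← List.append_assoc]
      rcases Finset.mem_insert.1 hi with rfl | hi
      · exact h6
      · exact List.mem_append_left _ (h3 i hi)

/-- The threshold of a sum of bounded integers, the `i`-th of which is determined by a single
computable bit, is computable by dynamic programming over the partial sums. -/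
theorem computableWithin_threshold_list {n : ℕ} {ι : Type*} (x : ι → SimpleGraph (Fin n) → Bool)
    (hx : ∀ i, ComputableWithin 1 fun _ : Unit => x i) (w : ι → Bool → ℤ) (W : ℕ)
    (hw : ∀ i b, |w i b| ≤ W) (thr : ℤ) (l : List ι) (M : ℕ) :
    ComputableWithin ((l.length + 1) * ((2 * (M + l.length * W) + 1) * 3 + 1))
      (fun (s : Finset.Icc (-M : ℤ) M) G =>
        decide (thr < s + (l.map fun i => w i (x i G)).sum)) := by
  induction l generalizing M with
  | nil =>
    have := ComputableWithin.finset (n := n) (c := 1) (h := fun (s : ℤ) _ => decide (thr < s))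
      (fun i => computableWithin_const _) (Finset.Icc (-M : ℤ) M)
    refine ComputableWithin.mono (c := _) (by simpa using this) ?_
    simp only [List.length_nil]
    zify
    rw [Int.toNat_of_nonneg (by omega)]
    push_cast
    nlinarith
  | cons i l ih =>
    -- One term moves a partial sum by at most `W`, so the tail of the list must be solved for every
    -- starting value in the enlarged window; each starting value in the old window then costs one
    -- three-gate multiplexer.
    have h1 := ih (M + W)
    have h2 : ComputableWithin ((l.length + 1) * ((2 * (M + W + l.length * W) + 1) * 3 + 1) +
        ((2 * M + 1) * 3 + 1)) (fun (s : Finset.Icc (-M : ℤ) M) G =>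
        decide (thr < s + ((i :: l).map fun i => w i (x i G)).sum)) := by
      refine h1.bind fun bs hbs hmem => ?_
      obtain ⟨b1, h3, h4, h5⟩ := hx i bs hbs
      have key : ∀ s ∈ Finset.Icc (-M : ℤ) M, ∀ b, (fun G =>
          decide (thr < (s + w i b) + (l.map fun i => w i (x i G)).sum)) ∈ bs ++ b1 := by
        intro s hs b
        have := abs_le.1 (hw i b)
        rw [Finset.mem_Icc] at hs
        exact List.mem_append_left _ (hmem ⟨s + w i b, by
          rw [Finset.mem_Icc]; push_cast; constructor <;> omega⟩)
      obtain ⟨b2, h6, h7, h8⟩ := h3.mux_finset (Finset.Icc (-M : ℤ) M) (h5 ())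
        (fun s hs => key s hs true) (fun s hs => key s hs false)
      refine ⟨b1 ++ b2, by simpa using h6, ?_, fun s => ?_⟩
      · rw [Int.card_Icc] at h7
        rw [List.length_append]
        omega
      · rw [← List.append_assoc]
        convert h8 s s.2 using 2 with G
        cases hxi : x i G <;> simp [hxi, add_assoc]
    refine h2.mono ?_
    simp only [List.length_cons]
    nlinarith [Nat.zero_le (l.length * W), Nat.zero_le W]

theorem computableWithin_threshold {n : ℕ} {ι : Type*} [Fintype ι]
    (x : ι → SimpleGraph (Fin n) → Bool)
    (hx : ∀ i, ComputableWithin 1 fun _ : Unit => x i) (w : ι → Bool → ℤ) (W : ℕ)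
    (hw : ∀ i b, |w i b| ≤ W) (thr : ℤ) :
    ComputableWithin ((Fintype.card ι + 1) * ((2 * (Fintype.card ι * W) + 1) * 3 + 1))
      (fun (_ : Unit) G => decide (thr < ∑ i, w i (x i G))) := fun bs hbs => by
  obtain ⟨b, h1, h2, h3⟩ :=
    computableWithin_threshold_list x hx w W hw thr Finset.univ.toList 0 bs hbs
  refine ⟨b, h1, by simpa using h2, fun _ => ?_⟩
  simpa using h3 ⟨0, by simp⟩

/-! ### Composing a test with a computable graph transformation -/

/-- Run the algorithm `φ` on the graph whose adjacency bits are found at the addresses `addr` of a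
memory of size `s`. -/
def translate {n N : ℕ} (s : ℕ) (addr : Fin N → Fin N → ℕ) : GraphInstr N → GraphInstr n
  | .edge u v => .gate (fun a _ => a) (addr u v) (addr u v)
  | .toss => .toss
  | .gate f i j => .gate f (s + i) (s + j)

-- The prefix shifts both the addresses and the coin indices of `φ` by its length. Addresses not yet
-- in use remain so after the shift, hence read as `false` on both sides.
open Classical in
theorem exec_translate {n N : ℕ} (addr : Fin N → Fin N → ℕ) (pre : List Bool)
    (G : SimpleGraph (Fin n)) (H : SimpleGraph (Fin N))
    (haddr : ∀ u v, pre[addr u v]? = some (decide (H.Adj u v)))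
    (φ : GraphAlgorithm N) (ω : ℕ → Bool) (mem : List Bool) :
    exec G ω (φ.map (translate pre.length addr)) (pre ++ mem) =
      pre ++ exec H (fun t => ω (pre.length + t)) φ mem := by
  induction φ generalizing mem with
  | nil => rfl
  | cons c cs ih =>
    have hstep : stepValue G (ω (pre ++ mem).length) (pre ++ mem) (translate pre.length addr c) =
        stepValue H (ω (pre.length + mem.length)) mem c := by
      cases c with
      | edge u v =>
        have h1 := haddr u v
        have h2 : addr u v < pre.length := by
          by_contra hcon
          rw [List.getElem?_eq_none (by omega)] at h1
          simp at h1
        simp [translate, stepValue, List.getD_eq_getElem?_getD, List.getElem?_append_left h2, h1]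
      | toss => simp [translate, stepValue]
      | gate f i j =>
        simp [translate, stepValue, List.getD_eq_getElem?_getD,
          List.getElem?_append_right (Nat.le_add_right _ _)]
    simp only [List.map_cons, exec]
    rw [hstep, List.append_assoc, ih]

/-- The first `s` coins belong to the deterministic prefix and are never consulted; the factor `2 ^
s` cancels in `outputProb`. -/
theorem card_filter_natAdd (s t : ℕ) (P : (Fin t → Bool) → Prop) [DecidablePred P] :
    (Finset.univ.filter fun ω : Fin (s + t) → Bool => P fun i => ω (Fin.natAdd s i)).card =
      2 ^ s * (Finset.univ.filter P).card := by
  classical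
  let e : (Fin (s + t) → Bool) ≃ (Fin s → Bool) × (Fin t → Bool) :=
    (Fin.appendEquiv s t).symm
  have : (Finset.univ.filter fun ω : Fin (s + t) → Bool => P fun i => ω (Fin.natAdd s i)) =
      ((Finset.univ : Finset (Fin s → Bool)) ×ˢ Finset.univ.filter P).map e.symm.toEmbedding := by
    ext ω
    simp only [Finset.mem_filter, Finset.mem_univ, true_and, Finset.mem_map_equiv, Equiv.symm_symm,
      Finset.mem_product]
    rfl
  rw [this, Finset.card_map, Finset.card_product]
  simp

open Classical in
/-- Composition of a randomized test with a deterministic graph transformation computable in `c`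
steps. -/
theorem exists_comp {n N : ℕ} {c : ℕ} (F : SimpleGraph (Fin n) → SimpleGraph (Fin N))
    (hF : ComputableWithin c fun (e : Fin N × Fin N) G => decide ((F G).Adj e.1 e.2))
    (φ : GraphAlgorithm N) :
    ∃ A : GraphAlgorithm n, A.time ≤ c + 1 + φ.time ∧
      ∀ G b, A.outputProb G b = φ.outputProb (F G) b := by
  obtain ⟨bs, hbs, hlen, hmem⟩ := hF [] computable_nil
  rw [List.nil_append] at hbs hmem
  -- The extra last bit matters when `φ` is the empty program: the composed program then outputs the
  -- last bit of the prefix, which has to be the default `false`.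
  obtain ⟨A, hA⟩ := hbs.const false
  have hmem' : ∀ u v : Fin N, ∃ i, ∃ h : i < bs.length,
      bs[i] = fun G => decide ((F G).Adj u v) := fun u v => by
    obtain ⟨i, hi, h⟩ := List.getElem_of_mem (hmem (u, v))
    exact ⟨i, hi, h⟩
  choose addr haddr hbs' using hmem'
  have hAlen : A.length = bs.length + 1 := by simpa using hA.length_eq
  refine ⟨A ++ φ.map (translate (bs.length + 1) addr), ?_, fun G b => ?_⟩
  · simp only [time, List.length_append, List.length_map]; omega
  · set pre : List Bool := List.map (fun a : SimpleGraph (Fin n) → Bool => a G) (bs ++ [fun _ => false]) with hpre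
    have hprelen : pre.length = bs.length + 1 := by simp [hpre]
    have hexec : ∀ ω : ℕ → Bool, exec G ω (A ++ φ.map (translate (bs.length + 1) addr)) [] =
        pre ++ exec (F G) (fun t => ω (pre.length + t)) φ [] := fun ω => by
      rw [exec_append, hA, ← hpre, ← hprelen]
      have := exec_translate addr pre G (F G) (fun u v => by
        simp only [hpre, List.map_append, List.getElem?_append_left (l₁ := bs.map fun a => a G)
          (by simpa using haddr u v)]
        rw [List.getElem?_map, List.getElem?_eq_getElem (haddr u v), hbs']
        simp) φ ω []
      simpa using this
    have hout : ∀ ω : ℕ → Bool, (exec G ω (A ++ φ.map (translate (bs.length + 1) addr)) []).getLastD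
        false = (exec (F G) (fun t => ω (pre.length + t)) φ []).getLastD false := fun ω => by
      rw [hexec]
      cases h : exec (F G) (fun t => ω (pre.length + t)) φ [] with
      | nil => simp [hpre]
      | cons a l =>
        rw [List.getLastD_eq_getLast?, List.getLastD_eq_getLast?, List.getLast?_append,
          List.getLast?_eq_some_getLast (List.cons_ne_nil a l)]
        simp
    have htime : (A ++ φ.map (translate (n := n) (bs.length + 1) addr)).time =
        (bs.length + 1) + φ.time := by simp [time, hAlen]
    unfold outputProb output
    simp_rw [hout]
    have hcard := card_filter_natAdd (bs.length + 1) φ.time (fun ω : Fin φ.time → Bool =>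
      (exec (F G) (fun t => if h : t < φ.time then ω ⟨t, h⟩ else false) φ []).getLastD false = b)
    have hcast : ∀ (T : ℕ) (hT : T = (bs.length + 1) + φ.time),
        (Finset.univ.filter fun ω : Fin T → Bool =>
          (exec (F G) (fun t => if h : pre.length + t < T then ω ⟨pre.length + t, h⟩ else false)
            φ []).getLastD false = b).card =
        (Finset.univ.filter fun ω : Fin ((bs.length + 1) + φ.time) → Bool =>
          (exec (F G) (fun t => if h : t < φ.time then
            ω (Fin.natAdd (bs.length + 1) ⟨t, h⟩) else false) φ []).getLastD false = b).card := by
      rintro T rfl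
      congr 1
      ext ω
      simp only [Finset.mem_filter, Finset.mem_univ, true_and]
      rw [show (fun t => if h : pre.length + t < bs.length + 1 + φ.time then
        ω ⟨pre.length + t, h⟩ else false) = fun t => if h : t < φ.time then
            ω (Fin.natAdd (bs.length + 1) ⟨t, h⟩) else false from ?_]
      funext t
      by_cases ht : t < φ.time
      · rw [dif_pos (by omega), dif_pos ht]
        congr 1
        ext
        simp [hprelen]
      · rw [dif_neg (by omega), dif_neg ht]
    rw [hcast _ htime, hcard, htime, pow_add (2 : ℝ≥0∞) (bs.length + 1), Nat.cast_mul, Nat.cast_pow,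
      Nat.cast_ofNat, ENNReal.mul_div_mul_left _ _ (by simp) (by simp)]

end GraphAlgorithm

/-! ### Measures on graphs and product measures -/

instance {V : Type*} [Finite V] : MeasurableSingletonClass (SimpleGraph V) where
  measurableSet_singleton G := by
    have : ({G} : Set (SimpleGraph V)) = SimpleGraph.edgeSet ⁻¹' {G.edgeSet} := by
      ext H; simp
    rw [this]
    exact SimpleGraph.measurable_edgeSet (Set.toFinite _).measurableSet

theorem measurable_fromEdgeSet_bool {n : ℕ} :
    Measurable fun x : Sym2 (Fin n) → Bool => SimpleGraph.fromEdgeSet {e | x e = true} :=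
  measurable_of_finite _

instance {n : ℕ} (p : Sym2 (Fin n) → I) : IsProbabilityMeasure (inhomogeneousRandomGraph p) :=
  Measure.isProbabilityMeasure_map (measurable_of_finite _).aemeasurable

theorem binomialRandom_eq_inhomogeneousRandomGraph (n : ℕ) (p : I) :
    SimpleGraph.binomialRandom (Fin n) p = inhomogeneousRandomGraph fun _ => p := by
  rw [SimpleGraph.binomialRandom_eq_map, ProbabilityTheory.setBernoulli_eq_map,
    Measure.infinitePi_eq_pi, inhomogeneousRandomGraph]
  have h1 : (fun e : Sym2 (Fin n) => toNNReal p • Measure.dirac (e ∈ (Sym2.diagSetᶜ : Set (Sym2 (Fin n)))) +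
      toNNReal (σ p) • Measure.dirac False) = fun e : Sym2 (Fin n) =>
      (ProbabilityTheory.bernoulliMeasure true false p).map
        fun b => (b = true ∧ e ∈ (Sym2.diagSetᶜ : Set (Sym2 (Fin n)))) := by
    funext e
    rw [ProbabilityTheory.map_bernoulliMeasure' _ _ (measurable_of_finite _)]
    simp [ProbabilityTheory.bernoulliMeasure]
  rw [h1, ← Measure.pi_map_pi (fun e => (measurable_of_finite _).aemeasurable),
    Measure.map_map (by fun_prop) (by fun_prop), Measure.map_map (by fun_prop) (by fun_prop)]
  congr 1
  funext x
  ext u v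
  simp +contextual

/-- Compare characteristic functions: the value at `t` after the map is the value at `Cᵀ t` before
it, and `⟨Cᵀ t, a⟩ = ⟨t, C a⟩`, `‖Cᵀ t‖ = ‖t‖`. Only orthonormality of the rows is needed, so `C`
may have more columns than rows. -/
theorem pi_gaussianReal_map_mulVec {ι κ : Type*} [Fintype ι] [Fintype κ] [DecidableEq κ]
    (C : Matrix κ ι ℝ) (hC : C * C.transpose = 1) (a : ι → ℝ) :
    (Measure.pi fun i => ProbabilityTheory.gaussianReal (a i) 1).map (fun z => C.mulVec z) =
      Measure.pi fun j => ProbabilityTheory.gaussianReal (C.mulVec a j) 1 := by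
  have hmeas : Measurable fun z : ι → ℝ => C.mulVec z := by
    refine measurable_pi_lambda _ fun j => ?_
    simp only [Matrix.mulVec, dotProduct]
    fun_prop
  have := Measure.isProbabilityMeasure_map (μ := Measure.pi fun i =>
    ProbabilityTheory.gaussianReal (a i) 1) hmeas.aemeasurable
  refine charFun_eq_pi_iff.1 fun t => ?_
  set s : PiLp 2 (fun _ : ι => ℝ) := WithLp.toLp 2 (C.transpose.mulVec (WithLp.ofLp t)) with hs
  have h1 : charFun (((Measure.pi fun i => ProbabilityTheory.gaussianReal (a i) 1).map
      (fun z => C.mulVec z)).map (WithLp.toLp 2)) t =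
      charFun ((Measure.pi fun i => ProbabilityTheory.gaussianReal (a i) 1).map (WithLp.toLp 2)) s := by
    rw [charFun_apply, charFun_apply, integral_map (by fun_prop) (by fun_prop),
      integral_map hmeas.aemeasurable (by fun_prop), integral_map (by fun_prop) (by fun_prop)]
    congr 1
    funext z
    congr 2
    simp only [hs, PiLp.inner_apply, RCLike.inner_apply, conj_trivial, Complex.ofReal_inj]
    change (WithLp.ofLp t) ⬝ᵥ C.mulVec z = (C.transpose.mulVec (WithLp.ofLp t)) ⬝ᵥ z
    rw [Matrix.dotProduct_mulVec, Matrix.mulVec_transpose]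
  rw [h1, charFun_pi]
  simp_rw [ProbabilityTheory.charFun_gaussianReal]
  rw [← Complex.exp_sum, ← Complex.exp_sum]
  congr 1
  have e1 : ∑ i, s i * a i = ∑ j, t j * C.mulVec a j := by
    change (C.transpose.mulVec (WithLp.ofLp t)) ⬝ᵥ a = (WithLp.ofLp t) ⬝ᵥ C.mulVec a
    rw [Matrix.dotProduct_mulVec, Matrix.mulVec_transpose]
  have e2 : ∑ i, s i ^ 2 = ∑ j, t j ^ 2 := by
    simp_rw [sq]
    change (C.transpose.mulVec (WithLp.ofLp t)) ⬝ᵥ (C.transpose.mulVec (WithLp.ofLp t)) =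
      (WithLp.ofLp t) ⬝ᵥ (WithLp.ofLp t)
    rw [Matrix.dotProduct_mulVec, ← Matrix.mulVec_transpose, Matrix.transpose_transpose,
      Matrix.mulVec_mulVec, hC, Matrix.one_mulVec]
  simp only [Finset.sum_sub_distrib, NNReal.coe_one, Complex.ofReal_one, one_mul,
    ← Finset.sum_mul, ← Finset.sum_div]
  congr 1
  · congr 1; exact_mod_cast e1
  · congr 1; exact_mod_cast e2

/-- Choosing a random coordinate-wise selector independently of the data gives a product of
mixtures. -/
theorem lintegral_pi_select {ι X Y Z : Type*} [Fintype ι] [MeasurableSpace X] [MeasurableSpace Y]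
    [MeasurableSpace Z] (ξ : ι → Measure X) (κ : ι → Measure Y) [∀ i, IsProbabilityMeasure (ξ i)]
    [∀ i, IsProbabilityMeasure (κ i)] {sel : X → Y → Z}
    (hsel : Measurable fun p : X × Y => sel p.1 p.2) {F : (ι → Z) → ℝ≥0∞} (hF : Measurable F) :
    ∫⁻ x, ∫⁻ ω, F (fun i => sel (x i) (ω i)) ∂(Measure.pi κ) ∂(Measure.pi ξ) =
      ∫⁻ z, F z ∂(Measure.pi fun i => ((ξ i).prod (κ i)).map fun p => sel p.1 p.2) := by
  have : ∀ i, IsProbabilityMeasure (((ξ i).prod (κ i)).map fun p => sel p.1 p.2) := fun i =>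
    Measure.isProbabilityMeasure_map hsel.aemeasurable
  have hm : Measurable fun (x : ι → X × Y) i => sel (x i).1 (x i).2 :=
    measurable_pi_lambda _ fun i => hsel.comp (measurable_pi_apply i)
  rw [← Measure.pi_map_pi (fun i => hsel.aemeasurable), lintegral_map hF hm,
    ← lintegral_prod (f := fun p : (ι → X) × (ι → Y) => F fun i => sel (p.1 i) (p.2 i))]
  · have hmp := measurePreserving_arrowProdEquivProdArrow X Y ι ξ κ
    rw [← hmp.map_eq, lintegral_map_equiv]
    rfl
  · refine (hF.comp (f := fun (p : (ι → X) × (ι → Y)) i => sel (p.1 i) (p.2 i))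
      (measurable_pi_lambda _ fun i => ?_)).aemeasurable
    exact hsel.comp (f := fun p : (ι → X) × (ι → Y) => (p.1 i, p.2 i)) (by fun_prop)

/-- The preimage of a box is a box whose sides outside the range of `s` are everything, and these
contribute factors `1`. -/
theorem pi_map_comp_injective {ι κ X : Type*} [Fintype ι] [Fintype κ] [MeasurableSpace X]
    (m : Measure X) [IsProbabilityMeasure m] {s : ι → κ} (hs : Function.Injective s) :
    (Measure.pi fun _ : κ => m).map (fun w i => w (s i)) = Measure.pi fun _ : ι => m := by
  classical
  refine (Measure.pi_eq fun S hS => ?_).symm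
  rw [Measure.map_apply (by fun_prop) (.univ_pi hS)]
  have : (fun (w : κ → X) i => w (s i)) ⁻¹' Set.univ.pi S =
      Set.univ.pi (Function.extend s S fun _ => Set.univ) := by
    ext w
    simp only [Set.mem_preimage, Set.mem_pi, Set.mem_univ, true_implies]
    refine ⟨fun h k => ?_, fun h i => ?_⟩
    · by_cases hk : ∃ i, s i = k
      · obtain ⟨i, rfl⟩ := hk
        rw [hs.extend_apply]; exact h i
      · rw [Function.extend_apply' _ _ _ hk]; trivial
    · simpa [hs.extend_apply] using h (s i)
  rw [this, Measure.pi_pi]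
  refine (Fintype.prod_of_injective s hs _ _ (fun k hk => ?_) fun i => ?_).symm
  · rw [Function.extend_apply' _ _ _ (by simpa using hk), measure_univ]
  · rw [hs.extend_apply]

/-- Used when each bit of a table is copied from one of two independent families: if no source is
read twice, the table is i.i.d. -/
theorem lintegral_pi_sumElim_comp {ι κ X : Type*} [Fintype ι] [Fintype κ] [MeasurableSpace X]
    (m : Measure X) [IsProbabilityMeasure m] {s : ι → κ ⊕ ι} (hs : Function.Injective s)
    {F : (ι → X) → ℝ≥0∞} (hF : Measurable F) :
    ∫⁻ y, ∫⁻ u, F (fun i => Sum.elim y u (s i)) ∂(Measure.pi fun _ : ι => m)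
      ∂(Measure.pi fun _ : κ => m) = ∫⁻ x, F x ∂(Measure.pi fun _ : ι => m) := by
  have hmp := measurePreserving_sumPiEquivProdPi_symm (fun _ : κ ⊕ ι => m)
  have hmeas : Measurable fun p : (κ → X) × (ι → X) => fun i => Sum.elim p.1 p.2 (s i) := by
    refine measurable_pi_lambda _ fun i => ?_
    rcases s i with j | j <;> simp <;> fun_prop
  conv_rhs => rw [← pi_map_comp_injective m hs, lintegral_map hF (by fun_prop), ← hmp.map_eq]
  rw [lintegral_map_equiv, lintegral_prod _ (by
      refine (hF.comp (f := fun p : (κ → X) × (ι → X) => fun i =>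
        (MeasurableEquiv.sumPiEquivProdPi fun _ : κ ⊕ ι => X).symm p (s i)) ?_).aemeasurable
      fun_prop)]
  rfl

/-- The left side is the product measure restricted to a box and scaled; dropping the restriction
only increases it. This bounds the law produced by planted bits by a genuine Gaussian law. -/
theorem pi_smul_restrict_le {ι X : Type*} [Fintype ι] [MeasurableSpace X] (m : ι → Measure X)
    [∀ i, IsProbabilityMeasure (m i)] (c : ι → NNReal) {s : ι → Set X} :
    Measure.pi (fun i => c i • (m i).restrict (s i)) ≤ (∏ i, c i) • Measure.pi m := by
  have h : Measure.pi (fun i => c i • (m i).restrict (s i)) =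
      (∏ i, c i) • (Measure.pi m).restrict (Set.univ.pi s) := by
    refine Measure.pi_eq fun S hS => ?_
    rw [Measure.restrict_pi_pi]
    rw [Measure.smul_apply, Measure.pi_pi, ENNReal.smul_def, ENNReal.ofNNReal_finsetProd, smul_eq_mul,
      ← Finset.prod_mul_distrib]
    exact Finset.prod_congr rfl fun i _ => rfl
  rw [h]
  refine Measure.le_iff.2 fun t _ => ?_
  rw [Measure.smul_apply, Measure.smul_apply]
  gcongr
  exact Measure.restrict_le_self

/-! ### Gaussian estimates -/

-- The bounded expression is the logarithm of the density ratio of the two Gaussians.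
open ProbabilityTheory in
theorem gaussianReal_le_mul (a a' L : ℝ) {s : Set ℝ} (hs : MeasurableSet s)
    (h : ∀ z ∈ s, (a - a') * z - (a ^ 2 - a' ^ 2) / 2 ≤ L) :
    gaussianReal a 1 s ≤ ENNReal.ofReal (Real.exp L) * gaussianReal a' 1 s := by
  rw [gaussianReal_apply _ one_ne_zero, gaussianReal_apply _ one_ne_zero,
    ← lintegral_const_mul _ (measurable_gaussianPDF _ _)]
  refine setLIntegral_mono' hs fun z hz => ?_
  rw [gaussianPDF, gaussianPDF, ← ENNReal.ofReal_mul (Real.exp_pos _).le]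
  refine ENNReal.ofReal_le_ofReal ?_
  rw [gaussianPDFReal, gaussianPDFReal, mul_left_comm, ← Real.exp_add]
  gcongr
  have := h z hz
  simp only [NNReal.coe_one]
  linarith

-- Exponential tilting: comparison with mean `a + 2` makes the log-likelihood ratio equal to `2 * a
-- + 2 - 2 * z`, which decreases along the half-line. A crude exponential rate is enough later.
open ProbabilityTheory in
theorem gaussianReal_Ioi_le (a B : ℝ) :
    gaussianReal a 1 (Set.Ioi B) ≤ ENNReal.ofReal (Real.exp (2 * a + 2 - 2 * B)) := by
  refine (gaussianReal_le_mul a (a + 2) (2 * a + 2 - 2 * B) measurableSet_Ioi fun z hz => ?_).trans ?_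
  · have : B < z := hz
    nlinarith
  · calc _ ≤ ENNReal.ofReal (Real.exp (2 * a + 2 - 2 * B)) * 1 := by gcongr; exact prob_le_one
      _ = _ := mul_one _

open ProbabilityTheory in
/-- The standard Gaussian law is the midpoint of two laws, one of which is a Gaussian of mean `a`
conditioned on a half-line. -/
theorem exists_gaussian_split {a B : ℝ} (ha : 0 ≤ a) (haB : Real.exp (a * B) ≤ 3 / 2)
    (hB : Real.exp (2 * a + 2 - 2 * B) ≤ 1 / 4) :
    ∃ (ν₀ ν₁ : Measure ℝ) (c : NNReal), IsProbabilityMeasure ν₀ ∧ IsProbabilityMeasure ν₁ ∧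
      ν₀ + ν₁ = (2 : NNReal) • gaussianReal 0 1 ∧
      ν₁ = c • (gaussianReal a 1).restrict (Set.Iic B) ∧
      (c : ℝ) ≤ 1 + 2 * Real.exp (2 * a + 2 - 2 * B) := by
  set η := Real.exp (2 * a + 2 - 2 * B) with hη
  have hη0 : 0 < η := Real.exp_pos _
  set P := (gaussianReal a 1).real (Set.Iic B) with hP
  have hP1 : P = 1 - (gaussianReal a 1).real (Set.Ioi B) := by
    rw [hP, ← Set.compl_Ioi, probReal_compl_eq_one_sub measurableSet_Ioi]
  have hPη : 1 - η ≤ P := by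
    rw [hP1]
    have := ENNReal.toReal_le_of_le_ofReal hη0.le (gaussianReal_Ioi_le a B)
    rw [measureReal_def]; linarith
  have hPpos : 0 < P := by linarith
  have hPofReal : gaussianReal a 1 (Set.Iic B) = ENNReal.ofReal P := by
    rw [hP, ofReal_measureReal]
  set c : NNReal := Real.toNNReal P⁻¹ with hc
  have hcR : (c : ℝ) = P⁻¹ := Real.coe_toNNReal _ (inv_pos.2 hPpos).le
  have hcE : (c : ℝ≥0∞) = ENNReal.ofReal P⁻¹ := rfl
  set ν₁ := c • (gaussianReal a 1).restrict (Set.Iic B) with hν₁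
  have hprob : IsProbabilityMeasure ν₁ := ⟨by
    rw [hν₁, Measure.smul_apply, Measure.restrict_apply_univ, hPofReal, ENNReal.smul_def, hcE,
      smul_eq_mul, ← ENNReal.ofReal_mul (inv_pos.2 hPpos).le, inv_mul_cancel₀ hPpos.ne',
      ENNReal.ofReal_one]⟩
  -- This is what makes the complementary law `ν₀` a positive measure. Below `B` the density ratio
  -- of `N(a,1)` to `N(0,1)` is at most `exp (a * B) ≤ 3 / 2`, and the normalization divides by `P ≥
  -- 3 / 4`.
  have hle : ν₁ ≤ (2 : NNReal) • gaussianReal 0 1 := by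
    refine Measure.le_iff.2 fun s hs => ?_
    rw [hν₁, Measure.smul_apply, Measure.restrict_apply hs, Measure.smul_apply, ENNReal.smul_def,
      ENNReal.smul_def, hcE, smul_eq_mul, smul_eq_mul]
    have h1 := gaussianReal_le_mul a 0 (a * B) (hs.inter (measurableSet_Iic (a := B)))
      fun z hz => by
        have : z ≤ B := hz.2
        nlinarith [sq_nonneg a]
    calc ENNReal.ofReal P⁻¹ * gaussianReal a 1 (s ∩ Set.Iic B)
        ≤ ENNReal.ofReal P⁻¹ * (ENNReal.ofReal (Real.exp (a * B)) *
          gaussianReal 0 1 s) := by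
          gcongr
          refine h1.trans ?_
          gcongr
          exact Set.inter_subset_left
      _ = ENNReal.ofReal (P⁻¹ * Real.exp (a * B)) * gaussianReal 0 1 s := by
          rw [← mul_assoc, ← ENNReal.ofReal_mul (inv_pos.2 hPpos).le]
      _ ≤ _ := by
          gcongr
          rw [show ((2 : NNReal) : ℝ≥0∞) = ENNReal.ofReal 2 by simp]
          refine ENNReal.ofReal_le_ofReal ?_
          rw [inv_mul_le_iff₀ hPpos]
          linarith
  have hadd : (2 : NNReal) • gaussianReal 0 1 - ν₁ + ν₁ = (2 : NNReal) • gaussianReal 0 1 :=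
    Measure.sub_add_cancel_of_le hle
  refine ⟨(2 : NNReal) • gaussianReal 0 1 - ν₁, ν₁, c, ⟨?_⟩, hprob, hadd, rfl, ?_⟩
  · have h2 := congrArg (fun m : Measure ℝ => m Set.univ) hadd
    simp only [Measure.add_apply, measure_univ, Measure.smul_apply] at h2
    refine (ENNReal.add_left_inj ENNReal.one_ne_top).1 (h2.trans ?_)
    rw [ENNReal.smul_def]
    norm_num
  -- `P ≥ 1 - η` and `(1 + 2η)(1 - η) ≥ 1` for `0 ≤ η ≤ 1 / 2`.
  · rw [hcR, inv_le_iff_one_le_mul₀ hPpos]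
    nlinarith

theorem two_mul_bernoulli_half {X : Type*} [MeasurableSpace X] (x y : X) :
    ProbabilityTheory.bernoulliMeasure x y ⟨1 / 2, by norm_num, by norm_num⟩ =
      (2⁻¹ : NNReal) • (Measure.dirac x + Measure.dirac y) := by
  rw [ProbabilityTheory.bernoulliMeasure, smul_add]
  congr 2 <;> ext <;> norm_num

-- A fair selector between `ν₀` and `ν₁` averages them, so an unplanted bit yields exactly `γ`: this
-- stage costs nothing under the null hypothesis.
open ProbabilityTheory in
theorem bernoulli_half_prod_map_select {ν₀ ν₁ : Measure ℝ} [IsProbabilityMeasure ν₀]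
    [IsProbabilityMeasure ν₁] {γ : Measure ℝ} (h : ν₀ + ν₁ = (2 : NNReal) • γ) :
    ((bernoulliMeasure true false ⟨1 / 2, by norm_num, by norm_num⟩).prod (ν₀.prod ν₁)).map
      (fun p => bif p.1 then p.2.2 else p.2.1) = γ := by
  have hm : Measurable fun p : Bool × ℝ × ℝ => bif p.1 then p.2.2 else p.2.1 := by
    refine measurable_from_prod_countable_right fun b => ?_
    cases b <;> simp <;> fun_prop
  ext s hs
  rw [two_mul_bernoulli_half, Measure.map_apply hm hs, Measure.prod_apply (hm hs),
    lintegral_smul_measure, lintegral_add_measure, lintegral_dirac, lintegral_dirac]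
  have e1 : (Prod.mk true ⁻¹' ((fun p : Bool × ℝ × ℝ => bif p.1 then p.2.2 else p.2.1) ⁻¹' s)) =
      Set.univ ×ˢ s := by ext; simp
  have e2 : (Prod.mk false ⁻¹' ((fun p : Bool × ℝ × ℝ => bif p.1 then p.2.2 else p.2.1) ⁻¹' s)) =
      s ×ˢ Set.univ := by ext; simp
  have h2 := congrArg (fun m : Measure ℝ => m s) h
  simp only [Measure.add_apply, Measure.smul_apply] at h2
  rw [e1, e2, Measure.prod_prod, Measure.prod_prod, measure_univ, measure_univ, one_mul, mul_one,
    add_comm, h2, smul_smul, inv_mul_cancel₀ two_ne_zero, one_smul]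

open ProbabilityTheory in
theorem dirac_true_prod_map_select {ν₀ ν₁ : Measure ℝ} [IsProbabilityMeasure ν₀]
    [IsProbabilityMeasure ν₁] :
    ((Measure.dirac true).prod (ν₀.prod ν₁)).map
      (fun p => bif p.1 then p.2.2 else p.2.1) = ν₁ := by
  have hm : Measurable fun p : Bool × ℝ × ℝ => bif p.1 then p.2.2 else p.2.1 := by
    refine measurable_from_prod_countable_right fun b => ?_
    cases b <;> simp <;> fun_prop
  rw [Measure.dirac_prod, Measure.map_map hm (by fun_prop)]
  exact Measure.map_snd_prod.trans (by simp)

/-! ### Gaussian tails under a shift of the mean, and quantiles -/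

open ProbabilityTheory in
theorem gaussianPDFReal_one_le_one (b x : ℝ) : gaussianPDFReal b 1 x ≤ 1 := by
  rw [gaussianPDFReal]
  have h1 : (1 : ℝ) ≤ √(2 * Real.pi * (1 : NNReal)) := by
    rw [Real.one_le_sqrt]
    have := Real.pi_gt_three
    simp only [NNReal.coe_one]; linarith
  have h2 : Real.exp (-(x - b) ^ 2 / (2 * (1 : NNReal))) ≤ 1 := by
    rw [Real.exp_le_one_iff]
    simp only [NNReal.coe_one]
    nlinarith [sq_nonneg (x - b)]
  calc _ ≤ (1 : ℝ) * 1 := by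
        gcongr
        exact inv_le_one_of_one_le₀ h1
    _ = 1 := one_mul 1

open ProbabilityTheory in
theorem gaussianReal_le_volume (b : ℝ) (s : Set ℝ) : gaussianReal b 1 s ≤ volume s := by
  rw [gaussianReal_apply _ one_ne_zero, ← setLIntegral_one]
  refine lintegral_mono fun x => ?_
  rw [gaussianPDF, ← ENNReal.ofReal_one]
  exact ENNReal.ofReal_le_ofReal (gaussianPDFReal_one_le_one b x)

open ProbabilityTheory in
theorem le_gaussianReal_Ioc {L s t : ℝ} (hs : -L ≤ s) (ht : t ≤ L) :
    ENNReal.ofReal (gaussianPDFReal 0 1 L) * ENNReal.ofReal (t - s) ≤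
      gaussianReal 0 1 (Set.Ioc s t) := by
  rw [gaussianReal_apply _ one_ne_zero, ← Real.volume_Ioc, ← setLIntegral_const]
  refine setLIntegral_mono' measurableSet_Ioc fun x hx => ?_
  refine ENNReal.ofReal_le_ofReal ?_
  rw [gaussianPDFReal, gaussianPDFReal]
  refine mul_le_mul_of_nonneg_left (Real.exp_le_exp.2 (div_le_div_of_nonneg_right
    (neg_le_neg ?_) (by positivity))) (by positivity)
  rw [sub_zero, sub_zero, sq_le_sq, abs_le]
  have h1 : s < x := hx.1
  have h2 : x ≤ t := hx.2
  have h3 : 0 ≤ L := by linarith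
  rw [abs_of_nonneg h3]
  constructor <;> linarith

open ProbabilityTheory in
theorem gaussianReal_real_Ioi (b t : ℝ) :
    (gaussianReal b 1).real (Set.Ioi t) = (gaussianReal 0 1).real (Set.Ioi (t - b)) := by
  rw [measureReal_def, measureReal_def]
  have := gaussianReal_map_add_const (μ := 0) (v := 1) b
  rw [zero_add] at this
  rw [← this, Measure.map_apply (by fun_prop) measurableSet_Ioi]
  congr 2
  ext x
  simp [sub_lt_iff_lt_add]

open ProbabilityTheory in
theorem gaussianReal_real_Ioi_sub {s t : ℝ} (h : s ≤ t) :
    (gaussianReal 0 1).real (Set.Ioi s) =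
      (gaussianReal 0 1).real (Set.Ioi t) + (gaussianReal 0 1).real (Set.Ioc s t) := by
  rw [← Set.Ioc_union_Ioi_eq_Ioi h, measureReal_union (by
    rw [Set.disjoint_left]; intro x hx hx'; exact absurd hx.2 (not_le.2 hx')) measurableSet_Ioi,
    add_comm]

open ProbabilityTheory in
theorem le_gaussianReal_real_Ioc {L s t : ℝ} (hs : -L ≤ s) (ht : t ≤ L) :
    gaussianPDFReal 0 1 L * (t - s) ≤ (gaussianReal 0 1).real (Set.Ioc s t) := by
  have := le_gaussianReal_Ioc hs ht
  rw [← ENNReal.ofReal_mul (gaussianPDFReal_nonneg _ _ _)] at this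
  rw [measureReal_def]
  exact (ENNReal.ofReal_le_iff_le_toReal (measure_ne_top _ _)).1 this

-- Shifting the mean by `s` adds to the tail the mass of an interval of length `s` adjacent to `t`.
-- As `s ≤ 1`, that interval lies in `[-(|t| + 1), |t| + 1]`, where the density is at least its
-- value at the end.
open ProbabilityTheory in
theorem gaussianReal_real_Ioi_ge {b s t : ℝ} (hs0 : 0 ≤ s) (hs1 : s ≤ 1) (hb : s ≤ b) :
    (gaussianReal 0 1).real (Set.Ioi t) + gaussianPDFReal 0 1 (|t| + 1) * s ≤
      (gaussianReal b 1).real (Set.Ioi t) := by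
  rw [gaussianReal_real_Ioi b]
  have h1 := gaussianReal_real_Ioi_sub (s := t - s) (t := t) (by linarith)
  have h2 : (gaussianReal 0 1).real (Set.Ioi (t - s)) ≤ (gaussianReal 0 1).real (Set.Ioi (t - b)) :=
    measureReal_mono (Set.Ioi_subset_Ioi (by linarith))
  have h3 := le_gaussianReal_real_Ioc (L := |t| + 1) (s := t - s) (t := t)
    (by linarith [neg_abs_le t]) (by linarith [le_abs_self t])
  rw [sub_sub_cancel] at h3
  linarith

open ProbabilityTheory in
theorem gaussianReal_real_Ioi_le {b s t : ℝ} (hs0 : 0 ≤ s) (hs1 : s ≤ 1) (hb : b ≤ -s) :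
    (gaussianReal b 1).real (Set.Ioi t) ≤
      (gaussianReal 0 1).real (Set.Ioi t) - gaussianPDFReal 0 1 (|t| + 1) * s := by
  rw [gaussianReal_real_Ioi b]
  have h1 := gaussianReal_real_Ioi_sub (s := t) (t := t + s) (by linarith)
  have h2 : (gaussianReal 0 1).real (Set.Ioi (t - b)) ≤ (gaussianReal 0 1).real (Set.Ioi (t + s)) :=
    measureReal_mono (Set.Ioi_subset_Ioi (by linarith))
  have h3 := le_gaussianReal_real_Ioc (L := |t| + 1) (s := t) (t := t + s)
    (by linarith [neg_abs_le t]) (by linarith [le_abs_self t])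
  rw [add_sub_cancel_left] at h3
  linarith

-- The density is at most `1`, so the distribution function is 1-Lipschitz and the intermediate
-- value theorem applies.
open ProbabilityTheory in
theorem exists_gaussianReal_quantile {q : ℝ} (hq₀ : 0 < q) (hq₁ : q < 1) :
    ∃ t, (gaussianReal 0 1).real (Set.Ioi t) = q := by
  set γ := gaussianReal 0 1
  have hcdf : ∀ t, γ.real (Set.Ioi t) = 1 - cdf γ t := fun t => by
    rw [cdf_eq_real, ← Set.compl_Iic, probReal_compl_eq_one_sub measurableSet_Iic]
  have hcont : Continuous fun t => cdf γ t := by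
    refine (LipschitzWith.of_le_add fun s t => ?_ : LipschitzWith 1 fun t => cdf γ t).continuous
    rcases le_total s t with h | h
    · linarith [monotone_cdf γ h, dist_nonneg (x := s) (y := t)]
    · have h1 := gaussianReal_real_Ioi_sub h
      change γ.real _ = γ.real _ + γ.real _ at h1
      rw [hcdf, hcdf] at h1
      have h2 : γ.real (Set.Ioc t s) ≤ s - t := by
        refine ENNReal.toReal_le_of_le_ofReal (by linarith) ?_
        rw [← Real.volume_Ioc]
        exact gaussianReal_le_volume 0 _
      rw [Real.dist_eq, abs_of_nonneg (by linarith)]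
      linarith
  obtain ⟨a, ha⟩ := ((tendsto_cdf_atBot γ).eventually (gt_mem_nhds (by linarith : (0 : ℝ) < 1 - q))).exists
  obtain ⟨b, hb⟩ := ((tendsto_cdf_atTop γ).eventually (lt_mem_nhds (by linarith : 1 - q < 1))).exists
  obtain ⟨t, ht⟩ := mem_range_of_exists_le_of_exists_ge hcont ⟨a, ha.le⟩ ⟨b, hb.le⟩
  exact ⟨t, by rw [hcdf]; linarith⟩

/-! ### Rotation of symmetric Gaussian matrices -/

/-- The matrix of the map `Z ↦ R Z Rᵀ` on symmetric matrices; both sides are normalized to make it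
an isometry, and a symmetric matrix is stored in its upper triangle. -/
noncomputable def symConj {N : ℕ} (R : Matrix (Fin N) (Fin N) ℝ) :
    Matrix (Sym2 (Fin N)) (Fin N × Fin N) ℝ :=
  fun e p => Sym2.lift ⟨fun u v => (if u = v then (√2)⁻¹ else 1) *
    (if p.1 < p.2 then R u p.1 * R v p.2 + R v p.1 * R u p.2
      else if p.1 = p.2 then √2 * (R u p.1 * R v p.1) else 0), fun u v => by
        simp only [eq_comm (a := u) (b := v), mul_comm (R u p.1), add_comm (R v p.2 * R u p.1)]⟩ e

theorem symConj_mk {N : ℕ} (R : Matrix (Fin N) (Fin N) ℝ) (u v : Fin N) (p : Fin N × Fin N) :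
    symConj R s(u, v) p = (if u = v then (√2)⁻¹ else 1) *
    (if p.1 < p.2 then R u p.1 * R v p.2 + R v p.1 * R u p.2
      else if p.1 = p.2 then √2 * (R u p.1 * R v p.1) else 0) := rfl

theorem two_mul_sum_eq_sum_add_swap {N : ℕ} (f : Fin N × Fin N → ℝ) :
    2 * ∑ p, f p = ∑ p, (f p + f p.swap) := by
  rw [Finset.sum_add_distrib, two_mul]
  congr 1
  exact (Equiv.sum_comp (Equiv.prodComm (Fin N) (Fin N)) f).symm

theorem sum_mul_mul_mul {N : ℕ} (a b : Fin N → ℝ) :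
    ∑ p : Fin N × Fin N, a p.1 * b p.2 = (∑ i, a i) * ∑ j, b j := by
  rw [Fintype.sum_prod_type, Finset.sum_mul_sum]

/-- Independent standard coordinates encode a symmetric matrix with off-diagonal entries of variance
`1` and diagonal entries `√2 * z i i` of variance `2`, a law invariant under orthogonal conjugation;
the factor `(√2)⁻¹` renormalizes the output diagonal. In the proof, the sum over the upper triangle
is symmetrized into half of a sum over all pairs, which factors into inner products of rows of `R`.
-/
theorem symConj_mul_transpose {N : ℕ} {R : Matrix (Fin N) (Fin N) ℝ} (hR : R * R.transpose = 1) :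
    symConj R * (symConj R).transpose = 1 := by
  have hs : √2 * √2 = (2 : ℝ) := Real.mul_self_sqrt (by norm_num)
  have hs0 : √2 ≠ (0 : ℝ) := by positivity
  have horth : ∀ u v, ∑ i, R u i * R v i = if u = v then 1 else 0 := fun u v => by
    have := congrFun (congrFun hR u) v
    rw [Matrix.mul_apply, Matrix.one_apply] at this
    exact this
  ext e e'
  induction e using Sym2.ind with | _ u v
  induction e' using Sym2.ind with | _ u' v'
  rw [Matrix.mul_apply, Matrix.one_apply]
  simp only [Matrix.transpose_apply]
  set κ : ℝ := if u = v then (√2)⁻¹ else 1 with hκ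
  set κ' : ℝ := if u' = v' then (√2)⁻¹ else 1 with hκ'
  -- Adding the swapped term merges the three cases of the definition into one formula; on the
  -- diagonal this is where `√2 * √2 = 2` enters.
  have hpt : ∀ p : Fin N × Fin N, symConj R s(u, v) p * symConj R s(u', v') p +
      symConj R s(u, v) p.swap * symConj R s(u', v') p.swap =
      κ * κ' * ((R u p.1 * R v p.2 + R v p.1 * R u p.2) *
        (R u' p.1 * R v' p.2 + R v' p.1 * R u' p.2)) := by
    rintro ⟨i, j⟩
    simp only [symConj_mk, Prod.swap, ← hκ, ← hκ']
    rcases lt_trichotomy i j with h | h | h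
    · rw [if_pos h, if_pos h, if_neg h.not_gt, if_neg h.ne', if_neg h.not_gt, if_neg h.ne']
      ring
    · subst h
      simp only [lt_irrefl, if_false, if_true]
      linear_combination (2 * κ * κ' * (R u i * R v i) * (R u' i * R v' i)) * hs
    · rw [if_pos h, if_pos h, if_neg h.not_gt, if_neg h.ne', if_neg h.not_gt, if_neg h.ne']
      ring
  have h2 := two_mul_sum_eq_sum_add_swap fun p => symConj R s(u, v) p * symConj R s(u', v') p
  rw [Finset.sum_congr rfl fun p _ => hpt p, ← Finset.mul_sum] at h2
  have h3 : ∑ p : Fin N × Fin N, (R u p.1 * R v p.2 + R v p.1 * R u p.2) *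
        (R u' p.1 * R v' p.2 + R v' p.1 * R u' p.2) =
      2 * ((if u = u' then 1 else 0) * (if v = v' then 1 else 0) +
        (if u = v' then 1 else 0) * (if v = u' then 1 else 0)) := by
    rw [← horth u u', ← horth v v', ← horth u v', ← horth v u', ← sum_mul_mul_mul,
      ← sum_mul_mul_mul, ← Finset.sum_add_distrib]
    have hsw := two_mul_sum_eq_sum_add_swap fun p : Fin N × Fin N =>
      R u p.1 * R u' p.1 * (R v p.2 * R v' p.2) + R u p.1 * R v' p.1 * (R v p.2 * R u' p.2)
    rw [hsw]
    refine Finset.sum_congr rfl fun p _ => ?_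
    simp only [Prod.fst_swap, Prod.snd_swap]
    ring
  rw [h3] at h2
  have h4 : ∑ p, symConj R s(u, v) p * symConj R s(u', v') p =
      κ * κ' * ((if u = u' then 1 else 0) * (if v = v' then 1 else 0) +
        (if u = v' then 1 else 0) * (if v = u' then 1 else 0)) := by linarith
  rw [h4]
  have hi : (√2)⁻¹ * (√2)⁻¹ = (2 : ℝ)⁻¹ := by rw [← mul_inv, hs]
  by_cases huv : u = v
  · subst huv
    by_cases huv' : u' = v'
    · subst huv'
      by_cases h : u = u'
      · subst h
        simp [hκ, hκ', hi]; norm_num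
      · simp [h]
    · have : ¬ (s(u, u) = s(u', v')) := by
        rw [Sym2.eq_iff]; rintro (⟨h1, h2⟩ | ⟨h1, h2⟩) <;> exact huv' (by rw [← h1, ← h2])
      rw [if_neg this]
      by_cases h1 : u = u'
      · subst h1; simp [huv']
      · simp [h1]
  · by_cases huv' : u' = v'
    · subst huv'
      have : ¬ (s(u, v) = s(u', u')) := by
        rw [Sym2.eq_iff]; rintro (⟨h1, h2⟩ | ⟨h1, h2⟩) <;> exact huv (by rw [h1, h2])
      rw [if_neg this]
      by_cases h1 : u = u'
      · subst h1
        have : v ≠ u := fun h => huv h.symm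
        simp [this]
      · simp [h1]
    · have hk : κ = 1 := if_neg huv
      have hk' : κ' = 1 := if_neg huv'
      rw [hk, hk']
      simp only [Sym2.eq_iff]
      by_cases h1 : u = u'
      · subst h1
        by_cases h2 : v = v' <;> simp [h2, huv', Ne.symm huv]
      · by_cases h2 : u = v'
        · subst h2
          by_cases h3 : v = u' <;> simp [h3, h1]
        · simp [h1, h2]

/-- The upper triangle of the symmetric matrix `μ 1_Σ 1_Σᵀ`, whose diagonal is divided by `√2`. -/
noncomputable def plantedMean {N : ℕ} (μ : ℝ) (A : Finset (Fin N)) (p : Fin N × Fin N) : ℝ :=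
  if p.1 ∈ A ∧ p.2 ∈ A then (if p.1 < p.2 then μ else if p.1 = p.2 then μ / √2 else 0) else 0

/-- `R (1 1ᵀ) Rᵀ = (R 1)(R 1)ᵀ`, so a planted block stays of rank one. The diagonal of `plantedMean`
is divided by `√2` to cancel the `√2` with which `symConj` weights diagonal coordinates. -/
theorem symConj_mulVec_plantedMean {N : ℕ} (R : Matrix (Fin N) (Fin N) ℝ) (μ : ℝ)
    (A : Finset (Fin N)) {u v : Fin N} (huv : u ≠ v) :
    (symConj R).mulVec (plantedMean μ A) s(u, v) = μ * ((∑ i ∈ A, R u i) * ∑ j ∈ A, R v j) := by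
  have hs : √2 * √2 = (2 : ℝ) := Real.mul_self_sqrt (by norm_num)
  have hs0 : √2 ≠ (0 : ℝ) := by positivity
  have hpt : ∀ p : Fin N × Fin N, symConj R s(u, v) p * plantedMean μ A p +
      symConj R s(u, v) p.swap * plantedMean μ A p.swap =
      μ * (((if p.1 ∈ A then R u p.1 else 0) * (if p.2 ∈ A then R v p.2 else 0)) +
        ((if p.1 ∈ A then R v p.1 else 0) * (if p.2 ∈ A then R u p.2 else 0))) := by
    rintro ⟨i, j⟩
    simp only [symConj_mk, plantedMean, Prod.swap, if_neg huv]
    by_cases hi : i ∈ A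
    · by_cases hj : j ∈ A
      · simp only [hi, hj, and_self, if_true]
        rcases lt_trichotomy i j with h | h | h
        · rw [if_pos h, if_pos h, if_neg h.not_gt, if_neg h.ne', if_neg h.not_gt, if_neg h.ne']
          ring
        · subst h
          simp only [lt_irrefl, if_false, if_true]
          field_simp
        · rw [if_pos h, if_pos h, if_neg h.not_gt, if_neg h.ne', if_neg h.not_gt, if_neg h.ne']
          ring
      · simp [hj]
    · simp [hi]
  have h2 := two_mul_sum_eq_sum_add_swap fun p => symConj R s(u, v) p * plantedMean μ A p
  rw [Finset.sum_congr rfl fun p _ => hpt p, ← Finset.mul_sum, Finset.sum_add_distrib,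
    sum_mul_mul_mul (fun i => if i ∈ A then R u i else 0) (fun i => if i ∈ A then R v i else 0),
    sum_mul_mul_mul (fun i => if i ∈ A then R v i else 0)
      (fun i => if i ∈ A then R u i else 0)] at h2
  have h3 : ∀ w, ∑ i, (if i ∈ A then R w i else 0) = ∑ i ∈ A, R w i := fun w => by
    rw [← Finset.sum_filter]; simp
  rw [h3, h3] at h2
  rw [Matrix.mulVec, dotProduct]
  linarith

/-! ### Thresholding -/

/-- The graph of the pairs `e` with `t < y e`. -/
def thresholdGraph {N : ℕ} (t : ℝ) (y : Sym2 (Fin N) → ℝ) : SimpleGraph (Fin N) :=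
  SimpleGraph.fromEdgeSet {e | t < y e}

/-- The probability that a Gaussian of mean `b` exceeds `t`. -/
noncomputable def gaussianTail (t b : ℝ) : I :=
  ⟨(ProbabilityTheory.gaussianReal b 1).real (Set.Ioi t), measureReal_nonneg, measureReal_le_one⟩

theorem measurable_decide_mem_Ioi (t : ℝ) : Measurable fun z : ℝ => decide (z ∈ Set.Ioi t) := by
  refine measurable_to_bool ?_
  have : (fun z : ℝ => decide (z ∈ Set.Ioi t)) ⁻¹' {true} = Set.Ioi t := by ext; simp
  rw [this]
  exact measurableSet_Ioi

theorem measurable_thresholdGraph {N : ℕ} (t : ℝ) : Measurable (thresholdGraph (N := N) t) := by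
  have : thresholdGraph (N := N) t =
      (fun x : Sym2 (Fin N) → Bool => SimpleGraph.fromEdgeSet {e | x e = true}) ∘
        fun y e => decide (y e ∈ Set.Ioi t) := by
    funext y; simp [thresholdGraph]
  rw [this]
  refine measurable_fromEdgeSet_bool.comp (measurable_pi_lambda _ fun e => ?_)
  exact (measurable_decide_mem_Ioi t).comp (measurable_pi_apply e)

theorem map_decide_gaussianReal (t b : ℝ) :
    (ProbabilityTheory.gaussianReal b 1).map (fun z => decide (z ∈ Set.Ioi t)) =
      ProbabilityTheory.bernoulliMeasure true false (gaussianTail t b) := by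
  have hm := measurable_decide_mem_Ioi t
  refine Measure.ext_of_singleton fun c => ?_
  rw [Measure.map_apply hm (measurableSet_singleton c)]
  cases c
  · have : (fun z : ℝ => decide (z ∈ Set.Ioi t)) ⁻¹' {false} = (Set.Ioi t)ᶜ := by ext; simp
    rw [this, ProbabilityTheory.bernoulliMeasure_apply_of_notMem_of_mem _
      (measurableSet_singleton _) (by simp) (by simp), ← ENNReal.toReal_eq_toReal_iff'
      (measure_ne_top _ _) (by simp)]
    rw [← measureReal_def, probReal_compl_eq_one_sub measurableSet_Ioi]
    rfl
  · have : (fun z : ℝ => decide (z ∈ Set.Ioi t)) ⁻¹' {true} = Set.Ioi t := by ext; simp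
    rw [this, ProbabilityTheory.bernoulliMeasure_apply_of_mem_of_notMem _
      (measurableSet_singleton _) (by simp) (by simp), ← ENNReal.toReal_eq_toReal_iff'
      (measure_ne_top _ _) (by simp)]
    rfl

theorem pi_gaussianReal_map_thresholdGraph {N : ℕ} (t : ℝ) (b : Sym2 (Fin N) → ℝ) :
    (Measure.pi fun e => ProbabilityTheory.gaussianReal (b e) 1).map (thresholdGraph t) =
      inhomogeneousRandomGraph fun e => gaussianTail t (b e) := by
  rw [inhomogeneousRandomGraph]
  simp_rw [← map_decide_gaussianReal]
  have hm := measurable_decide_mem_Ioi t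
  have : ∀ e, IsProbabilityMeasure ((ProbabilityTheory.gaussianReal (b e) 1).map
      fun z => decide (z ∈ Set.Ioi t)) := fun e => Measure.isProbabilityMeasure_map hm.aemeasurable
  have hm' : Measurable fun (y : Sym2 (Fin N) → ℝ) e => decide (y e ∈ Set.Ioi t) :=
    measurable_pi_lambda _ fun e => hm.comp (measurable_pi_apply e)
  rw [← Measure.pi_map_pi (fun e => hm.aemeasurable), Measure.map_map measurable_fromEdgeSet_bool hm']
  congr 1
  funext y
  simp [thresholdGraph]

/-! ### Replacing real arithmetic by bounded integers -/

/-- The thresholded rotation, computed with the entries rounded to the grid `η ℤ` after truncation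
at level `M`. -/
noncomputable def roundedGraph {N : ℕ} {ι : Type*} [Fintype ι] (C : Matrix (Sym2 (Fin N)) ι ℝ)
    (t M η : ℝ) (z : ι → ℝ) : SimpleGraph (Fin N) :=
  SimpleGraph.fromEdgeSet {e | ⌊t / η⌋ < ∑ i, ⌊C e i * max (-M) (min M (z i)) / η⌋}

/-- In units of `η`, each summand loses at most `1` to its floor and the threshold loses at most `1`
to its own. A margin of `card ι + 1` units around `t` therefore protects every decision. -/
theorem roundedGraph_eq {N : ℕ} {ι : Type*} [Fintype ι] (C : Matrix (Sym2 (Fin N)) ι ℝ)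
    {t M η : ℝ} (hη : 0 < η) {z : ι → ℝ} (hz : ∀ i, |z i| ≤ M)
    (ht : ∀ e, (Fintype.card ι + 1) * η < |C.mulVec z e - t|) :
    roundedGraph C t M η z = thresholdGraph t (C.mulVec z) := by
  unfold roundedGraph thresholdGraph
  congr 1
  ext e
  have hclip : ∀ i, max (-M) (min M (z i)) = z i := fun i => by
    have := abs_le.1 (hz i)
    rw [min_eq_right this.2, max_eq_right this.1]
  simp_rw [hclip, Set.mem_ofPred_eq]
  have hsum : C.mulVec z e / η = ∑ i, C e i * z i / η := by
    rw [Matrix.mulVec, dotProduct, Finset.sum_div]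
  set S := ∑ i, ⌊C e i * z i / η⌋ with hS
  have hS1 : (S : ℝ) ≤ C.mulVec z e / η := by
    rw [hsum, hS]; push_cast
    exact Finset.sum_le_sum fun i _ => Int.floor_le _
  have hS2 : C.mulVec z e / η ≤ S + Fintype.card ι := by
    rw [hsum, hS]; push_cast
    calc _ ≤ ∑ i, ((⌊C e i * z i / η⌋ : ℝ) + 1) :=
          Finset.sum_le_sum fun i _ => (Int.lt_floor_add_one _).le
      _ = _ := by rw [Finset.sum_add_distrib]; simp
  have h3 := Int.floor_le (t / η)
  have h4 := Int.lt_floor_add_one (t / η)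
  have h5 : (Fintype.card ι + 1 : ℝ) < |C.mulVec z e / η - t / η| := by
    rw [← sub_div, abs_div, abs_of_pos hη, lt_div_iff₀ hη]
    exact ht e
  have hc : (0 : ℝ) ≤ Fintype.card ι := Nat.cast_nonneg _
  constructor
  · intro h
    have h' : ((⌊t / η⌋ : ℝ)) + 1 ≤ S := by exact_mod_cast h
    have : t / η < C.mulVec z e / η := by linarith
    exact (div_lt_div_iff_of_pos_right hη).1 this
  · intro h
    have h' : t / η < C.mulVec z e / η := (div_lt_div_iff_of_pos_right hη).2 h
    rw [abs_of_pos (by linarith)] at h5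
    have : (⌊t / η⌋ : ℝ) < S := by linarith
    exact_mod_cast this

open ProbabilityTheory in
theorem gaussianReal_abs_gt_le {a : ℝ} (ha : |a| ≤ 1) (M : ℝ) :
    gaussianReal a 1 {z | M < |z|} ≤ ENNReal.ofReal (2 * Real.exp (4 - 2 * M)) := by
  have h1 : gaussianReal a 1 (Set.Ioi M) ≤ ENNReal.ofReal (Real.exp (4 - 2 * M)) :=
    (gaussianReal_Ioi_le a M).trans (ENNReal.ofReal_le_ofReal (Real.exp_le_exp.2 (by
      linarith [le_abs_self a])))
  have h2 : gaussianReal a 1 (Set.Iio (-M)) ≤ ENNReal.ofReal (Real.exp (4 - 2 * M)) := by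
    have : gaussianReal a 1 (Set.Iio (-M)) = gaussianReal (-a) 1 (Set.Ioi M) := by
      rw [← gaussianReal_map_neg, Measure.map_apply (by fun_prop) measurableSet_Ioi]
      congr 1
      ext z
      simp
    rw [this]
    exact (gaussianReal_Ioi_le (-a) M).trans (ENNReal.ofReal_le_ofReal (Real.exp_le_exp.2 (by
      linarith [neg_abs_le a])))
  have h3 : {z : ℝ | M < |z|} = Set.Ioi M ∪ Set.Iio (-M) := by
    ext z
    simp [lt_abs, lt_neg]
  rw [h3, two_mul, ENNReal.ofReal_add (Real.exp_pos _).le (Real.exp_pos _).le]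
  exact (measure_union_le _ _).trans (add_le_add h1 h2)

theorem measurable_roundedGraph {N : ℕ} {ι : Type*} [Fintype ι] (C : Matrix (Sym2 (Fin N)) ι ℝ)
    (t M η : ℝ) : Measurable (roundedGraph C t M η) := by
  refine SimpleGraph.measurable_fromEdgeSet.comp (measurable_set_iff.2 fun e => ?_)
  simp only [Set.mem_ofPred_eq]
  refine measurableSet_setOfPred.1 (measurableSet_lt measurable_const ?_)
  refine Finset.measurable_fun_sum _ fun i _ => Int.measurable_floor.comp ?_
  fun_prop

/-- The error made by rounding a Gaussian vector with `k` entries before thresholding `l` linear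
functionals. -/
noncomputable def roundingError (k l : ℕ) (M η : ℝ) : ℝ :=
  k * (2 * Real.exp (4 - 2 * M)) + l * (2 * ((k + 1) * η))

theorem roundingError_nonneg (k l : ℕ) (M : ℝ) {η : ℝ} (hη : 0 ≤ η) :
    0 ≤ roundingError k l M η := by
  unfold roundingError; positivity

theorem lintegral_le_lintegral_add_measure {Ω : Type*} [MeasurableSpace Ω] (m : Measure Ω)
    {f g : Ω → ℝ≥0∞} (hf : ∀ z, f z ≤ 1) {S : Set Ω} (hS : MeasurableSet S)
    (hfg : ∀ z ∉ S, f z = g z) : ∫⁻ z, f z ∂m ≤ ∫⁻ z, g z ∂m + m S := by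
  rw [← lintegral_indicator_one hS]
  calc ∫⁻ z, f z ∂m ≤ ∫⁻ z, g z + S.indicator 1 z ∂m := lintegral_mono fun z => by
        by_cases hz : z ∈ S
        · simpa [hz] using (hf z).trans le_add_self
        · simp [hz, hfg z hz]
    _ = _ := lintegral_add_right _ (measurable_one.indicator hS)

-- A union bound over the two ways in which rounding can matter: an input coordinate exceeds the
-- truncation level, or a rotated coordinate falls too close to `t`. The second probability is at
-- most the length of the forbidden interval, because the rotated coordinate is again Gaussian with
-- density at most `1`.
open ProbabilityTheory in
theorem lintegral_roundedGraph_le {N : ℕ} {ι : Type*} [Fintype ι]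
    {C : Matrix (Sym2 (Fin N)) ι ℝ} (hC : C * C.transpose = 1) (t M : ℝ) {η : ℝ} (hη : 0 < η)
    {a : ι → ℝ} (ha : ∀ i, |a i| ≤ 1) {f : SimpleGraph (Fin N) → ℝ≥0∞} (hf : ∀ G, f G ≤ 1) :
    ∫⁻ z, f (roundedGraph C t M η z) ∂(Measure.pi fun i => gaussianReal (a i) 1) ≤
      ∫⁻ G, f G ∂(inhomogeneousRandomGraph fun e => gaussianTail t (C.mulVec a e)) +
        ENNReal.ofReal (roundingError (Fintype.card ι) (Fintype.card (Sym2 (Fin N))) M η) := by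
  have hCm : Measurable fun z : ι → ℝ => C.mulVec z := by
    refine measurable_pi_lambda _ fun j => ?_
    simp only [Matrix.mulVec, dotProduct]
    fun_prop
  set m := Measure.pi fun i => gaussianReal (a i) 1 with hm
  set k : ℝ := (Fintype.card ι + 1) * η with hk
  have hk0 : 0 ≤ k := by positivity
  set S₁ : ι → Set (ι → ℝ) := fun i => Function.eval i ⁻¹' {z | M < |z|} with hS₁
  set S₂ : Sym2 (Fin N) → Set (ι → ℝ) := fun e =>
    (fun z => C.mulVec z e) ⁻¹' Set.Icc (t - k) (t + k) with hS₂
  have hM : MeasurableSet {z : ℝ | M < |z|} := measurableSet_lt measurable_const measurable_norm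
  have hmS₁ : ∀ i, MeasurableSet (S₁ i) := fun i => measurable_pi_apply i hM
  have hmS₂ : ∀ e, MeasurableSet (S₂ e) := fun e =>
    ((measurable_pi_apply e).comp hCm) measurableSet_Icc
  have hS : MeasurableSet ((⋃ i, S₁ i) ∪ ⋃ e, S₂ e) :=
    (MeasurableSet.iUnion hmS₁).union (MeasurableSet.iUnion hmS₂)
  have h1 : ∀ i, m (S₁ i) ≤ ENNReal.ofReal (2 * Real.exp (4 - 2 * M)) := fun i => by
    rw [hS₁, (measurePreserving_eval (fun i => gaussianReal (a i) 1) i).measure_preimage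
      hM.nullMeasurableSet]
    exact gaussianReal_abs_gt_le (ha i) M
  have h2 : ∀ e, m (S₂ e) ≤ ENNReal.ofReal (2 * k) := fun e => by
    have : S₂ e = (fun z => C.mulVec z) ⁻¹' (Function.eval e ⁻¹' Set.Icc (t - k) (t + k)) := rfl
    rw [this, ← Measure.map_apply hCm (measurable_pi_apply e measurableSet_Icc), hm,
      pi_gaussianReal_map_mulVec C hC,
      (measurePreserving_eval (fun e => gaussianReal (C.mulVec a e) 1) e).measure_preimage
      measurableSet_Icc.nullMeasurableSet]
    refine (gaussianReal_le_volume _ _).trans ?_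
    rw [Real.volume_Icc]
    refine ENNReal.ofReal_le_ofReal ?_
    linarith
  have h3 : m ((⋃ i, S₁ i) ∪ ⋃ e, S₂ e) ≤
      ENNReal.ofReal (roundingError (Fintype.card ι) (Fintype.card (Sym2 (Fin N))) M η) := by
    refine (measure_union_le _ _).trans ?_
    rw [roundingError, ENNReal.ofReal_add (by positivity) (by positivity)]
    refine add_le_add ((measure_iUnion_fintype_le _ _).trans ?_)
      ((measure_iUnion_fintype_le _ _).trans ?_)
    · refine (Finset.sum_le_sum fun i _ => h1 i).trans ?_
      rw [Finset.sum_const, ENNReal.ofReal_mul (Nat.cast_nonneg _), ENNReal.ofReal_natCast,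
        nsmul_eq_mul, Finset.card_univ]
    · refine (Finset.sum_le_sum fun i _ => h2 i).trans ?_
      rw [Finset.sum_const, ENNReal.ofReal_mul (Nat.cast_nonneg _), ENNReal.ofReal_natCast,
        nsmul_eq_mul, Finset.card_univ]
  have h4 : ∫⁻ G, f G ∂(inhomogeneousRandomGraph fun e => gaussianTail t (C.mulVec a e)) =
      ∫⁻ z, f (thresholdGraph t (C.mulVec z)) ∂m := by
    rw [← pi_gaussianReal_map_thresholdGraph, lintegral_map (measurable_of_finite _)
      (measurable_thresholdGraph t), ← pi_gaussianReal_map_mulVec C hC,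
      lintegral_map (f := fun y => f (thresholdGraph t y))
        ((measurable_of_finite f).comp (measurable_thresholdGraph t)) hCm]
  rw [h4]
  refine (lintegral_le_lintegral_add_measure m (fun z => hf _) hS fun z hz => ?_).trans
    (add_le_add le_rfl h3)
  simp only [Set.mem_union, Set.mem_iUnion, not_or, not_exists] at hz
  rw [roundedGraph_eq C hη (fun i => not_lt.1 (hz.1 i)) fun e => ?_]
  have := hz.2 e
  simp only [hS₂, Set.mem_preimage, Set.mem_Icc, not_and_or, not_le] at this
  rw [lt_abs]
  rcases this with h | h
  · right; linarith
  · left; linarith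

open ProbabilityTheory in
/-- Gaussianization of planted bits: a pair of Gaussian-like random variables is drawn for each bit,
one for each value of the bit; then the result is rotated, rounded and thresholded. -/
theorem exists_gaussianization {N : ℕ} {ι : Type*} [Fintype ι] [DecidableEq ι]
    {C : Matrix (Sym2 (Fin N)) ι ℝ} (hC : C * C.transpose = 1) (t M B : ℝ) {η : ℝ} (hη : 0 < η)
    {m : ι → ℝ} (hm₀ : ∀ i, 0 ≤ m i) (hm₁ : ∀ i, m i ≤ 1) (hmB : ∀ i, Real.exp (m i * B) ≤ 3 / 2)
    (hB : Real.exp (4 - 2 * B) ≤ 1 / 4) :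
    ∃ κ : ι → Measure (ℝ × ℝ), (∀ i, IsProbabilityMeasure (κ i)) ∧
      ∀ (P : Finset ι) (f : SimpleGraph (Fin N) → ℝ≥0∞), (∀ G, f G ≤ 1) →
        ∫⁻ x, ∫⁻ ω, f (roundedGraph C t M η fun i => bif x i then (ω i).2 else (ω i).1)
            ∂(Measure.pi κ) ∂(Measure.pi fun i => if i ∈ P then Measure.dirac true else
              bernoulliMeasure true false ⟨1 / 2, by norm_num, by norm_num⟩) ≤
          ENNReal.ofReal ((1 + 2 * Real.exp (4 - 2 * B)) ^ P.card) *
          (∫⁻ G, f G ∂(inhomogeneousRandomGraph fun e =>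
              gaussianTail t (C.mulVec (fun i => if i ∈ P then m i else 0) e)) +
            ENNReal.ofReal (roundingError (Fintype.card ι) (Fintype.card (Sym2 (Fin N))) M η)) := by
  have hle : ∀ i, Real.exp (2 * m i + 2 - 2 * B) ≤ Real.exp (4 - 2 * B) := fun i =>
    Real.exp_le_exp.2 (by linarith [hm₁ i])
  choose ν₀ ν₁ c hν₀ hν₁ hadd hνc hc using fun i =>
    exists_gaussian_split (hm₀ i) (hmB i) ((hle i).trans hB)
  refine ⟨fun i => (ν₀ i).prod (ν₁ i), fun i => inferInstance, fun P f hf => ?_⟩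
  have hsel : Measurable fun p : Bool × ℝ × ℝ => bif p.1 then p.2.2 else p.2.1 := by
    refine measurable_from_prod_countable_right fun b => ?_
    cases b <;> simp <;> fun_prop
  have hF : Measurable fun z : ι → ℝ => f (roundedGraph C t M η z) :=
    (measurable_of_finite f).comp (measurable_roundedGraph C t M η)
  have hξ : ∀ i, IsProbabilityMeasure (if i ∈ P then Measure.dirac true else
      bernoulliMeasure true false ⟨1 / 2, by norm_num, by norm_num⟩) := fun i => by
    split_ifs <;> infer_instance
  rw [lintegral_pi_select (fun i => if i ∈ P then Measure.dirac true else
      bernoulliMeasure true false ⟨1 / 2, by norm_num, by norm_num⟩)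
    (fun i => (ν₀ i).prod (ν₁ i)) (sel := fun b p => bif b then p.2 else p.1) hsel hF]
  set c' : ι → NNReal := fun i => if i ∈ P then c i else 1 with hc'
  set a : ι → ℝ := fun i => if i ∈ P then m i else 0 with ha
  set s : ι → Set ℝ := fun i => if i ∈ P then Set.Iic B else Set.univ with hs
  -- On `P` the selector always picks the conditioned Gaussian of mean `m i`; off `P` the two laws
  -- recombine to the standard Gaussian.
  have hmarg : (fun i => ((if i ∈ P then Measure.dirac true else
      bernoulliMeasure true false ⟨1 / 2, by norm_num, by norm_num⟩).prod
        ((ν₀ i).prod (ν₁ i))).map fun p => bif p.1 then p.2.2 else p.2.1) =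
      fun i => c' i • (gaussianReal (a i) 1).restrict (s i) := by
    funext i
    by_cases hi : i ∈ P
    · simp only [hc', ha, hs, if_pos hi]
      rw [dirac_true_prod_map_select, hνc]
    · simp only [hc', ha, hs, if_neg hi]
      rw [bernoulli_half_prod_map_select (hadd i), Measure.restrict_univ, one_smul]
  rw [hmarg]
  -- Domination is enough, since errors of the test only have to be bounded from above; no total
  -- variation distance is needed.
  refine (lintegral_mono' (pi_smul_restrict_le _ _) le_rfl).trans ?_
  rw [lintegral_smul_measure, ENNReal.smul_def, smul_eq_mul]
  refine mul_le_mul' ?_ (lintegral_roundedGraph_le hC t M hη (fun i => ?_) hf)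
  · rw [← ENNReal.ofReal_coe_nnreal]
    refine ENNReal.ofReal_le_ofReal ?_
    push_cast
    rw [hc', ← Finset.prod_const, ← Finset.prod_subset (Finset.subset_univ P)
      fun i _ hi => by simp [hi]]
    refine Finset.prod_le_prod (fun i _ => NNReal.coe_nonneg _) fun i hi => ?_
    simp only [if_pos hi]
    linarith [hc i, hle i]
  · simp only [ha]
    split_ifs
    · rw [abs_of_nonneg (hm₀ i)]; exact hm₁ i
    · simp

/-! ### Erasing a random subset of a random set -/

/-- With denominators cleared: a uniformly random `a`-subset of an `r`-set contains a given `b`-set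
with probability at most `(a / r) ^ b`, as each factor `(a - i) / (r - i)` is at most `a / r`. -/
theorem choose_sub_mul_pow_le {r a : ℕ} (har : a ≤ r) (b : ℕ) (hb : b ≤ a) :
    ((r - b).choose (a - b) : ℝ) * r ^ b ≤ r.choose a * a ^ b := by
  induction b with
  | zero => simp
  | succ b ih =>
    have h1 := ih (by omega)
    have h2 : (r - b).choose (a - b) * (a - b) = (r - b) * (r - (b + 1)).choose (a - (b + 1)) := by
      obtain ⟨a', ha'⟩ : ∃ a', a - b = a' + 1 := ⟨a - b - 1, by omega⟩
      obtain ⟨r', hr'⟩ : ∃ r', r - b = r' + 1 := ⟨r - b - 1, by omega⟩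
      rw [show r - (b + 1) = r' by omega, show a - (b + 1) = a' by omega, ha', hr']
      exact (Nat.add_one_mul_choose_eq r' a').symm
    have h2' : ((r - b).choose (a - b) : ℝ) * (a - b) =
        (r - b) * (r - (b + 1)).choose (a - (b + 1)) := by
      have := congrArg (Nat.cast : ℕ → ℝ) h2
      push_cast [Nat.cast_sub (show b ≤ a by omega), Nat.cast_sub (show b ≤ r by omega)] at this
      exact this
    have hbr : (0 : ℝ) < r - b := by
      have : (b : ℝ) + 1 ≤ r := by exact_mod_cast (by omega : b + 1 ≤ r)
      linarith
    have har' : (a : ℝ) ≤ r := by exact_mod_cast har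
    have hb0 : (0 : ℝ) ≤ b := Nat.cast_nonneg b
    have hba : (b : ℝ) ≤ a := by exact_mod_cast (by omega : b ≤ a)
    refine le_of_mul_le_mul_left ?_ hbr
    calc (r - b : ℝ) * (((r - (b + 1)).choose (a - (b + 1)) : ℝ) * r ^ (b + 1))
        = ((r - b) * (r - (b + 1)).choose (a - (b + 1))) * r ^ b * r := by ring
      _ = ((r - b).choose (a - b) * r ^ b) * ((a - b) * r) := by rw [← h2']; ring
      _ ≤ (r.choose a * a ^ b) * ((r - b) * a) := by
          refine mul_le_mul h1 (by nlinarith) (mul_nonneg (by linarith) (by linarith)) (by positivity)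
      _ = _ := by ring

theorem card_filter_superset_powersetCard {V : Type*} [DecidableEq V] {U B : Finset V}
    (hB : B ⊆ U) {a : ℕ} (hBa : B.card ≤ a) :
    ((U.powersetCard a).filter fun A => B ⊆ A).card = (U.card - B.card).choose (a - B.card) := by
  rw [← Finset.card_sdiff_of_subset hB, ← Finset.card_powersetCard]
  refine Finset.card_bij' (fun A _ => A \ B) (fun A _ => A ∪ B) ?_ ?_ ?_ ?_
  · intro A hA
    simp only [Finset.mem_filter, Finset.mem_powersetCard] at hA ⊢
    exact ⟨Finset.sdiff_subset_sdiff hA.1.1 le_rfl, by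
      rw [Finset.card_sdiff_of_subset hA.2, hA.1.2]⟩
  · intro A hA
    simp only [Finset.mem_filter, Finset.mem_powersetCard] at hA ⊢
    have hd : Disjoint A B := Finset.disjoint_of_subset_left hA.1 Finset.sdiff_disjoint
    refine ⟨⟨Finset.union_subset (hA.1.trans Finset.sdiff_subset) hB, ?_⟩, Finset.subset_union_right⟩
    rw [Finset.card_union_of_disjoint hd, hA.2]; omega
  · intro A hA
    simp only [Finset.mem_filter] at hA
    exact Finset.sdiff_union_of_subset hA.2
  · intro A hA
    simp only [Finset.mem_powersetCard] at hA
    exact Finset.union_sdiff_cancel_right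
      (Finset.disjoint_of_subset_left hA.1 Finset.sdiff_disjoint)

/-- Expand `2 ^ |A₁ ∩ A|` as the number of subsets `B` of `A₁` contained in `A`. Each `B` is
contained in a random `A` with probability at most `(a / r) ^ |B|`, and the binomial theorem gives
`(1 + a / r) ^ a`. This is the second moment of the likelihood ratio in the next lemma. -/
theorem sum_two_pow_card_inter_le {V : Type*} [DecidableEq V] {U A₁ : Finset V} {a : ℕ}
    (hA₁ : A₁ ∈ U.powersetCard a) :
    ∑ A ∈ U.powersetCard a, (2 : ℝ) ^ (A₁ ∩ A).card ≤
      U.card.choose a * Real.exp ((a : ℝ) ^ 2 / U.card) := by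
  obtain ⟨hAU, hAa⟩ := Finset.mem_powersetCard.1 hA₁
  have har : a ≤ U.card := hAa ▸ Finset.card_le_card hAU
  rcases Nat.eq_zero_or_pos U.card with h0 | hpos
  · have ha : a = 0 := by omega
    subst ha
    have : A₁ = ∅ := Finset.card_eq_zero.1 hAa
    simp [this]
  have hr : (0 : ℝ) < U.card := by exact_mod_cast hpos
  have h1 : ∀ A : Finset V, (2 : ℝ) ^ (A₁ ∩ A).card =
      ∑ B ∈ A₁.powerset, if B ⊆ A then 1 else 0 := fun A => by
    rw [← Finset.sum_filter, Finset.sum_const, nsmul_eq_mul, mul_one]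
    have : A₁.powerset.filter (fun B => B ⊆ A) = (A₁ ∩ A).powerset := by
      ext B; simp only [Finset.mem_filter, Finset.mem_powerset, Finset.subset_inter_iff]
    rw [this, Finset.card_powerset]
    push_cast; rfl
  simp_rw [h1]
  rw [Finset.sum_comm]
  have h2 : ∀ B ∈ A₁.powerset, ∑ A ∈ U.powersetCard a, (if B ⊆ A then (1 : ℝ) else 0) ≤
      U.card.choose a * ((a : ℝ) / U.card) ^ B.card := fun B hB => by
    have hBA := Finset.mem_powerset.1 hB
    have hBa : B.card ≤ a := hAa ▸ Finset.card_le_card hBA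
    rw [← Finset.sum_filter, Finset.sum_const, nsmul_eq_mul, mul_one,
      card_filter_superset_powersetCard (hBA.trans hAU) hBa, div_pow, ← mul_div_assoc,
      le_div_iff₀ (by positivity)]
    exact choose_sub_mul_pow_le har _ hBa
  refine (Finset.sum_le_sum h2).trans ?_
  rw [← Finset.mul_sum]
  refine mul_le_mul_of_nonneg_left ?_ (Nat.cast_nonneg _)
  have h3 := Finset.sum_pow_mul_eq_add_pow ((a : ℝ) / U.card) 1 A₁
  simp only [one_pow, mul_one] at h3
  rw [h3, hAa]
  calc ((a : ℝ) / U.card + 1) ^ a ≤ Real.exp ((a : ℝ) / U.card) ^ a := by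
        gcongr
        exact Real.add_one_le_exp _
    _ = _ := by rw [← Real.exp_nat_mul]; congr 1; ring

/-- A random subset of `U` that avoids a hidden random `a`-set `A` looks like a uniform subset of
`U`. Its weight at `E` is proportional to the number `n E` of admissible `A` disjoint from `E`. For
two independent hidden sets, `2 ^ a * 2 ^ (r - |A₁ ∪ A₂|) = 2 ^ (r - a) * 2 ^ |A₁ ∩ A₂|`, so the
variance of `n E` is controlled by the preceding lemma, and Cauchy–Schwarz turns it into an `L¹`
bound. -/
theorem sum_powersetCard_sum_powerset_sdiff_le {V : Type*} [DecidableEq V] (U : Finset V) {a : ℕ}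
    (ha : a ≤ U.card) (h : Finset V → ℝ) (h0 : ∀ E, 0 ≤ h E) (h1 : ∀ E, h E ≤ 1) :
    (∑ A ∈ U.powersetCard a, ∑ E ∈ (U \ A).powerset, h E) ≤
      U.card.choose a * 2 ^ (U.card - a) * ((∑ E ∈ U.powerset, h E) / 2 ^ U.card +
        √(Real.exp ((a : ℝ) ^ 2 / U.card) - 1)) := by
  set r := U.card with hr
  set c : ℝ := ((r.choose a : ℕ) : ℝ) with hc
  have hcpos : 0 < c := Nat.cast_pos.2 (Nat.choose_pos ha)
  have h2r : (2 : ℝ) ^ r = 2 ^ (r - a) * 2 ^ a := by rw [← pow_add]; congr 1; omega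
  set n : Finset V → ℝ := fun E => ((U.powersetCard a).filter fun A => Disjoint A E).card with hn
  set ε := Real.exp ((a : ℝ) ^ 2 / r) with hε
  have hind : ∀ E, n E = ∑ A ∈ U.powersetCard a, if Disjoint A E then (1 : ℝ) else 0 := fun E => by
    rw [← Finset.sum_filter, Finset.sum_const, nsmul_eq_mul, mul_one]
  have hfil : ∀ A, U.powerset.filter (fun E => Disjoint A E) = (U \ A).powerset := fun A => by
    ext E
    simp only [Finset.mem_filter, Finset.mem_powerset, Finset.subset_sdiff, disjoint_comm]
  have hlhs : ∀ g : Finset V → ℝ, ∑ A ∈ U.powersetCard a, ∑ E ∈ (U \ A).powerset, g E =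
      ∑ E ∈ U.powerset, g E * n E := fun g => by
    simp_rw [hind, Finset.mul_sum]
    rw [Finset.sum_comm]
    refine Finset.sum_congr rfl fun A _ => ?_
    simp_rw [mul_ite, mul_one, mul_zero]
    rw [← Finset.sum_filter, hfil]
  have hcard : ∀ A ∈ U.powersetCard a, (U \ A).card = r - a := fun A hA => by
    obtain ⟨h1, h2⟩ := Finset.mem_powersetCard.1 hA
    rw [Finset.card_sdiff_of_subset h1, h2]
  have hmom1 : ∑ E ∈ U.powerset, n E = c * 2 ^ (r - a) := by
    have := hlhs fun _ => 1
    simp only [one_mul] at this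
    rw [← this]
    calc _ = ∑ A ∈ U.powersetCard a, (2 : ℝ) ^ (r - a) :=
          Finset.sum_congr rfl fun A hA => by
            rw [Finset.sum_const, Finset.card_powerset, hcard A hA]; simp
      _ = _ := by rw [Finset.sum_const, Finset.card_powersetCard, nsmul_eq_mul]
  have hmom2 : 2 ^ a * ∑ E ∈ U.powerset, n E ^ 2 ≤ c ^ 2 * 2 ^ (r - a) * ε := by
    have e1 : ∑ E ∈ U.powerset, n E ^ 2 =
        ∑ A₁ ∈ U.powersetCard a, ∑ A₂ ∈ U.powersetCard a, (2 : ℝ) ^ (r - (A₁ ∪ A₂).card) := by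
      have : ∀ E, n E ^ 2 = ∑ A₁ ∈ U.powersetCard a, ∑ A₂ ∈ U.powersetCard a,
          if Disjoint (A₁ ∪ A₂) E then (1 : ℝ) else 0 := fun E => by
        rw [sq, hind, Finset.sum_mul_sum]
        refine Finset.sum_congr rfl fun A₁ _ => Finset.sum_congr rfl fun A₂ _ => ?_
        by_cases d1 : Disjoint A₁ E <;> by_cases d2 : Disjoint A₂ E <;>
          simp [d1, d2, Finset.disjoint_union_left]
      simp_rw [this]
      rw [Finset.sum_comm]
      refine Finset.sum_congr rfl fun A₁ hA₁ => ?_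
      rw [Finset.sum_comm]
      refine Finset.sum_congr rfl fun A₂ hA₂ => ?_
      rw [← Finset.sum_filter, hfil, Finset.sum_const, Finset.card_powerset,
        Finset.card_sdiff_of_subset (Finset.union_subset (Finset.mem_powersetCard.1 hA₁).1
          (Finset.mem_powersetCard.1 hA₂).1)]
      simp [hr]
    have e2 : 2 ^ a * ∑ E ∈ U.powerset, n E ^ 2 = 2 ^ (r - a) *
        ∑ A₁ ∈ U.powersetCard a, ∑ A₂ ∈ U.powersetCard a, (2 : ℝ) ^ (A₁ ∩ A₂).card := by
      rw [e1]
      simp_rw [Finset.mul_sum]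
      refine Finset.sum_congr rfl fun A₁ hA₁ => Finset.sum_congr rfl fun A₂ hA₂ => ?_
      obtain ⟨s1, c1⟩ := Finset.mem_powersetCard.1 hA₁
      obtain ⟨s2, c2⟩ := Finset.mem_powersetCard.1 hA₂
      have hu := Finset.card_union_add_card_inter A₁ A₂
      have hle := Finset.card_le_card (Finset.union_subset s1 s2)
      rw [← pow_add, ← pow_add]
      congr 1
      omega
    rw [e2]
    calc _ ≤ 2 ^ (r - a) * ∑ A₁ ∈ U.powersetCard a, c * ε := by
          gcongr with A₁ hA₁
          exact sum_two_pow_card_inter_le hA₁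
      _ = _ := by rw [Finset.sum_const, Finset.card_powersetCard, nsmul_eq_mul]; ring
  set d : ℝ := c * 2 ^ (r - a) with hd
  have hdpos : 0 < d := by positivity
  have hvar : ∑ E ∈ U.powerset, (n E - d / 2 ^ r) ^ 2 ≤ d ^ 2 / 2 ^ r * (ε - 1) := by
    have e3 : ∑ E ∈ U.powerset, (n E - d / 2 ^ r) ^ 2 =
        ∑ E ∈ U.powerset, n E ^ 2 - d ^ 2 / 2 ^ r := by
      simp_rw [sub_sq]
      rw [Finset.sum_add_distrib, Finset.sum_sub_distrib, ← Finset.sum_mul, ← Finset.mul_sum, hmom1,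
        Finset.sum_const, Finset.card_powerset, ← hr]
      simp only [nsmul_eq_mul, Nat.cast_pow, Nat.cast_ofNat]
      field_simp
      ring
    have e4 : ∑ E ∈ U.powerset, n E ^ 2 ≤ d ^ 2 / 2 ^ r * ε := by
      have h2a : (0 : ℝ) < 2 ^ a := by positivity
      refine le_of_mul_le_mul_left (hmom2.trans (le_of_eq ?_)) h2a
      rw [hd, h2r]
      field_simp
    rw [e3]; linarith
  have hCS : ∑ E ∈ U.powerset, |n E - d / 2 ^ r| ≤ d * √(ε - 1) := by
    have hcs := sq_sum_le_card_mul_sum_sq (s := U.powerset) (f := fun E => |n E - d / 2 ^ r|)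
    simp only [sq_abs] at hcs
    rw [Finset.card_powerset, ← hr] at hcs
    push_cast at hcs
    have : d * √(ε - 1) = √(d ^ 2 * (ε - 1)) := by
      rw [Real.sqrt_mul (by positivity), Real.sqrt_sq hdpos.le]
    rw [this]
    refine Real.le_sqrt_of_sq_le (hcs.trans ?_)
    calc (2 : ℝ) ^ r * ∑ E ∈ U.powerset, (n E - d / 2 ^ r) ^ 2
        ≤ 2 ^ r * (d ^ 2 / 2 ^ r * (ε - 1)) := by gcongr
      _ = _ := by field_simp
  rw [hlhs]
  calc ∑ E ∈ U.powerset, h E * n E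
      ≤ ∑ E ∈ U.powerset, (h E * (d / 2 ^ r) + |n E - d / 2 ^ r|) := by
        refine Finset.sum_le_sum fun E _ => ?_
        nlinarith [h0 E, h1 E, le_abs_self (n E - d / 2 ^ r), abs_nonneg (n E - d / 2 ^ r)]
    _ = d * ((∑ E ∈ U.powerset, h E) / 2 ^ r) + ∑ E ∈ U.powerset, |n E - d / 2 ^ r| := by
        rw [Finset.sum_add_distrib, ← Finset.sum_mul]; ring
    _ ≤ d * ((∑ E ∈ U.powerset, h E) / 2 ^ r) + d * √(ε - 1) := by gcongr
    _ = _ := by ring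

theorem sum_powerset_univ_split {V M : Type*} [Fintype V] [DecidableEq V] [AddCommMonoid M]
    (C : Finset V) (F : Finset V → Finset V → M) :
    ∑ D : Finset V, F (C ∩ D) (D \ C) = ∑ S ∈ C.powerset, ∑ E ∈ Cᶜ.powerset, F S E := by
  rw [← Finset.sum_product']
  refine Finset.sum_bij' (fun D _ => (C ∩ D, D \ C)) (fun p _ => p.1 ∪ p.2) ?_ ?_ ?_ ?_ ?_
  · intro D _
    simp only [Finset.mem_product, Finset.mem_powerset]
    refine ⟨Finset.inter_subset_left, fun x hx => ?_⟩
    rw [Finset.mem_compl]; exact (Finset.mem_sdiff.1 hx).2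
  · intro p _; exact Finset.mem_univ _
  · intro D _
    ext x; simp only [Finset.mem_union, Finset.mem_inter, Finset.mem_sdiff]; tauto
  · rintro ⟨S, E⟩ hp
    simp only [Finset.mem_product, Finset.mem_powerset] at hp
    have h1 : ∀ x, x ∈ S → x ∈ C := fun x hx => hp.1 hx
    have h2 : ∀ x, x ∈ E → x ∉ C := fun x hx => Finset.mem_compl.1 (hp.2 hx)
    ext x
    · simp only [Finset.mem_union, Finset.mem_inter]; have := h1 x; have := h2 x; tauto
    · simp only [Finset.mem_union, Finset.mem_sdiff]; have := h1 x; have := h2 x; tauto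
  · intro D _; rfl

/-- Exchanges the order of choice: instead of `C` and then `S ⊆ C`, first `S` and then `C \ S` among
the remaining vertices. -/
theorem sum_powersetCard_sum_powerset {V M : Type*} [Fintype V] [DecidableEq V] [AddCommMonoid M]
    (k : ℕ) (F : Finset V → Finset V → M) :
    ∑ C ∈ Finset.univ.powersetCard k, ∑ S ∈ C.powerset, F S (C \ S) =
      ∑ S : Finset V with S.card ≤ k, ∑ A ∈ Sᶜ.powersetCard (k - S.card), F S A := by
  rw [Finset.sum_sigma', Finset.sum_sigma']
  refine Finset.sum_bij' (fun p _ => ⟨p.2, p.1 \ p.2⟩) (fun p _ => ⟨p.1 ∪ p.2, p.1⟩) ?_ ?_ ?_ ?_ ?_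
  · rintro ⟨C, S⟩ hp
    simp only [Finset.mem_sigma, Finset.mem_powersetCard, Finset.mem_powerset, Finset.mem_filter,
      Finset.mem_univ, true_and] at hp ⊢
    refine ⟨hp.1.2 ▸ Finset.card_le_card hp.2, fun x hx => ?_, ?_⟩
    · rw [Finset.mem_compl]; exact (Finset.mem_sdiff.1 hx).2
    · rw [Finset.card_sdiff_of_subset hp.2, hp.1.2]
  · rintro ⟨S, A⟩ hp
    simp only [Finset.mem_sigma, Finset.mem_powersetCard, Finset.mem_powerset, Finset.mem_filter,
      Finset.mem_univ, true_and] at hp ⊢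
    have hd : Disjoint S A := (Finset.subset_compl_iff_disjoint_left).1 hp.2.1
    exact ⟨⟨Finset.subset_univ _, by rw [Finset.card_union_of_disjoint hd, hp.2.2]; omega⟩,
      Finset.subset_union_left⟩
  · rintro ⟨C, S⟩ hp
    simp only [Finset.mem_sigma, Finset.mem_powerset] at hp
    simp [Finset.union_sdiff_of_subset hp.2]
  · rintro ⟨S, A⟩ hp
    simp only [Finset.mem_sigma, Finset.mem_powersetCard] at hp
    have hd : Disjoint S A := (Finset.subset_compl_iff_disjoint_left).1 hp.2.1
    simp [Finset.union_sdiff_cancel_left hd]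
  · rintro ⟨C, S⟩ _; rfl

/-- Erasing the part of a uniformly random set `D` outside `C` reveals little on a uniformly random
`k`-set `C`: given `C ∩ D`, the rest of `D` is close to uniform. -/
theorem sum_inter_le_sum_inter_union {V : Type*} [Fintype V] [DecidableEq V] {k : ℕ}
    (hk : 2 * k ≤ Fintype.card V) (f : Finset V → Finset V → ℝ) (h0 : ∀ S E, 0 ≤ f S E)
    (h1 : ∀ S E, f S E ≤ 1) :
    (∑ C ∈ Finset.univ.powersetCard k, ∑ D : Finset V, f (C ∩ D) D) / 2 ^ Fintype.card V ≤
      (∑ C ∈ Finset.univ.powersetCard k, ∑ D : Finset V, ∑ D' : Finset V,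
        f (C ∩ D) (C ∩ D ∪ D')) / (2 ^ Fintype.card V * 2 ^ Fintype.card V) +
      (Fintype.card V).choose k * √(Real.exp (2 * (k : ℝ) ^ 2 / Fintype.card V) - 1) := by
  set n := Fintype.card V with hn
  set ε := √(Real.exp (2 * (k : ℝ) ^ 2 / n) - 1) with hε
  have hsplit : ∀ C ∈ Finset.univ.powersetCard k, ∑ D : Finset V, f (C ∩ D) D =
      ∑ S ∈ C.powerset, ∑ E ∈ (Sᶜ \ (C \ S)).powerset, f S (S ∪ E) := fun C _ => by
    have := sum_powerset_univ_split C fun S E => f S (S ∪ E)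
    have e : ∀ D : Finset V, C ∩ D ∪ D \ C = D := fun D => by
      ext x; simp only [Finset.mem_union, Finset.mem_inter, Finset.mem_sdiff]; tauto
    simp only [e] at this
    rw [this]
    refine Finset.sum_congr rfl fun S hS => ?_
    have hSC : ∀ x, x ∈ S → x ∈ C := fun x hx => Finset.mem_powerset.1 hS hx
    rw [show Sᶜ \ (C \ S) = Cᶜ from ?_]
    ext x
    simp only [Finset.mem_sdiff, Finset.mem_compl]
    have := hSC x
    tauto
  -- Once `S = C ∩ D` is fixed, `A = C \ S` is a hidden uniform subset of `Sᶜ`, and the rest of `D`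
  -- is a uniform subset of `Sᶜ` avoiding `A`: the situation of
  -- `sum_powersetCard_sum_powerset_sdiff_le`.
  have hL : ∑ C ∈ Finset.univ.powersetCard k, ∑ D : Finset V, f (C ∩ D) D =
      ∑ S : Finset V with S.card ≤ k, ∑ A ∈ Sᶜ.powersetCard (k - S.card),
        ∑ E ∈ (Sᶜ \ A).powerset, f S (S ∪ E) := by
    rw [Finset.sum_congr rfl hsplit, sum_powersetCard_sum_powerset k
      fun S A => ∑ E ∈ (Sᶜ \ A).powerset, f S (S ∪ E)]
  have hcompl : ∀ S : Finset V, Sᶜ.card = n - S.card := Finset.card_compl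
  have hRD : ∀ S : Finset V, ∑ D' : Finset V, f S (S ∪ D') =
      2 ^ S.card * ∑ E ∈ Sᶜ.powerset, f S (S ∪ E) := fun S => by
    have := sum_powerset_univ_split S fun _ E => f S (S ∪ E)
    have e : ∀ D : Finset V, S ∪ D \ S = S ∪ D := fun D => Finset.union_sdiff_self_eq_union
    simp only [e] at this
    rw [this, Finset.sum_const, Finset.card_powerset]
    simp
  have hR : ∑ C ∈ Finset.univ.powersetCard k, ∑ D : Finset V, ∑ D' : Finset V,
        f (C ∩ D) (C ∩ D ∪ D') = ∑ S : Finset V with S.card ≤ k,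
        (n - S.card).choose (k - S.card) * (2 ^ (n - k) *
          (2 ^ S.card * ∑ E ∈ Sᶜ.powerset, f S (S ∪ E))) := by
    have e1 : ∀ C ∈ Finset.univ.powersetCard k, ∑ D : Finset V, ∑ D' : Finset V,
        f (C ∩ D) (C ∩ D ∪ D') = ∑ S ∈ C.powerset, 2 ^ (n - k) *
          (2 ^ S.card * ∑ E ∈ Sᶜ.powerset, f S (S ∪ E)) := fun C hC => by
      have := sum_powerset_univ_split C fun S _ => ∑ D' : Finset V, f S (S ∪ D')
      rw [this]
      refine Finset.sum_congr rfl fun S _ => ?_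
      rw [Finset.sum_const, Finset.card_powerset, hcompl, (Finset.mem_powersetCard.1 hC).2, hRD]
      simp
    rw [Finset.sum_congr rfl e1, sum_powersetCard_sum_powerset k
      fun S _ => 2 ^ (n - k) * (2 ^ S.card * ∑ E ∈ Sᶜ.powerset, f S (S ∪ E))]
    refine Finset.sum_congr rfl fun S _ => ?_
    rw [Finset.sum_const, Finset.card_powersetCard, hcompl, nsmul_eq_mul]
  have hchoose : ∑ S : Finset V with S.card ≤ k,
      ((n - S.card).choose (k - S.card) : ℝ) = n.choose k * 2 ^ k := by
    have := sum_powersetCard_sum_powerset (V := V) k fun _ _ => (1 : ℝ)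
    simp only [Finset.sum_const, Finset.card_powersetCard, nsmul_eq_mul, mul_one, hcompl,
      Finset.card_powerset] at this
    rw [← this]
    rw [Finset.sum_congr rfl fun C hC => by rw [(Finset.mem_powersetCard.1 hC).2],
      Finset.sum_const, Finset.card_powersetCard, Finset.card_univ]
    simp [hn]
  have hkn : k ≤ n := by omega
  have hterm : ∀ S ∈ Finset.univ.filter (fun S : Finset V => S.card ≤ k),
      (∑ A ∈ Sᶜ.powersetCard (k - S.card), ∑ E ∈ (Sᶜ \ A).powerset, f S (S ∪ E)) / 2 ^ n ≤
      ((n - S.card).choose (k - S.card) * (2 ^ (n - k) *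
          (2 ^ S.card * ∑ E ∈ Sᶜ.powerset, f S (S ∪ E)))) / (2 ^ n * 2 ^ n) +
        (n - S.card).choose (k - S.card) / 2 ^ k * ε := fun S hS => by
    have hSk : S.card ≤ k := (Finset.mem_filter.1 hS).2
    have hcore := sum_powersetCard_sum_powerset_sdiff_le Sᶜ (a := k - S.card)
      (by rw [hcompl]; omega) (fun E => f S (S ∪ E)) (fun E => h0 _ _) (fun E => h1 _ _)
    rw [hcompl] at hcore
    set c : ℝ := (((n - S.card).choose (k - S.card) : ℕ) : ℝ) with hc
    set T := ∑ E ∈ Sᶜ.powerset, f S (S ∪ E) with hT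
    have hc0 : 0 ≤ c := Nat.cast_nonneg _
    -- A bound uniform in `S`: since `|S| ≤ k ≤ n / 2`, the complement has at least `n / 2`
    -- elements, which produces the factor `2` in the exponent.
    have hεle : √(Real.exp (((k - S.card : ℕ) : ℝ) ^ 2 / ((n - S.card : ℕ) : ℝ)) - 1) ≤ ε := by
      refine Real.sqrt_le_sqrt (sub_le_sub_right (Real.exp_le_exp.2 ?_) 1)
      rcases Nat.eq_zero_or_pos k with hk0 | hkpos
      · simp [hk0]
      have hnpos : 0 < n := by omega
      have e1 : ((k - S.card : ℕ) : ℝ) ≤ k := by exact_mod_cast Nat.sub_le _ _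
      have e2 : (n : ℝ) / 2 ≤ ((n - S.card : ℕ) : ℝ) := by
        rw [div_le_iff₀ two_pos]
        exact_mod_cast (by omega : n ≤ (n - S.card) * 2)
      have e3 : (0 : ℝ) < n := by exact_mod_cast hnpos
      calc _ ≤ (k : ℝ) ^ 2 / ((n : ℝ) / 2) := by gcongr
        _ = _ := by field_simp
    have p1 : (2 : ℝ) ^ n = 2 ^ (n - S.card - (k - S.card)) * 2 ^ k := by
      rw [← pow_add]; congr 1; omega
    have p2 : (2 : ℝ) ^ n = 2 ^ (n - S.card) * 2 ^ S.card := by rw [← pow_add]; congr 1; omega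
    have p3 : (2 : ℝ) ^ (n - S.card - (k - S.card)) = 2 ^ (n - k) := by congr 1; omega
    rw [div_le_iff₀ (by positivity)]
    refine hcore.trans ?_
    rw [p3] at p1 ⊢
    calc c * 2 ^ (n - k) * (T / 2 ^ (n - S.card) +
          √(Real.exp (((k - S.card : ℕ) : ℝ) ^ 2 / ((n - S.card : ℕ) : ℝ)) - 1))
        ≤ c * 2 ^ (n - k) * (T / 2 ^ (n - S.card) + ε) := by gcongr
      _ = _ := by
        have e : T / 2 ^ (n - S.card) = 2 ^ S.card * T / 2 ^ n := by
          rw [p2]; field_simp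
        rw [e, add_mul, mul_add]
        congr 1
        · field_simp
        · rw [p1]; field_simp
  rw [hL, hR, Finset.sum_div, Finset.sum_div]
  refine (Finset.sum_le_sum hterm).trans (le_of_eq ?_)
  rw [Finset.sum_add_distrib, ← Finset.sum_mul, ← Finset.sum_div, ← Finset.sum_div, hchoose]
  congr 2
  field_simp

/-! ### Planted bits from a planted clique -/

/-- The law of a fair coin. -/
noncomputable def fairCoin : Measure Bool :=
  ProbabilityTheory.bernoulliMeasure true false ⟨1 / 2, by norm_num, by norm_num⟩

instance : IsProbabilityMeasure fairCoin := by unfold fairCoin; infer_instance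

theorem fairCoin_singleton (b : Bool) : fairCoin {b} = 2⁻¹ := by
  rw [fairCoin, two_mul_bernoulli_half]
  cases b <;> simp [ENNReal.smul_def]

theorem lintegral_pi_fairCoin {κ : Type*} [Fintype κ] [DecidableEq κ] (g : (κ → Bool) → ℝ≥0∞) :
    ∫⁻ b, g b ∂(Measure.pi fun _ => fairCoin) = (∑ b, g b) / 2 ^ Fintype.card κ := by
  rw [lintegral_fintype, ENNReal.div_eq_inv_mul, Finset.mul_sum]
  refine Finset.sum_congr rfl fun b _ => ?_
  rw [Measure.pi_singleton, mul_comm]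
  simp [fairCoin_singleton, ENNReal.inv_pow]

open Classical in
/-- The bits (a symmetric matrix, including its diagonal, stored in the upper triangle) read off a
graph `H` on `n ≤ N` vertices, the vertices being placed at the positions `j`. Only the vertices
with `D a = true` are used; their diagonal bits are `true`, and fresh bits `U` fill the rest. -/
noncomputable def graphBits {n N : ℕ} (j : Fin n ↪ Fin N) (H : SimpleGraph (Fin n)) (D : Fin n → Bool)
    (U : Fin N × Fin N → Bool) (p : Fin N × Fin N) : Bool :=
  match Function.partialInv j p.1, Function.partialInv j p.2 with
  | some a, some b =>
    if p.1 < p.2 then (if D a ∧ D b then decide (H.Adj a b) else U p)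
    else if p.1 = p.2 then D a else U p
  | _, _ => U p

/-- The source of an off-diagonal bit of `graphBits`. -/
noncomputable def bitSource {n N : ℕ} (j : Fin n ↪ Fin N) (D : Fin n → Bool) (p : Fin N × Fin N) :
    Sym2 (Fin n) ⊕ (Fin N × Fin N) :=
  match Function.partialInv j p.1, Function.partialInv j p.2 with
  | some a, some b => if p.1 < p.2 ∧ D a ∧ D b then .inl s(a, b) else .inr p
  | _, _ => .inr p

/-- The source of a bit of `overrideDiag`. -/
noncomputable def diagSource {n N : ℕ} (j : Fin n ↪ Fin N) (p : Fin N × Fin N) :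
    Fin n ⊕ (Fin N × Fin N) :=
  match Function.partialInv j p.1 with
  | some a => if p.1 = p.2 then .inl a else .inr p
  | none => .inr p

/-- Replace the diagonal bits at the positions `j` by the bits `D`. -/
noncomputable def overrideDiag {n N : ℕ} (j : Fin n ↪ Fin N) (D : Fin n → Bool)
    (x : Fin N × Fin N → Bool) (p : Fin N × Fin N) : Bool :=
  Sum.elim D x (diagSource j p)

/-- The pairs of positions of elements of `S`, in the upper triangle. -/
def plantedPairs {n N : ℕ} (j : Fin n ↪ Fin N) (S : Finset (Fin n)) : Finset (Fin N × Fin N) :=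
  ((S.map j) ×ˢ (S.map j)).filter fun p => p.1 ≤ p.2

/-- Set the bits in `P` to `true`. -/
def plantBits {κ : Type*} [DecidableEq κ] (P : Finset κ) (x : κ → Bool) (p : κ) : Bool :=
  if p ∈ P then true else x p

theorem partialInv_eq_some {n N : ℕ} (j : Fin n ↪ Fin N) (a : Fin n) (p : Fin N) :
    Function.partialInv j p = some a ↔ j a = p :=
  j.injective.isPartialInv a p

theorem partialInv_apply {n N : ℕ} (j : Fin n ↪ Fin N) (a : Fin n) :
    Function.partialInv j (j a) = some a := (partialInv_eq_some j a _).2 rfl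

theorem mem_plantedPairs {n N : ℕ} {j : Fin n ↪ Fin N} {S : Finset (Fin n)} {p : Fin N × Fin N} :
    p ∈ plantedPairs j S ↔ p.1 ≤ p.2 ∧ ∃ a ∈ S, ∃ b ∈ S, p = (j a, j b) := by
  simp only [plantedPairs, Finset.mem_filter, Finset.mem_product, Finset.mem_map]
  constructor
  · rintro ⟨⟨⟨a, ha, h1⟩, b, hb, h2⟩, h⟩
    exact ⟨h, a, ha, b, hb, Prod.ext h1.symm h2.symm⟩
  · rintro ⟨h, a, ha, b, hb, rfl⟩
    exact ⟨⟨⟨a, ha, rfl⟩, b, hb, rfl⟩, h⟩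

theorem bitSource_cases {n N : ℕ} (j : Fin n ↪ Fin N) (D : Fin n → Bool) (p : Fin N × Fin N) :
    bitSource j D p = .inr p ∨
      ∃ a b, p = (j a, j b) ∧ j a < j b ∧ bitSource j D p = .inl s(a, b) := by
  unfold bitSource
  split
  · rename_i a b ha hb
    split_ifs with h
    · right
      rw [partialInv_eq_some] at ha hb
      exact ⟨a, b, Prod.ext ha.symm hb.symm, by rw [ha, hb]; exact h.1, rfl⟩
    · left; rfl
  · left; rfl

/-- An edge is read only at the one of its two positions that lies above the diagonal, and a fresh
bit only at its own position. -/
theorem bitSource_injective {n N : ℕ} (j : Fin n ↪ Fin N) (D : Fin n → Bool) :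
    Function.Injective (bitSource j D) := by
  intro p p' h
  rcases bitSource_cases j D p with h1 | ⟨a, b, rfl, hab, h1⟩ <;>
  rcases bitSource_cases j D p' with h2 | ⟨a', b', rfl, hab', h2⟩ <;>
  rw [h1, h2] at h
  · exact Sum.inr_injective h
  · simp at h
  · simp at h
  · rcases Sym2.eq_iff.1 (Sum.inl_injective h) with ⟨rfl, rfl⟩ | ⟨rfl, rfl⟩
    · rfl
    · exact absurd hab (not_lt.2 hab'.le)

theorem diagSource_cases {n N : ℕ} (j : Fin n ↪ Fin N) (p : Fin N × Fin N) :
    diagSource j p = .inr p ∨ ∃ a, p = (j a, j a) ∧ diagSource j p = .inl a := by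
  unfold diagSource
  split
  · rename_i a ha
    split_ifs with h
    · right
      rw [partialInv_eq_some] at ha
      exact ⟨a, Prod.ext ha.symm (by rw [ha, h]), rfl⟩
    · left; rfl
  · left; rfl

theorem diagSource_injective {n N : ℕ} (j : Fin n ↪ Fin N) : Function.Injective (diagSource j) := by
  intro p p' h
  rcases diagSource_cases j p with h1 | ⟨a, rfl, h1⟩ <;>
  rcases diagSource_cases j p' with h2 | ⟨a', rfl, h2⟩ <;>
  rw [h1, h2] at h
  · exact Sum.inr_injective h
  · simp at h
  · simp at h
  · rw [Sum.inl_injective h]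

theorem overrideDiag_diag {n N : ℕ} (j : Fin n ↪ Fin N) (D : Fin n → Bool)
    (x : Fin N × Fin N → Bool) (a : Fin n) : overrideDiag j D x (j a, j a) = D a := by
  simp [overrideDiag, diagSource, partialInv_apply]

theorem overrideDiag_of_ne {n N : ℕ} (j : Fin n ↪ Fin N) (D : Fin n → Bool)
    (x : Fin N × Fin N → Bool) {p : Fin N × Fin N} (hp : ∀ a, p ≠ (j a, j a)) :
    overrideDiag j D x p = x p := by
  rcases diagSource_cases j p with h | ⟨a, h, -⟩
  · simp [overrideDiag, h]
  · exact absurd h (hp a)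

/-- For fixed `D` every bit is a copy of one independent source, apart from the diagonal override;
this form makes the independence of the bits visible. -/
theorem graphBits_fromEdgeSet {n N : ℕ} (j : Fin n ↪ Fin N) (y : Sym2 (Fin n) → Bool)
    (D : Fin n → Bool) (U : Fin N × Fin N → Bool) :
    graphBits j (SimpleGraph.fromEdgeSet {e | y e = true}) D U =
      overrideDiag j D fun p => Sum.elim y U (bitSource j D p) := by
  funext p
  obtain ⟨p1, p2⟩ := p
  by_cases hd : ∃ a, (p1, p2) = (j a, j a)
  · obtain ⟨a, ha⟩ := hd
    obtain ⟨rfl, rfl⟩ := Prod.ext_iff.1 ha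
    rw [overrideDiag_diag]
    simp [graphBits, partialInv_apply]
  · rw [overrideDiag_of_ne j D _ (not_exists.1 hd)]
    unfold graphBits bitSource
    cases h1 : Function.partialInv j p1 with
    | none => simp
    | some a =>
      cases h2 : Function.partialInv j p2 with
      | none => simp
      | some b =>
        simp only
        rw [partialInv_eq_some] at h1 h2
        subst h1 h2
        by_cases hlt : j a < j b
        · have hab : a ≠ b := fun h => by subst h; exact lt_irrefl _ hlt
          by_cases hD : D a = true ∧ D b = true
          · simp [hlt, hD, hab]
          · simp [hlt, hD]
        · have hne : j a ≠ j b := fun h => hd ⟨a, Prod.ext rfl h.symm⟩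
          simp [hlt, hne]

/-- The set of indices of the `true` bits. -/
def trueSet {κ : Type*} [Fintype κ] (D : κ → Bool) : Finset κ := Finset.univ.filter fun a => D a = true

/-- Edges touching `C \ D` are never read, and vertices of `C ∩ D` already have a `true` diagonal
bit. What remains of the clique is a full block on `C ∩ D`, diagonal included. -/
theorem graphBits_sup_clique {n N : ℕ} (j : Fin n ↪ Fin N) (G : SimpleGraph (Fin n))
    (C : Finset (Fin n)) (D : Fin n → Bool) (U : Fin N × Fin N → Bool) :
    graphBits j (G ⊔ SimpleGraph.fromRel fun u v => u ∈ C ∧ v ∈ C) D U =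
      plantBits (plantedPairs j (C ∩ trueSet D)) (graphBits j G D U) := by
  funext p
  obtain ⟨p1, p2⟩ := p
  unfold plantBits
  by_cases hp : (p1, p2) ∈ plantedPairs j (C ∩ trueSet D)
  · rw [if_pos hp]
    obtain ⟨hle, a, ha, b, hb, hab⟩ := mem_plantedPairs.1 hp
    obtain ⟨rfl, rfl⟩ := Prod.ext_iff.1 hab
    simp only [trueSet, Finset.mem_inter, Finset.mem_filter, Finset.mem_univ, true_and] at ha hb
    simp only [graphBits, partialInv_apply]
    by_cases hlt : j a < j b
    · have hne : a ≠ b := fun h => by subst h; exact lt_irrefl _ hlt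
      simp [hlt, ha, hb, hne]
    · have : j a = j b := le_antisymm hle (not_lt.1 hlt)
      simp [this, ha]
  · rw [if_neg hp]
    unfold graphBits
    cases h1 : Function.partialInv j p1 with
    | none => simp
    | some a =>
      cases h2 : Function.partialInv j p2 with
      | none => simp
      | some b =>
        simp only
        rw [partialInv_eq_some] at h1 h2
        subst h1 h2
        by_cases hlt : j a < j b
        · by_cases hD : D a = true ∧ D b = true
          · have : ¬ (a ∈ C ∧ b ∈ C) := fun h => hp (mem_plantedPairs.2 ⟨hlt.le, a, by
              simp [trueSet, h, hD], b, by simp [trueSet, h, hD], rfl⟩)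
            have h' : ¬ (b ∈ C ∧ a ∈ C) := fun h => this h.symm
            simp [hlt, hD, this, h']
          · simp [hlt, hD]
        · simp [hlt]

theorem lintegral_graphBits {n N : ℕ} (j : Fin n ↪ Fin N) (D : Fin n → Bool)
    (Φ : (Fin N × Fin N → Bool) → ℝ≥0∞) :
    ∫⁻ G, ∫⁻ U, Φ (graphBits j G D U) ∂(Measure.pi fun _ => fairCoin)
      ∂(SimpleGraph.binomialRandom (Fin n) ⟨1 / 2, by norm_num, by norm_num⟩) =
    ∫⁻ x, Φ (overrideDiag j D x) ∂(Measure.pi fun _ => fairCoin) := by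
  rw [binomialRandom_eq_inhomogeneousRandomGraph, inhomogeneousRandomGraph,
    lintegral_map (measurable_of_finite _) measurable_fromEdgeSet_bool]
  simp_rw [graphBits_fromEdgeSet]
  exact lintegral_pi_sumElim_comp fairCoin (bitSource_injective j D)
    (F := fun x => Φ (overrideDiag j D x)) (measurable_of_finite _)

theorem lintegral_overrideDiag {n N : ℕ} (j : Fin n ↪ Fin N) (Φ : (Fin N × Fin N → Bool) → ℝ≥0∞) :
    ∫⁻ D, ∫⁻ x, Φ (overrideDiag j D x) ∂(Measure.pi fun _ => fairCoin)
      ∂(Measure.pi fun _ => fairCoin) = ∫⁻ x, Φ x ∂(Measure.pi fun _ => fairCoin) :=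
  lintegral_pi_sumElim_comp fairCoin (diagSource_injective j) (measurable_of_finite _)

theorem lintegral_plantBits {κ : Type*} [Fintype κ] [DecidableEq κ] (P : Finset κ)
    (Φ : (κ → Bool) → ℝ≥0∞) :
    ∫⁻ x, Φ (plantBits P x) ∂(Measure.pi fun _ => fairCoin) =
      ∫⁻ x, Φ x ∂(Measure.pi fun i => if i ∈ P then Measure.dirac true else fairCoin) := by
  have h : (fun i => if i ∈ P then Measure.dirac true else fairCoin) =
      fun i => fairCoin.map fun b => if i ∈ P then true else b := by
    funext i
    split_ifs
    · rw [Measure.map_const, measure_univ, one_smul]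
    · exact Measure.map_id.symm
  have : ∀ i, IsProbabilityMeasure (fairCoin.map fun b => if i ∈ P then true else b) := fun i =>
    Measure.isProbabilityMeasure_map (measurable_of_finite _).aemeasurable
  rw [h, ← Measure.pi_map_pi (fun i => (measurable_of_finite _).aemeasurable),
    lintegral_map (measurable_of_finite _) (measurable_of_finite _)]
  rfl

/-- Planting on `S` overwrites the diagonal bits of `S`, so it does not matter whether `S` belongs
to the set defining the diagonal. Hence the diagonal may be taken from a fresh uniform set. -/
theorem plantBits_overrideDiag_union {n N : ℕ} (j : Fin n ↪ Fin N) (S E : Finset (Fin n))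
    (x : Fin N × Fin N → Bool) :
    plantBits (plantedPairs j S) (overrideDiag j (fun a => decide (a ∈ S ∪ E)) x) =
      plantBits (plantedPairs j S) (overrideDiag j (fun a => decide (a ∈ E)) x) := by
  funext p
  unfold plantBits
  by_cases hp : p ∈ plantedPairs j S
  · rw [if_pos hp, if_pos hp]
  · rw [if_neg hp, if_neg hp]
    by_cases hd : ∃ a, p = (j a, j a)
    · obtain ⟨a, rfl⟩ := hd
      rw [overrideDiag_diag, overrideDiag_diag]
      have : a ∉ S := fun h => hp (mem_plantedPairs.2 ⟨le_rfl, a, h, a, h, rfl⟩)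
      simp [this]
    · rw [overrideDiag_of_ne j _ x (not_exists.1 hd), overrideDiag_of_ne j _ x (not_exists.1 hd)]

/-- Functions `κ → Bool` and finite subsets of `κ`. -/
def boolFunEquivFinset (κ : Type*) [Fintype κ] [DecidableEq κ] : (κ → Bool) ≃ Finset κ where
  toFun := trueSet
  invFun S := fun a => decide (a ∈ S)
  left_inv D := by funext a; simp [trueSet]
  right_inv S := by ext a; simp [trueSet]

/-- The bits read off a graph with a planted clique are close to planted bits. -/
theorem sum_lintegral_graphBits_clique_le {n N k : ℕ} (hk : 2 * k ≤ n) (j : Fin n ↪ Fin N)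
    (Φ : (Fin N × Fin N → Bool) → ℝ≥0∞) (hΦ : ∀ x, Φ x ≤ 1) :
    ((n.choose k : ℝ≥0∞)⁻¹) * ∑ C ∈ Finset.univ.powersetCard k,
      ∫⁻ D, ∫⁻ G, ∫⁻ U, Φ (graphBits j (G ⊔ SimpleGraph.fromRel fun u v => u ∈ C ∧ v ∈ C) D U)
        ∂(Measure.pi fun _ => fairCoin)
        ∂(SimpleGraph.binomialRandom (Fin n) ⟨1 / 2, by norm_num, by norm_num⟩)
        ∂(Measure.pi fun _ => fairCoin) ≤
    ((n.choose k : ℝ≥0∞)⁻¹) * ∑ C ∈ Finset.univ.powersetCard k, ∫⁻ D, ∫⁻ x, Φ x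
        ∂(Measure.pi fun i => if i ∈ plantedPairs j (C ∩ trueSet D) then Measure.dirac true
          else fairCoin)
        ∂(Measure.pi fun _ => fairCoin) +
      ENNReal.ofReal √(Real.exp (2 * (k : ℝ) ^ 2 / n) - 1) := by
  set ε := √(Real.exp (2 * (k : ℝ) ^ 2 / n) - 1) with hε
  set f : Finset (Fin n) → Finset (Fin n) → ℝ≥0∞ := fun S E =>
    ∫⁻ x, Φ (plantBits (plantedPairs j S) (overrideDiag j (fun a => decide (a ∈ E)) x))
      ∂(Measure.pi fun _ => fairCoin) with hf
  have hf1 : ∀ S E, f S E ≤ 1 := fun S E => by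
    calc f S E ≤ ∫⁻ _, 1 ∂(Measure.pi fun _ => fairCoin) := lintegral_mono fun _ => hΦ _
      _ = 1 := by simp
  have hfin : ∀ S E, f S E ≠ ∞ := fun S E => ((hf1 S E).trans_lt ENNReal.one_lt_top).ne
  have hunion : ∀ S E, f S (S ∪ E) = f S E := fun S E => by
    simp only [hf, plantBits_overrideDiag_union]
  have hD : ∀ g : Finset (Fin n) → ℝ≥0∞, ∫⁻ D, g (trueSet D) ∂(Measure.pi fun _ => fairCoin) =
      (∑ D, g D) / 2 ^ n := fun g => by
    rw [lintegral_pi_fairCoin, Fintype.card_fin]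
    congr 1
    exact Fintype.sum_equiv (boolFunEquivFinset (Fin n)) _ _ fun D => rfl
  have hdec : ∀ D : Fin n → Bool, (fun a => decide (a ∈ trueSet D)) = D :=
    (boolFunEquivFinset (Fin n)).left_inv
  have hL : ∀ C : Finset (Fin n), ∫⁻ D, ∫⁻ G, ∫⁻ U,
      Φ (graphBits j (G ⊔ SimpleGraph.fromRel fun u v => u ∈ C ∧ v ∈ C) D U)
        ∂(Measure.pi fun _ => fairCoin)
        ∂(SimpleGraph.binomialRandom (Fin n) ⟨1 / 2, by norm_num, by norm_num⟩)
        ∂(Measure.pi fun _ => fairCoin) = (∑ D, f (C ∩ D) D) / 2 ^ n := fun C => by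
    rw [← hD fun D => f (C ∩ D) D]
    refine lintegral_congr fun D => ?_
    simp_rw [graphBits_sup_clique]
    rw [lintegral_graphBits j D fun x => Φ (plantBits (plantedPairs j (C ∩ trueSet D)) x)]
    simp only [hf, hdec]
  have hR : ∀ C : Finset (Fin n), ∫⁻ D, ∫⁻ x, Φ x
        ∂(Measure.pi fun i => if i ∈ plantedPairs j (C ∩ trueSet D) then Measure.dirac true
          else fairCoin)
        ∂(Measure.pi fun _ => fairCoin) = (∑ D, ∑ D', f (C ∩ D) (C ∩ D ∪ D')) / (2 ^ n * 2 ^ n) :=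
      fun C => by
    have e : ∀ S : Finset (Fin n), ∫⁻ x, Φ x ∂(Measure.pi fun i => if i ∈ plantedPairs j S then
        Measure.dirac true else fairCoin) = (∑ D', f S (S ∪ D')) / 2 ^ n := fun S => by
      simp_rw [hunion]
      rw [← hD fun D' => f S D', ← lintegral_plantBits, ← lintegral_overrideDiag j]
      simp only [hf, hdec]
    simp_rw [e]
    rw [hD fun D => (∑ D', f (C ∩ D) (C ∩ D ∪ D')) / 2 ^ n]
    simp_rw [div_eq_mul_inv]
    rw [← Finset.sum_mul, mul_assoc, ENNReal.mul_inv (by simp) (by simp)]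
  simp_rw [hL, hR]
  -- What remains is finite counting over `C`, `D` and `D'` with the `[0, 1]`-valued function `f`;
  -- the rest is the passage between `ℝ` and `ℝ≥0∞`.
  have hmain := sum_inter_le_sum_inter_union (V := Fin n) (k := k) (by simpa using hk)
    (fun S E => (f S E).toReal) (fun S E => ENNReal.toReal_nonneg)
    (fun S E => ENNReal.toReal_le_of_le_ofReal zero_le_one (by simpa using hf1 S E))
  simp only [Fintype.card_fin] at hmain
  have hc0 : (n.choose k : ℝ≥0∞) ≠ 0 := by
    exact_mod_cast (Nat.choose_pos (by omega : k ≤ n)).ne'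
  have hct : (n.choose k : ℝ≥0∞) ≠ ∞ := ENNReal.natCast_ne_top _
  have h2 : ∑ C ∈ Finset.univ.powersetCard k, (∑ D, f (C ∩ D) D) / 2 ^ n ≤
      (∑ C ∈ Finset.univ.powersetCard k, (∑ D, ∑ D', f (C ∩ D) (C ∩ D ∪ D')) / (2 ^ n * 2 ^ n)) +
        n.choose k * ENNReal.ofReal ε := by
    have t1 : ∑ C ∈ Finset.univ.powersetCard k, (∑ D, f (C ∩ D) D) / 2 ^ n ≠ ∞ := by
      refine ENNReal.sum_ne_top.2 fun C _ => ENNReal.div_ne_top (ENNReal.sum_ne_top.2 fun D _ =>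
        hfin _ _) (by simp)
    have t2 : ∑ C ∈ Finset.univ.powersetCard k,
        (∑ D, ∑ D', f (C ∩ D) (C ∩ D ∪ D')) / (2 ^ n * 2 ^ n) ≠ ∞ := by
      refine ENNReal.sum_ne_top.2 fun C _ => ENNReal.div_ne_top (ENNReal.sum_ne_top.2 fun D _ =>
        ENNReal.sum_ne_top.2 fun D' _ => hfin _ _) (by simp)
    have t3 : (n.choose k : ℝ≥0∞) * ENNReal.ofReal ε ≠ ∞ := ENNReal.mul_ne_top hct (by simp)
    rw [← ENNReal.toReal_le_toReal t1 (ENNReal.add_ne_top.2 ⟨t2, t3⟩), ENNReal.toReal_add t2 t3,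
      ENNReal.toReal_mul, ENNReal.toReal_natCast, ENNReal.toReal_ofReal (Real.sqrt_nonneg _)]
    rw [ENNReal.toReal_sum (fun C _ => ENNReal.div_ne_top (ENNReal.sum_ne_top.2 fun D _ =>
        hfin _ _) (by simp)), ENNReal.toReal_sum (fun C _ => ENNReal.div_ne_top
        (ENNReal.sum_ne_top.2 fun D _ => ENNReal.sum_ne_top.2 fun D' _ => hfin _ _) (by simp))]
    simp_rw [ENNReal.toReal_div, ENNReal.toReal_mul, ENNReal.toReal_pow, ENNReal.toReal_ofNat]
    rw [← Finset.sum_div, ← Finset.sum_div]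
    have e1 : ∀ C : Finset (Fin n), (∑ D, f (C ∩ D) D).toReal = ∑ D, (f (C ∩ D) D).toReal := fun C =>
      ENNReal.toReal_sum fun D _ => hfin _ _
    have e2 : ∀ C : Finset (Fin n), (∑ D, ∑ D', f (C ∩ D) (C ∩ D ∪ D')).toReal =
        ∑ D, ∑ D', (f (C ∩ D) (C ∩ D ∪ D')).toReal := fun C => by
      rw [ENNReal.toReal_sum fun D _ => ENNReal.sum_ne_top.2 fun D' _ => hfin _ _]
      exact Finset.sum_congr rfl fun D _ => ENNReal.toReal_sum fun D' _ => hfin _ _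
    simp_rw [e1, e2]
    exact hmain
  calc _ ≤ (n.choose k : ℝ≥0∞)⁻¹ * ((∑ C ∈ Finset.univ.powersetCard k,
        (∑ D, ∑ D', f (C ∩ D) (C ∩ D ∪ D')) / (2 ^ n * 2 ^ n)) + n.choose k * ENNReal.ofReal ε) := by
        gcongr
    _ = _ := by rw [mul_add, ← mul_assoc, ENNReal.inv_mul_cancel hc0 hct, one_mul]

/-! ### Relabelling -/

/-- The permutation of the pairs induced by a permutation of the vertices. -/
def sym2Perm {n : ℕ} (g : Equiv.Perm (Fin n)) : Equiv.Perm (Sym2 (Fin n)) where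
  toFun := Sym2.map g
  invFun := Sym2.map g.symm
  left_inv e := by rw [Sym2.map_map]; simp
  right_inv e := by rw [Sym2.map_map]; simp

theorem inhomogeneousRandomGraph_map {n : ℕ} (p : Sym2 (Fin n) → I) (g : Equiv.Perm (Fin n)) :
    (inhomogeneousRandomGraph p).map (fun G => G.map g.toEmbedding) =
      inhomogeneousRandomGraph fun e => p (Sym2.map g.symm e) := by
  rw [inhomogeneousRandomGraph, inhomogeneousRandomGraph,
    Measure.map_map (measurable_of_finite _) (measurable_of_finite _)]
  have hmp := measurePreserving_piCongrLeft
    (fun e => ProbabilityTheory.bernoulliMeasure true false (p (Sym2.map g.symm e)))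
    (sym2Perm g)
  have hp : (fun e => ProbabilityTheory.bernoulliMeasure true false
      (p (Sym2.map g.symm (sym2Perm g e)))) =
      fun e => ProbabilityTheory.bernoulliMeasure true false (p e) := by
    funext e
    congr 2
    exact (sym2Perm g).left_inv e
  rw [hp] at hmp
  rw [← hmp.map_eq, Measure.map_map (measurable_of_finite _) hmp.measurable]
  congr 1
  funext x
  ext u v
  simp only [Function.comp_apply, SimpleGraph.map_adj, SimpleGraph.fromEdgeSet_adj,
    Set.mem_ofPred_eq, MeasurableEquiv.coe_piCongrLeft]
  constructor
  · rintro ⟨a, b, ⟨h1, h2⟩, rfl, rfl⟩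
    refine ⟨?_, fun h => h2 (g.injective h)⟩
    have := Equiv.piCongrLeft_apply_apply (fun _ => Bool) (sym2Perm g) x s(a, b)
    exact this.trans h1
  · rintro ⟨h1, h2⟩
    refine ⟨g.symm u, g.symm v, ⟨?_, fun h => h2 (g.symm.injective h)⟩, by simp, by simp⟩
    have := Equiv.piCongrLeft_apply_apply (fun _ => Bool) (sym2Perm g) x
      s(g.symm u, g.symm v)
    have hg : sym2Perm g s(g.symm u, g.symm v) = s(u, v) := by simp [sym2Perm]
    rw [hg] at this
    exact this.symm.trans h1

theorem lintegral_randomlyPermuted {n : ℕ} (P : Measure (SimpleGraph (Fin n)))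
    (f : SimpleGraph (Fin n) → ℝ≥0∞) :
    ∫⁻ G, f G ∂(randomlyPermuted P) =
      ∫⁻ G, (n.factorial : ℝ≥0∞)⁻¹ * ∑ τ : Equiv.Perm (Fin n), f (G.map τ.toEmbedding) ∂P := by
  rw [randomlyPermuted, lintegral_smul_measure, lintegral_finsetSum_measure,
    lintegral_const_mul _ (measurable_of_finite _), smul_eq_mul,
    lintegral_finsetSum _ fun τ _ => measurable_of_finite _]
  congr 1
  exact Finset.sum_congr rfl fun τ _ => lintegral_map (measurable_of_finite _)
    (measurable_of_finite _)

theorem factorial_inv_mul_sum_const (n : ℕ) (c : ℝ≥0∞) :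
    (n.factorial : ℝ≥0∞)⁻¹ * ∑ _τ : Equiv.Perm (Fin n), c = c := by
  rw [Finset.sum_const, Finset.card_univ, Fintype.card_perm, Fintype.card_fin, nsmul_eq_mul,
    ← mul_assoc, ENNReal.inv_mul_cancel (by exact_mod_cast n.factorial_ne_zero)
      (ENNReal.natCast_ne_top _), one_mul]

theorem randomlyPermuted_inhomogeneousRandomGraph_const (n : ℕ) (q : I) :
    randomlyPermuted (inhomogeneousRandomGraph fun _ : Sym2 (Fin n) => q) =
      inhomogeneousRandomGraph fun _ => q := by
  rw [randomlyPermuted]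
  simp_rw [inhomogeneousRandomGraph_map]
  ext s hs
  simpa using factorial_inv_mul_sum_const n _

theorem randomlyPermuted_map {n : ℕ} (P : Measure (SimpleGraph (Fin n))) (g : Equiv.Perm (Fin n)) :
    randomlyPermuted (P.map fun G => G.map g.toEmbedding) = randomlyPermuted P := by
  rw [randomlyPermuted, randomlyPermuted]
  congr 1
  refine Fintype.sum_equiv (Equiv.mulRight g) _ _ fun τ => ?_
  rw [Measure.map_map (measurable_of_finite _) (measurable_of_finite _)]
  congr 1
  funext G
  simp only [Function.comp_apply, SimpleGraph.map_map]
  rfl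

/-! ### The reduction for a fixed seed -/

/-- The graph transformation with seed `(D, U, ω, τ)`. -/
noncomputable def seededGraph {n N : ℕ} (j : Fin n ↪ Fin N)
    (C : Matrix (Sym2 (Fin N)) (Fin N × Fin N) ℝ) (t M η : ℝ) (D : Fin n → Bool)
    (U : Fin N × Fin N → Bool) (ω : Fin N × Fin N → ℝ × ℝ) (G : SimpleGraph (Fin n)) :
    SimpleGraph (Fin N) :=
  roundedGraph C t M η fun p => bif graphBits j G D U p then (ω p).2 else (ω p).1

open Classical in
theorem computableWithin_graphBits {n N : ℕ} (j : Fin n ↪ Fin N) (D : Fin n → Bool)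
    (U : Fin N × Fin N → Bool) (p : Fin N × Fin N) :
    GraphAlgorithm.ComputableWithin 1 fun (_ : Unit) G => graphBits j G D U p := by
  unfold graphBits
  split
  · split_ifs
    · exact GraphAlgorithm.computableWithin_edge _ _
    · exact GraphAlgorithm.computableWithin_const _
    · exact GraphAlgorithm.computableWithin_const _
    · exact GraphAlgorithm.computableWithin_const _
  · exact GraphAlgorithm.computableWithin_const _

theorem abs_le_one_of_mul_transpose {ι κ : Type*} [Fintype ι] [DecidableEq κ]
    {C : Matrix κ ι ℝ} (hC : C * C.transpose = 1) (e : κ) (i : ι) : |C e i| ≤ 1 := by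
  have h : ∑ i, C e i * C e i = 1 := by
    have := congrFun (congrFun hC e) e
    simpa [Matrix.mul_apply] using this
  have : C e i * C e i ≤ 1 := h ▸ Finset.single_le_sum (f := fun i => C e i * C e i)
    (fun i _ => mul_self_nonneg _) (Finset.mem_univ i)
  rw [abs_le_one_iff_mul_self_le_one]
  exact this

/-- A bound for the number of steps of the circuit that computes `seededGraph`. -/
def seedCost (N W : ℕ) : ℕ :=
  N * N * ((N * N + 1) * ((2 * (N * N * W) + 1) * 3 + 1))

open Classical in
theorem computableWithin_seededGraph {n N : ℕ} (j : Fin n ↪ Fin N)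
    {C : Matrix (Sym2 (Fin N)) (Fin N × Fin N) ℝ} (hC : C * C.transpose = 1) (t : ℝ) {M η : ℝ}
    (hM : 0 ≤ M) (hη : 0 < η) {W : ℕ} (hW : M / η + 1 ≤ W) (D : Fin n → Bool)
    (U : Fin N × Fin N → Bool) (ω : Fin N × Fin N → ℝ × ℝ) (τ : Equiv.Perm (Fin N)) :
    GraphAlgorithm.ComputableWithin (seedCost N W) fun (e : Fin N × Fin N) G =>
      decide (((seededGraph j C t M η D U ω G).map τ.toEmbedding).Adj e.1 e.2) := by
  have hcard : Fintype.card (Fin N × Fin N) = N * N := by simp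
  rw [seedCost, ← hcard]
  refine GraphAlgorithm.ComputableWithin.fintype fun e => ?_
  set w : Fin N × Fin N → Bool → ℤ := fun p b =>
    ⌊C s(τ.symm e.1, τ.symm e.2) p * max (-M) (min M (bif b then (ω p).2 else (ω p).1)) / η⌋ with hw
  -- Rows of `C` are unit vectors, so entries are at most `1` in size; a truncated and rescaled term
  -- is at most `M / η`, and the floor costs one more.
  have hwW : ∀ p b, |w p b| ≤ W := fun p b => by
    set z := C s(τ.symm e.1, τ.symm e.2) p *
      max (-M) (min M (bif b then (ω p).2 else (ω p).1)) / η with hz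
    have h1 : |z| ≤ M / η := by
      rw [hz, abs_div, abs_of_pos hη, abs_mul]
      refine div_le_div_of_nonneg_right ?_ hη.le
      have h2 : |max (-M) (min M (bif b then (ω p).2 else (ω p).1))| ≤ M :=
        abs_le.2 ⟨le_max_left _ _, max_le (by linarith) (min_le_left _ _)⟩
      calc _ ≤ 1 * M := mul_le_mul (abs_le_one_of_mul_transpose hC _ _) h2 (abs_nonneg _)
            zero_le_one
        _ = M := one_mul M
    have h3 := Int.floor_le z
    have h4 := Int.lt_floor_add_one z
    rw [abs_le] at h1
    have h5 : |((⌊z⌋ : ℤ) : ℝ)| ≤ (W : ℝ) := abs_le.2 ⟨by linarith, by linarith⟩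
    exact_mod_cast h5
  by_cases he : e.1 = e.2
  · have h0 : (fun (_ : Unit) (G : SimpleGraph (Fin n)) => decide
        (((seededGraph j C t M η D U ω G).map τ.toEmbedding).Adj e.1 e.2)) =
        fun _ _ => false := by
      funext _ G
      simp [he]
    rw [h0]
    refine (GraphAlgorithm.computableWithin_const _).mono ?_
    exact Nat.mul_pos (Nat.succ_pos _) (Nat.succ_pos _)
  · have h1 : (fun (_ : Unit) (G : SimpleGraph (Fin n)) => decide
        (((seededGraph j C t M η D U ω G).map τ.toEmbedding).Adj e.1 e.2)) =
        fun _ G => decide (⌊t / η⌋ < ∑ p, w p (graphBits j G D U p)) := by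
      funext _ G
      have hadj : ((seededGraph j C t M η D U ω G).map τ.toEmbedding).Adj e.1 e.2 ↔
          (seededGraph j C t M η D U ω G).Adj (τ.symm e.1) (τ.symm e.2) := by
        rw [SimpleGraph.map_adj]
        constructor
        · rintro ⟨a, b, h, h1, h2⟩
          rw [← h1, ← h2]
          simpa using h
        · intro h
          exact ⟨_, _, h, by simp, by simp⟩
      rw [decide_eq_decide, hadj, seededGraph, roundedGraph, SimpleGraph.fromEdgeSet_adj]
      simp [he, hw]
    rw [h1]
    exact GraphAlgorithm.computableWithin_threshold _ (computableWithin_graphBits j D U) w W hwW _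

/-! ### The reduction -/

theorem GraphAlgorithm.outputProb_le_one {n : ℕ} (A : GraphAlgorithm n) (G : SimpleGraph (Fin n))
    (b : Bool) : A.outputProb G b ≤ 1 := by
  rw [GraphAlgorithm.outputProb]
  refine ENNReal.div_le_of_le_mul ?_
  rw [one_mul]
  have := Finset.card_filter_le (Finset.univ : Finset (Fin A.time → Bool))
    fun ω => A.output G ω = b
  rw [Finset.card_univ, Fintype.card_fun, Fintype.card_bool, Fintype.card_fin] at this
  exact_mod_cast this

theorem lintegral_swap_of_finite {X Y : Type*} [MeasurableSpace X] [MeasurableSpace Y] [Fintype Y]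
    [MeasurableSingletonClass Y] (m : Measure X) (m' : Measure Y) {f : Y → X → ℝ≥0∞}
    (hf : ∀ y, Measurable (f y)) :
    ∫⁻ x, ∫⁻ y, f y x ∂m' ∂m = ∫⁻ y, ∫⁻ x, f y x ∂m ∂m' := by
  simp_rw [lintegral_fintype]
  rw [lintegral_finsetSum _ fun y _ => (hf y).mul_const _]
  exact Finset.sum_congr rfl fun y _ => lintegral_mul_const _ (hf y)

theorem lintegral_plantedClique (n k : ℕ) (p : I) (f : SimpleGraph (Fin n) → ℝ≥0∞) :
    ∫⁻ G, f G ∂(plantedClique n k p) = (n.choose k : ℝ≥0∞)⁻¹ *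
      ∑ S ∈ Finset.univ.powersetCard k, ∫⁻ G, f (G ⊔ SimpleGraph.fromRel fun u v => u ∈ S ∧ v ∈ S)
        ∂(SimpleGraph.binomialRandom (Fin n) p) := by
  rw [plantedClique, lintegral_smul_measure, lintegral_finsetSum_measure, smul_eq_mul]
  congr 1
  exact Finset.sum_congr rfl fun S _ => lintegral_map (measurable_of_finite _)
    (measurable_of_finite _)

theorem exists_perm_sum_le {N : ℕ} (g : Equiv.Perm (Fin N) → ℝ≥0∞) :
    ∃ τ, g τ ≤ (N.factorial : ℝ≥0∞)⁻¹ * ∑ τ, g τ := by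
  obtain ⟨τ, -, hτ⟩ := Finset.exists_min_image Finset.univ g Finset.univ_nonempty
  refine ⟨τ, ?_⟩
  rw [← factorial_inv_mul_sum_const N (g τ)]
  gcongr with τ' _
  exact hτ τ' (Finset.mem_univ _)

/-- Averaging over the relabelling, for the sum of the errors. -/
theorem exists_perm_add_le {n N : ℕ} (m₀ m₁ : Measure (SimpleGraph (Fin n)))
    (F : SimpleGraph (Fin n) → SimpleGraph (Fin N)) (f₀ f₁ : SimpleGraph (Fin N) → ℝ≥0∞) :
    ∃ τ : Equiv.Perm (Fin N), ∫⁻ G, f₀ ((F G).map τ.toEmbedding) ∂m₀ +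
        ∫⁻ G, f₁ ((F G).map τ.toEmbedding) ∂m₁ ≤
      ∫⁻ G, (N.factorial : ℝ≥0∞)⁻¹ * ∑ τ : Equiv.Perm (Fin N), f₀ ((F G).map τ.toEmbedding) ∂m₀ +
      ∫⁻ G, (N.factorial : ℝ≥0∞)⁻¹ * ∑ τ : Equiv.Perm (Fin N), f₁ ((F G).map τ.toEmbedding) ∂m₁ := by
  obtain ⟨τ, hτ⟩ := exists_perm_sum_le fun τ : Equiv.Perm (Fin N) =>
    ∫⁻ G, f₀ ((F G).map τ.toEmbedding) ∂m₀ + ∫⁻ G, f₁ ((F G).map τ.toEmbedding) ∂m₁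
  refine ⟨τ, hτ.trans (le_of_eq ?_)⟩
  rw [lintegral_const_mul _ (measurable_of_finite _), lintegral_const_mul _ (measurable_of_finite _),
    lintegral_finsetSum _ fun τ _ => measurable_of_finite _,
    lintegral_finsetSum _ fun τ _ => measurable_of_finite _, Finset.sum_add_distrib, mul_add]

/-- Some point does at least as well as the average. It allows the seed, including its real-valued
Gaussian part, to be hardwired into the circuit instead of being sampled. -/
theorem exists_seed_le {X Y Z : Type*} [MeasurableSpace X] [MeasurableSpace Y] [MeasurableSpace Z]
    [Fintype X] [MeasurableSingletonClass X] [Fintype Y] [MeasurableSingletonClass Y]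
    (m₁ : Measure X) (m₂ : Measure Y) (m₃ : Measure Z) [IsProbabilityMeasure m₁]
    [IsProbabilityMeasure m₂] [IsProbabilityMeasure m₃] {g : X → Y → Z → ℝ≥0∞}
    (hg : ∀ x y, Measurable (g x y)) :
    ∃ x y z, g x y z ≤ ∫⁻ x, ∫⁻ y, ∫⁻ z, g x y z ∂m₃ ∂m₂ ∂m₁ := by
  obtain ⟨x, hx⟩ := exists_le_lintegral (μ := m₁) (f := fun x => ∫⁻ y, ∫⁻ z, g x y z ∂m₃ ∂m₂)
    (measurable_of_finite _).aemeasurable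
  obtain ⟨y, hy⟩ := exists_le_lintegral (μ := m₂) (f := fun y => ∫⁻ z, g x y z ∂m₃)
    (measurable_of_finite _).aemeasurable
  obtain ⟨z, hz⟩ := exists_le_lintegral (μ := m₃) (hg x y).aemeasurable
  exact ⟨x, y, z, hz.trans (hy.trans hx)⟩

theorem ite_mem_plantedPairs {n N : ℕ} (j : Fin n ↪ Fin N) (μ : ℝ)
    (S : Finset (Fin n)) :
    (fun p : Fin N × Fin N => if p ∈ plantedPairs j S then
      (if p.1 < p.2 then μ else if p.1 = p.2 then μ / √2 else 0) else 0) =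
      plantedMean μ (S.map j) := by
  funext p
  simp only [plantedPairs, plantedMean, Finset.mem_filter, Finset.mem_product]
  by_cases h : p.1 ∈ S.map j ∧ p.2 ∈ S.map j
  · rw [if_pos h]
    by_cases hle : p.1 ≤ p.2
    · rw [if_pos ⟨h, hle⟩]
    · rw [if_neg (fun h => hle h.2), if_neg (fun h => hle h.le), if_neg (fun h => hle h.le)]
  · rw [if_neg h, if_neg (fun h' => h h'.1)]

theorem card_plantedPairs_le {n N : ℕ} (j : Fin n ↪ Fin N) (S : Finset (Fin n)) :
    (plantedPairs j S).card ≤ S.card ^ 2 := by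
  refine (Finset.card_filter_le _ _).trans ?_
  rw [Finset.card_product, Finset.card_map, sq]

/-- The four summands of the loss are: the domination factor for at most `k ^ 2` planted pairs, the
rounding errors under both hypotheses, the price of hiding `C \ D`, and the probability that the
surviving set `C ∩ D` is not `good`. On `good` sets the resulting law belongs to the alternative;
elsewhere the error is bounded by `1`. -/
theorem exists_reduction {n N k : ℕ} (hk : 2 * k ≤ n) (j : Fin n ↪ Fin N)
    {C : Matrix (Sym2 (Fin N)) (Fin N × Fin N) ℝ} (hC : C * C.transpose = 1) {t M B η μ : ℝ}
    (hM : 0 ≤ M) (hη : 0 < η) (hμ₀ : 0 ≤ μ) (hμ₁ : μ ≤ 1) (hμB : Real.exp (μ * B) ≤ 3 / 2)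
    (hB : Real.exp (4 - 2 * B) ≤ 1 / 4) (hB₀ : 0 ≤ B) {W : ℕ} (hW : M / η + 1 ≤ W)
    {H₁ : Set (Measure (SimpleGraph (Fin N)))} (hP : ∀ P ∈ H₁, IsProbabilityMeasure P)
    {good : Finset (Fin n) → Prop} [DecidablePred good]
    (hgood : ∀ S, good S → randomlyPermuted (inhomogeneousRandomGraph fun e =>
      gaussianTail t (C.mulVec (plantedMean μ (S.map j)) e)) ∈ H₁)
    {ε : ℝ} (hε : 0 ≤ ε)
    (hbad : (n.choose k : ℝ≥0∞)⁻¹ * ∑ C ∈ Finset.univ.powersetCard k,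
      ∫⁻ D, (if good (C ∩ trueSet D) then 0 else 1) ∂(Measure.pi fun _ => fairCoin) ≤
        ENNReal.ofReal ε)
    (φ : GraphAlgorithm N) :
    ∃ A : GraphAlgorithm n, A.time ≤ seedCost N W + 1 + φ.time ∧
      (plantedCliqueDetection n k ⟨1 / 2, by norm_num, by norm_num⟩).error A ≤
        (DetectionProblem.mk (SimpleGraph.binomialRandom (Fin N) (gaussianTail t 0)) H₁).error φ +
        ENNReal.ofReal (((1 + 2 * Real.exp (4 - 2 * B)) ^ (k ^ 2) - 1) +
          2 * (1 + 2 * Real.exp (4 - 2 * B)) ^ (k ^ 2) *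
            roundingError (N * N) (Fintype.card (Sym2 (Fin N))) M η +
          √(Real.exp (2 * (k : ℝ) ^ 2 / n) - 1) + ε) := by
  set m : Fin N × Fin N → ℝ := fun p =>
    if p.1 < p.2 then μ else if p.1 = p.2 then μ / √2 else 0 with hm
  have hs2 : μ / √2 ≤ μ := div_le_self hμ₀ (Real.one_le_sqrt.2 (by norm_num))
  have hm0 : ∀ p, 0 ≤ m p := fun p => by
    simp only [hm]; split_ifs
    · exact hμ₀
    · positivity
    · exact le_rfl
  have hmμ : ∀ p, m p ≤ μ := fun p => by
    simp only [hm]; split_ifs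
    · exact le_rfl
    · exact hs2
    · exact hμ₀
  obtain ⟨κ, hκ, hgauss⟩ := exists_gaussianization hC t M B hη hm0 (fun p => (hmμ p).trans hμ₁)
    (fun p => (Real.exp_le_exp.2 (mul_le_mul_of_nonneg_right (hmμ p) hB₀)).trans hμB) hB
  set r := roundingError (N * N) (Fintype.card (Sym2 (Fin N))) M η with hr
  have hcard : Fintype.card (Fin N × Fin N) = N * N := by simp
  rw [hcard, ← hr] at hgauss
  set c : ℝ := 1 + 2 * Real.exp (4 - 2 * B) with hc
  have hc1 : 1 ≤ c := by rw [hc]; linarith [Real.exp_pos (4 - 2 * B)]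
  have hr0 : 0 ≤ r := roundingError_nonneg _ _ _ hη.le
  -- Averaging the test over relabellings replaces every law by its randomly permuted version, which
  -- is the form of the block model.
  set f : Bool → SimpleGraph (Fin N) → ℝ≥0∞ := fun b H =>
    (N.factorial : ℝ≥0∞)⁻¹ * ∑ τ : Equiv.Perm (Fin N), φ.outputProb (H.map τ.toEmbedding) b with hf
  have hf1 : ∀ b H, f b H ≤ 1 := fun b H => by
    rw [← factorial_inv_mul_sum_const N 1]
    simp only [hf]
    gcongr with τ _
    exact φ.outputProb_le_one _ _
  have hfP : ∀ (b : Bool) (P : Measure (SimpleGraph (Fin N))),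
      ∫⁻ G, f b G ∂P = ∫⁻ G, φ.outputProb G b ∂(randomlyPermuted P) := fun b P =>
    (lintegral_randomlyPermuted P fun G => φ.outputProb G b).symm
  set Ψ : Bool → (Fin N × Fin N → Bool) → ℝ≥0∞ := fun b x =>
    ∫⁻ ω, f b (roundedGraph C t M η fun p => bif x p then (ω p).2 else (ω p).1) ∂(Measure.pi κ) with hΨ
  have hΨ1 : ∀ b x, Ψ b x ≤ 1 := fun b x => by
    calc Ψ b x ≤ ∫⁻ _, 1 ∂(Measure.pi κ) := lintegral_mono fun _ => hf1 _ _
      _ = 1 := by simp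
  have hmeas : ∀ x : Fin N × Fin N → Bool, Measurable fun ω : Fin N × Fin N → ℝ × ℝ =>
      roundedGraph C t M η fun p => bif x p then (ω p).2 else (ω p).1 := fun x => by
    refine (measurable_roundedGraph C t M η).comp (measurable_pi_lambda _ fun p => ?_)
    cases x p
    · exact (measurable_pi_apply p).fst
    · exact (measurable_pi_apply p).snd
  have hmeas' : ∀ (b : Bool) (D : Fin n → Bool) (U : Fin N × Fin N → Bool) (G : SimpleGraph (Fin n)),
      Measurable fun ω => f b (seededGraph j C t M η D U ω G) := fun b D U G =>
    (measurable_of_finite (f b)).comp (hmeas (graphBits j G D U))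
  set half : I := ⟨1 / 2, by norm_num, by norm_num⟩ with hhalf
  -- The two errors are averaged as one sum, since a single seed has to serve both hypotheses.
  have hseed := exists_seed_le (Measure.pi fun _ : Fin n => fairCoin)
    (Measure.pi fun _ : Fin N × Fin N => fairCoin) (Measure.pi κ) (g := fun D U ω =>
      ∫⁻ G, f true (seededGraph j C t M η D U ω G) ∂(SimpleGraph.binomialRandom (Fin n) half) +
      ∫⁻ G, f false (seededGraph j C t M η D U ω G) ∂(plantedClique n k half)) (fun D U => by
        simp_rw [lintegral_fintype]
        refine Measurable.add ?_ ?_ <;>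
        exact Finset.measurable_fun_sum _ fun G _ =>
          (hmeas' _ D U G).mul_const _)
  obtain ⟨D, U, ω, hDUω⟩ := hseed
  obtain ⟨τ, hτ⟩ := exists_perm_add_le (SimpleGraph.binomialRandom (Fin n) half)
    (plantedClique n k half) (seededGraph j C t M η D U ω) (fun H => φ.outputProb H true)
    (fun H => φ.outputProb H false)
  obtain ⟨A, hAt, hA⟩ := GraphAlgorithm.exists_comp (c := seedCost N W)
    (fun G => (seededGraph j C t M η D U ω G).map τ.toEmbedding)
    (by convert computableWithin_seededGraph j hC t hM hη hW D U ω τ) φ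
  refine ⟨A, hAt, ?_⟩
  have hswap : ∀ (b : Bool) (D : Fin n → Bool) (U : Fin N × Fin N → Bool)
      (P : Measure (SimpleGraph (Fin n))),
      ∫⁻ ω, ∫⁻ G, f b (seededGraph j C t M η D U ω G) ∂P ∂(Measure.pi κ) =
        ∫⁻ G, Ψ b (graphBits j G D U) ∂P := fun b D U P =>
    lintegral_swap_of_finite _ _ fun G => hmeas' b D U G
  have hnull : ∫⁻ D, ∫⁻ U, ∫⁻ ω, ∫⁻ G, f true (seededGraph j C t M η D U ω G)
      ∂(SimpleGraph.binomialRandom (Fin n) half) ∂(Measure.pi κ) ∂(Measure.pi fun _ => fairCoin)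
      ∂(Measure.pi fun _ => fairCoin) ≤
      ∫⁻ H, φ.outputProb H true ∂(SimpleGraph.binomialRandom (Fin N) (gaussianTail t 0)) +
        ENNReal.ofReal r := by
    simp_rw [hswap]
    have h1 : ∀ D : Fin n → Bool, ∫⁻ U, ∫⁻ G, Ψ true (graphBits j G D U)
        ∂(SimpleGraph.binomialRandom (Fin n) half) ∂(Measure.pi fun _ => fairCoin) =
        ∫⁻ x, Ψ true (overrideDiag j D x) ∂(Measure.pi fun _ => fairCoin) := fun D => by
      rw [lintegral_swap_of_finite _ _ fun _ => measurable_of_finite _]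
      exact lintegral_graphBits j D _
    simp_rw [h1]
    rw [lintegral_overrideDiag]
    have h2 := hgauss ∅ (f true) (hf1 true)
    simp only [Finset.notMem_empty, if_false, Finset.card_empty, pow_zero, ENNReal.ofReal_one,
      one_mul] at h2
    refine h2.trans (add_le_add (le_of_eq ?_) le_rfl)
    have h3 : (C.mulVec fun _ => (0 : ℝ)) = 0 := Matrix.mulVec_zero C
    rw [h3, binomialRandom_eq_inhomogeneousRandomGraph]
    simp only [Pi.zero_apply]
    rw [hfP, randomlyPermuted_inhomogeneousRandomGraph_const]
  set s : ℝ≥0∞ := ⨆ P ∈ H₁, ∫⁻ G, φ.outputProb G false ∂P with hs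
  have hs1 : s ≤ 1 := by
    refine iSup₂_le fun P hPm => ?_
    have := hP P hPm
    calc ∫⁻ G, φ.outputProb G false ∂P ≤ ∫⁻ _, 1 ∂P :=
          lintegral_mono fun G => φ.outputProb_le_one _ _
      _ = 1 := by simp
  have hbits : ∀ S : Finset (Fin n), S.card ≤ k → ∫⁻ x, Ψ false x
        ∂(Measure.pi fun i => if i ∈ plantedPairs j S then Measure.dirac true else fairCoin) ≤
      ENNReal.ofReal (c ^ (k ^ 2)) * (s + ENNReal.ofReal r) + if good S then 0 else 1 := by
    intro S hS
    split_ifs with hg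
    · rw [add_zero]
      refine (hgauss (plantedPairs j S) (f false) (hf1 false)).trans ?_
      refine mul_le_mul' (ENNReal.ofReal_le_ofReal (pow_le_pow_right₀ hc1
        ((card_plantedPairs_le j S).trans (Nat.pow_le_pow_left hS 2)))) (add_le_add ?_ le_rfl)
      rw [hm, ite_mem_plantedPairs, hfP]
      exact le_iSup₂_of_le _ (hgood S hg) le_rfl
    · refine le_trans ?_ le_add_self
      have : ∀ i, IsProbabilityMeasure (if i ∈ plantedPairs j S then Measure.dirac true
          else fairCoin) := fun i => by split_ifs <;> infer_instance
      calc _ ≤ ∫⁻ _, 1 ∂(Measure.pi fun i => if i ∈ plantedPairs j S then Measure.dirac true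
            else fairCoin) := lintegral_mono fun x => hΨ1 _ _
        _ = 1 := by simp
  have hc0 : (n.choose k : ℝ≥0∞) ≠ 0 := by
    exact_mod_cast (Nat.choose_pos (by omega : k ≤ n)).ne'
  have hct : (n.choose k : ℝ≥0∞) ≠ ∞ := ENNReal.natCast_ne_top _
  have hplanted : ∫⁻ D, ∫⁻ U, ∫⁻ ω, ∫⁻ G, f false (seededGraph j C t M η D U ω G)
      ∂(plantedClique n k half) ∂(Measure.pi κ) ∂(Measure.pi fun _ => fairCoin)
      ∂(Measure.pi fun _ => fairCoin) ≤
      ENNReal.ofReal (c ^ (k ^ 2)) * (s + ENNReal.ofReal r) + ENNReal.ofReal ε +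
        ENNReal.ofReal √(Real.exp (2 * (k : ℝ) ^ 2 / n) - 1) := by
    simp_rw [hswap, lintegral_plantedClique]
    have h1 : ∀ D : Fin n → Bool, ∫⁻ U, (n.choose k : ℝ≥0∞)⁻¹ * ∑ S ∈ Finset.univ.powersetCard k,
        ∫⁻ G, Ψ false (graphBits j (G ⊔ SimpleGraph.fromRel fun u v => u ∈ S ∧ v ∈ S) D U)
          ∂(SimpleGraph.binomialRandom (Fin n) half) ∂(Measure.pi fun _ => fairCoin) =
        (n.choose k : ℝ≥0∞)⁻¹ * ∑ S ∈ Finset.univ.powersetCard k, ∫⁻ G, ∫⁻ U,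
          Ψ false (graphBits j (G ⊔ SimpleGraph.fromRel fun u v => u ∈ S ∧ v ∈ S) D U)
          ∂(Measure.pi fun _ => fairCoin) ∂(SimpleGraph.binomialRandom (Fin n) half) := fun D => by
      rw [lintegral_const_mul _ (measurable_of_finite _),
        lintegral_finsetSum _ fun _ _ => measurable_of_finite _]
      congr 1
      exact Finset.sum_congr rfl fun S _ =>
        lintegral_swap_of_finite _ _ fun _ => measurable_of_finite _
    simp_rw [h1]
    rw [lintegral_const_mul _ (measurable_of_finite _),
      lintegral_finsetSum _ fun _ _ => measurable_of_finite _]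
    refine (sum_lintegral_graphBits_clique_le hk j (Ψ false) (hΨ1 false)).trans
      (add_le_add ?_ le_rfl)
    calc _ ≤ (n.choose k : ℝ≥0∞)⁻¹ * ∑ C ∈ Finset.univ.powersetCard k,
          (ENNReal.ofReal (c ^ (k ^ 2)) * (s + ENNReal.ofReal r) +
          ∫⁻ D, (if good (C ∩ trueSet D) then 0 else 1) ∂(Measure.pi fun _ => fairCoin)) := by
          refine mul_le_mul' le_rfl (Finset.sum_le_sum fun C hC => ?_)
          have h2 : ∀ D : Fin n → Bool, (C ∩ trueSet D).card ≤ k := fun D =>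
            (Finset.card_le_card Finset.inter_subset_left).trans_eq (Finset.mem_powersetCard.1 hC).2
          refine (lintegral_mono fun D => hbits _ (h2 D)).trans (le_of_eq ?_)
          rw [lintegral_add_left measurable_const, lintegral_const, measure_univ, mul_one]
      _ ≤ _ := by
          rw [Finset.sum_add_distrib, mul_add, Finset.sum_const, Finset.card_powersetCard,
            Finset.card_univ, Fintype.card_fin, nsmul_eq_mul, ← mul_assoc,
            ENNReal.inv_mul_cancel hc0 hct, one_mul]
          exact add_le_add le_rfl hbad
  have herr : (plantedCliqueDetection n k half).error A =
      ∫⁻ G, φ.outputProb ((seededGraph j C t M η D U ω G).map τ.toEmbedding) true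
        ∂(SimpleGraph.binomialRandom (Fin n) half) +
      ∫⁻ G, φ.outputProb ((seededGraph j C t M η D U ω G).map τ.toEmbedding) false
        ∂(plantedClique n k half) := by
    simp only [DetectionProblem.error, plantedCliqueDetection, Set.mem_singleton_iff, iSup_iSup_eq_left,
      hA]
  rw [herr]
  refine hτ.trans (hDUω.trans ?_)
  have hsplit : ∫⁻ D, ∫⁻ U, ∫⁻ ω,
      (∫⁻ G, f true (seededGraph j C t M η D U ω G) ∂(SimpleGraph.binomialRandom (Fin n) half) +
      ∫⁻ G, f false (seededGraph j C t M η D U ω G) ∂(plantedClique n k half))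
      ∂(Measure.pi κ) ∂(Measure.pi fun _ => fairCoin) ∂(Measure.pi fun _ => fairCoin) =
      (∫⁻ D, ∫⁻ U, ∫⁻ ω, ∫⁻ G, f true (seededGraph j C t M η D U ω G)
      ∂(SimpleGraph.binomialRandom (Fin n) half) ∂(Measure.pi κ) ∂(Measure.pi fun _ => fairCoin)
      ∂(Measure.pi fun _ => fairCoin)) +
      ∫⁻ D, ∫⁻ U, ∫⁻ ω, ∫⁻ G, f false (seededGraph j C t M η D U ω G)
      ∂(plantedClique n k half) ∂(Measure.pi κ) ∂(Measure.pi fun _ => fairCoin)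
      ∂(Measure.pi fun _ => fairCoin) := by
    rw [← lintegral_add_left (measurable_of_finite _)]
    refine lintegral_congr fun D => ?_
    rw [← lintegral_add_left (measurable_of_finite _)]
    refine lintegral_congr fun U => ?_
    refine lintegral_add_left ?_ _
    simp_rw [lintegral_fintype]
    exact Finset.measurable_fun_sum _ fun G _ =>
      (hmeas' _ D U G).mul_const _
  rw [hsplit]
  refine (add_le_add hnull hplanted).trans ?_
  have hck : 1 ≤ c ^ (k ^ 2) := one_le_pow₀ hc1
  -- The multiplicative loss becomes additive because `s ≤ 1`.
  have hcs : ENNReal.ofReal (c ^ (k ^ 2)) * s ≤ s + ENNReal.ofReal (c ^ (k ^ 2) - 1) := by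
    have : ENNReal.ofReal (c ^ (k ^ 2)) = 1 + ENNReal.ofReal (c ^ (k ^ 2) - 1) := by
      rw [← ENNReal.ofReal_one, ← ENNReal.ofReal_add zero_le_one (by linarith)]
      congr 1; ring
    rw [this, add_mul, one_mul]
    gcongr
    exact mul_le_of_le_one_right' hs1
  have hcr : ENNReal.ofReal r ≤ ENNReal.ofReal (c ^ (k ^ 2) * r) :=
    ENNReal.ofReal_le_ofReal (le_mul_of_one_le_left hr0 hck)
  set a := ∫⁻ H, φ.outputProb H true ∂(SimpleGraph.binomialRandom (Fin N) (gaussianTail t 0))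
  have htot : ENNReal.ofReal ((c ^ (k ^ 2) - 1) + 2 * c ^ (k ^ 2) * r +
      √(Real.exp (2 * (k : ℝ) ^ 2 / n) - 1) + ε) = ENNReal.ofReal (c ^ (k ^ 2) - 1) +
      (ENNReal.ofReal (c ^ (k ^ 2) * r) + ENNReal.ofReal (c ^ (k ^ 2) * r)) +
      ENNReal.ofReal √(Real.exp (2 * (k : ℝ) ^ 2 / n) - 1) + ENNReal.ofReal ε := by
    have h0 : 0 ≤ c ^ (k ^ 2) * r := by positivity
    have h1 : 0 ≤ c ^ (k ^ 2) - 1 := by linarith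
    rw [ENNReal.ofReal_add (by positivity) hε, ENNReal.ofReal_add (by positivity) (Real.sqrt_nonneg _),
      ENNReal.ofReal_add h1 (by positivity), ← ENNReal.ofReal_add h0 h0]
    ring_nf
  rw [htot, DetectionProblem.error]
  calc _ ≤ (a + ENNReal.ofReal (c ^ (k ^ 2) * r)) + ((s + ENNReal.ofReal (c ^ (k ^ 2) - 1)) +
        ENNReal.ofReal (c ^ (k ^ 2) * r) + ENNReal.ofReal ε +
        ENNReal.ofReal √(Real.exp (2 * (k : ℝ) ^ 2 / n) - 1)) := by
        rw [mul_add, ← ENNReal.ofReal_mul (by positivity)]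
        gcongr
    _ = _ := by ring

/-! ### Block structure of the planted mean -/

/-- Sorting by `f` sends each sublevel set to an initial segment, the shape in which the two
communities are prescribed. -/
theorem exists_perm_lt_card_iff {N : ℕ} (f : Fin N → ℕ) :
    ∃ g : Equiv.Perm (Fin N), ∀ (u : Fin N) (a : ℕ),
      (g u).val < (Finset.univ.filter fun v => f v < a).card ↔ f u < a := by
  refine ⟨(Tuple.sort f).symm, fun u a => ?_⟩
  have h := Tuple.lt_card_lt_iff_apply_lt_of_monotone (j := (Tuple.sort f).symm u) (a := a)
    (Tuple.monotone_sort f)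
  rw [Function.comp_apply, Equiv.apply_symm_apply] at h
  rw [← h]
  refine Eq.to_iff (congrArg _ ?_)
  refine Finset.card_equiv (Tuple.sort f).symm fun v => ?_
  simp

/-- The communities are the sign classes of `A`. Integrality gives `|A u * A v| ≥ 1` off the zero
set, so the Gaussian means leave a gap around zero, and the tail estimates turn it into a gap of at
least `ρ` around `q`. Values of `A` beyond `±1` only enlarge the gap. The sorting permutation is
absorbed by the random relabelling. -/
theorem exists_isBlockProbability {N : ℕ} {t ν q ρ : ℝ} (hν₀ : 0 ≤ ν) (hν₁ : ν ≤ 1)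
    (hq : (gaussianTail t 0 : ℝ) = q)
    (hρ : ρ ≤ ProbabilityTheory.gaussianPDFReal 0 1 (|t| + 1) * ν) (A : Fin N → ℤ)
    (b : Sym2 (Fin N) → ℝ) (hb : ∀ u v, u ≠ v → b s(u, v) = ν * (A u * A v)) :
    ∃ p : Sym2 (Fin N) → I,
      IsBlockProbability (Finset.univ.filter fun u => 0 < A u).card
        (Finset.univ.filter fun u => A u < 0).card q ρ p ∧
      randomlyPermuted (inhomogeneousRandomGraph fun e => gaussianTail t (b e)) =
        randomlyPermuted (inhomogeneousRandomGraph p) := by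
  set f : Fin N → ℕ := fun u => if 0 < A u then 0 else if A u < 0 then 1 else 2 with hf
  obtain ⟨g, hg⟩ := exists_perm_lt_card_iff f
  have hf1 : ∀ u, f u < 1 ↔ 0 < A u := fun u => by simp only [hf]; split_ifs <;> simp_all
  have hf2 : ∀ u, f u < 2 ↔ A u ≠ 0 := fun u => by
    simp only [hf]; split_ifs with h1 h2
    · simp [h1.ne']
    · simp [h2.ne]
    · have : A u = 0 := by omega
      simp [this]
  set k₁ := (Finset.univ.filter fun u => 0 < A u).card with hk₁
  set k₂ := (Finset.univ.filter fun u => A u < 0).card with hk₂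
  have hg1 : ∀ u, (g u).val < k₁ ↔ 0 < A u := fun u => by
    have := hg u 1
    simp_rw [hf1] at this
    exact this
  have hg2 : ∀ u, (g u).val < k₁ + k₂ ↔ A u ≠ 0 := fun u => by
    have := hg u 2
    simp_rw [hf2] at this
    rw [← this, hk₁, hk₂, ← Finset.card_union_of_disjoint]
    · have h : (Finset.univ.filter fun u => A u ≠ 0) = (Finset.univ.filter fun u => 0 < A u) ∪
          Finset.univ.filter fun u => A u < 0 := by
        ext u
        simp only [Finset.mem_union, Finset.mem_filter, Finset.mem_univ, true_and]
        omega
      rw [h]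
    · rw [Finset.disjoint_left]
      intro u h1 h2
      simp only [Finset.mem_filter, Finset.mem_univ, true_and] at h1 h2
      omega
  refine ⟨fun e => gaussianTail t (b (Sym2.map g.symm e)), ?_, ?_⟩
  · have hpos : ∀ u v, 0 < A u → 0 < A v → ν ≤ ν * ((A u : ℝ) * A v) := fun u v hu hv => by
      have : (1 : ℝ) ≤ (A u : ℝ) * A v := by exact_mod_cast (by nlinarith : 1 ≤ A u * A v)
      nlinarith
    have hge : ∀ u v, u ≠ v → ν ≤ ν * ((A u : ℝ) * A v) →
        q + ρ ≤ gaussianTail t (b s(u, v)) := fun u v huv h => by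
      rw [hb u v huv]
      have := gaussianReal_real_Ioi_ge (t := t) hν₀ hν₁ h
      simp only [gaussianTail] at hq ⊢
      linarith
    refine ⟨fun u v huv hu hv => ?_, fun u v huv hu hu' hv hv' => ?_, fun u v hu hv hv' => ?_,
      fun u v huv hv => ?_⟩ <;> simp only [Sym2.map_mk]
    all_goals
      have e1 := hg1 (g.symm u)
      have e2 := hg2 (g.symm u)
      have e3 := hg1 (g.symm v)
      have e4 := hg2 (g.symm v)
      rw [Equiv.apply_symm_apply] at e1 e2 e3 e4
    · exact hge _ _ (fun h => huv (g.symm.injective h)) (hpos _ _ (e1.1 hu) (e3.1 hv))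
    · refine hge _ _ (fun h => huv (g.symm.injective h)) ?_
      have h1 : A (g.symm u) < 0 := by
        have := e2.1 hu'
        have := mt e1.2 (not_lt.2 hu)
        omega
      have h2 : A (g.symm v) < 0 := by
        have := e4.1 hv'
        have := mt e3.2 (not_lt.2 hv)
        omega
      have : (1 : ℝ) ≤ (A (g.symm u) : ℝ) * A (g.symm v) := by
        exact_mod_cast (by nlinarith : 1 ≤ A (g.symm u) * A (g.symm v))
      nlinarith
    · have h1 := e1.1 hu
      have h2 : A (g.symm v) < 0 := by
        have := e4.1 hv'
        have := mt e3.2 (not_lt.2 hv)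
        omega
      have huv : u ≠ v := fun h => by subst h; omega
      rw [hb _ _ fun h => huv (g.symm.injective h)]
      have h3 : (A (g.symm u) : ℝ) * A (g.symm v) ≤ -1 := by
        exact_mod_cast (by nlinarith : A (g.symm u) * A (g.symm v) ≤ -1)
      have := gaussianReal_real_Ioi_le (t := t) hν₀ hν₁
        (b := ν * ((A (g.symm u) : ℝ) * A (g.symm v))) (by nlinarith)
      simp only [gaussianTail] at hq ⊢
      linarith
    · have h1 : A (g.symm v) = 0 := by
        by_contra h
        have := e4.2 h
        omega
      rw [hb _ _ fun h => huv (g.symm.injective h), h1]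
      simp [hq]
  · rw [← randomlyPermuted_map _ g, inhomogeneousRandomGraph_map]

/-- `|h| + h` is twice the indicator of `h > 0` and sums to `m` over each column. A row with a
positive total has a positive entry, hence the upper bound. A row meeting a column of `L` meets no
other column of `P`, so its total is that single entry, hence the lower bound. -/
theorem mul_card_le_two_mul_card_pos {V W : Type*} [Fintype V] [DecidableEq W] (h : V → W → ℤ) (m : ℕ)
    {P L : Finset W} (hLP : L ⊆ P) (h1 : ∀ u i, |h u i| ≤ 1) (hm : ∀ i, ∑ u, |h u i| = m)
    (hsum : ∀ i ∈ P, ∑ u, h u i = 0)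
    (hL : ∀ i ∈ L, ∀ i' ∈ P, i' ≠ i → ∀ u, h u i = 0 ∨ h u i' = 0) :
    m * L.card ≤ 2 * (Finset.univ.filter fun u => 0 < ∑ i ∈ P, h u i).card ∧
    2 * (Finset.univ.filter fun u => 0 < ∑ i ∈ P, h u i).card ≤ m * P.card := by
  have hcard : ((Finset.univ.filter fun u => 0 < ∑ i ∈ P, h u i).card : ℤ) =
      ∑ u, if 0 < ∑ i ∈ P, h u i then 1 else 0 := by simp
  have hS : ∀ Q ⊆ P, ∑ u, ∑ i ∈ Q, (|h u i| + h u i) = m * Q.card := fun Q hQ => by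
    rw [Finset.sum_comm, Finset.sum_congr rfl fun i hi => by
      rw [Finset.sum_add_distrib, hm, hsum i (hQ hi), add_zero]]
    simp [mul_comm]
  constructor
  · zify
    rw [hcard, ← hS L hLP, Finset.mul_sum]
    refine Finset.sum_le_sum fun u _ => ?_
    by_cases hex : ∃ i ∈ L, h u i ≠ 0
    · obtain ⟨i, hi, hne⟩ := hex
      have h0 : ∀ i' ∈ P, i' ≠ i → h u i' = 0 := fun i' hi' hne' =>
        (hL i hi i' hi' hne' u).resolve_left hne
      rw [Finset.sum_eq_single_of_mem i (hLP hi) h0,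
        Finset.sum_eq_single_of_mem i hi fun i' hi' hne' => by rw [h0 i' (hLP hi') hne']; simp]
      have := h1 u i
      rcases lt_or_gt_of_ne hne with h | h
      · rw [abs_of_neg h, if_neg (by omega)]; omega
      · rw [abs_of_pos h] at this ⊢
        rw [if_pos h]; omega
    · push Not at hex
      rw [Finset.sum_eq_zero fun i hi => by rw [hex i hi]; simp]
      split_ifs <;> simp
  · zify
    rw [hcard, ← hS P subset_rfl, Finset.mul_sum]
    refine Finset.sum_le_sum fun u _ => ?_
    rw [Finset.sum_add_distrib]
    have := Finset.abs_sum_le_sum_abs (fun i => h u i) P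
    split_ifs with hp
    · rw [abs_of_pos hp] at this; omega
    · have := neg_abs_le (∑ i ∈ P, h u i); omega

/-! ### Block Hadamard matrices -/

/-- The entries of the Sylvester Hadamard matrix of order `2 ^ l`. -/
def hadamardSign {l : ℕ} (u v : Fin l → Bool) : ℤ := ∏ i, if u i && v i then -1 else 1

theorem hadamardSign_comm {l : ℕ} (u v : Fin l → Bool) : hadamardSign u v = hadamardSign v u := by
  simp only [hadamardSign, Bool.and_comm]

theorem abs_hadamardSign {l : ℕ} (u v : Fin l → Bool) : |hadamardSign u v| = 1 := by
  rw [hadamardSign, Finset.abs_prod]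
  exact Finset.prod_eq_one fun i _ => by split_ifs <;> simp

/-- The sum over `v` factors over the coordinates; a coordinate in which `u` and `w` differ gives
the factor `1 - 1`. -/
theorem sum_hadamardSign_mul {l : ℕ} (u w : Fin l → Bool) :
    ∑ v, hadamardSign u v * hadamardSign w v = if u = w then 2 ^ l else 0 := by
  simp_rw [hadamardSign, ← Finset.prod_mul_distrib]
  have h := Finset.prod_univ_sum (fun _ : Fin l => (Finset.univ : Finset Bool)) fun i b =>
    ((if u i && b then -1 else 1) * (if w i && b then -1 else 1) : ℤ)
  rw [Fintype.piFinset_univ] at h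
  rw [← h]
  split_ifs with huw
  · subst huw
    rw [Finset.prod_congr rfl (g := fun _ => (2 : ℤ)) fun i _ => by
      cases u i <;> simp]
    simp
  · obtain ⟨i, hi⟩ := Function.ne_iff.1 huw
    refine Finset.prod_eq_zero (Finset.mem_univ i) ?_
    cases hu : u i <;> cases hw : w i <;> simp_all

theorem sum_hadamardSign {l : ℕ} {v : Fin l → Bool} (hv : v ≠ fun _ => false) :
    ∑ u, hadamardSign u v = 0 := by
  have := sum_hadamardSign_mul v fun _ => false
  rw [if_neg hv] at this
  rw [← this]
  refine Finset.sum_congr rfl fun u _ => ?_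
  rw [hadamardSign_comm u v]
  simp [hadamardSign]

/-- The block diagonal matrix with Hadamard blocks. -/
def blockSign {g l : ℕ} (p r : Fin g × (Fin l → Bool)) : ℤ :=
  if p.1 = r.1 then hadamardSign p.2 r.2 else 0

theorem abs_blockSign {g l : ℕ} (p r : Fin g × (Fin l → Bool)) :
    |blockSign p r| = if p.1 = r.1 then 1 else 0 := by
  rw [blockSign]; split_ifs <;> simp [abs_hadamardSign]

theorem sum_blockSign_mul {g l : ℕ} (p r : Fin g × (Fin l → Bool)) :
    ∑ s, blockSign p s * blockSign r s = if p = r then 2 ^ l else 0 := by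
  simp only [blockSign]
  rw [Fintype.sum_prod_type, Finset.sum_eq_single_of_mem p.1 (Finset.mem_univ _)
    fun i _ hi => by simp [Ne.symm hi]]
  by_cases h : p.1 = r.1
  · simp only [h, if_true]
    rw [sum_hadamardSign_mul]
    simp [Prod.ext_iff, h]
  · have h' : ¬ r.1 = p.1 := fun h' => h h'.symm
    have h'' : p ≠ r := fun h'' => h (h'' ▸ rfl)
    simp [h', h'']

theorem sum_blockSign {g l : ℕ} {r : Fin g × (Fin l → Bool)} (hr : r.2 ≠ fun _ => false) :
    ∑ p, blockSign p r = 0 := by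
  simp only [blockSign]
  rw [Fintype.sum_prod_type, Finset.sum_eq_single_of_mem r.1 (Finset.mem_univ _)
    fun i _ hi => by simp [hi]]
  simpa using sum_hadamardSign hr

theorem sum_abs_blockSign {g l : ℕ} (r : Fin g × (Fin l → Bool)) :
    ∑ p, |blockSign p r| = 2 ^ l := by
  simp only [abs_blockSign]
  rw [Fintype.sum_prod_type, Finset.sum_eq_single_of_mem r.1 (Finset.mem_univ _)
    fun i _ hi => by simp [hi]]
  simp

/-- A sparse orthogonal matrix with sign pattern `h`, together with `n` columns of it that sum to
zero and are divided into groups such that columns of different groups have disjoint supports. -/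
theorem exists_sparse_sign_matrix {n g l : ℕ} (hn : n ≤ g * (2 ^ l - 1)) :
    ∃ (j : Fin n ↪ Fin (g * 2 ^ l)) (h : Fin (g * 2 ^ l) → Fin (g * 2 ^ l) → ℤ) (c : Fin n → Fin g),
      (Matrix.of fun u v => (h u v : ℝ) / √(2 ^ l)) *
        (Matrix.of fun u v => (h u v : ℝ) / √(2 ^ l)).transpose = 1 ∧
      (∀ u v, |h u v| ≤ 1) ∧ (∀ v, ∑ u, |h u v| = 2 ^ l) ∧ (∀ a, ∑ u, h u (j a) = 0) ∧
      (∀ a b, c a ≠ c b → ∀ u, h u (j a) = 0 ∨ h u (j b) = 0) ∧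
      ∀ a, (Finset.univ.filter fun b => c b = c a).card ≤ 2 ^ l := by
  have hcardN : Fintype.card (Fin g × (Fin l → Bool)) = Fintype.card (Fin (g * 2 ^ l)) := by simp
  set e := Fintype.equivOfCardEq hcardN with he
  -- Only the `2 ^ l - 1` nonconstant columns of each block are used: the constant one does not sum
  -- to zero and would unbalance the communities. The block index serves as the group `c`.
  have hcard : Fintype.card (Fin n) ≤
      Fintype.card (Fin g × {v : Fin l → Bool // v ≠ fun _ => false}) := by
    rw [Fintype.card_prod, Fintype.card_subtype_compl, Fintype.card_subtype_eq]
    simpa using hn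
  obtain ⟨i⟩ := Function.Embedding.nonempty_of_card_le hcard
  obtain ⟨j, hj⟩ : ∃ j : Fin n ↪ Fin (g * 2 ^ l), ∀ a, e.symm (j a) = ((i a).1, (i a).2.1) := by
    refine ⟨⟨fun a => e ((i a).1, (i a).2.1), fun a a' h => ?_⟩, fun a => e.symm_apply_apply _⟩
    have := e.injective h
    simp only [Prod.mk.injEq] at this
    exact i.injective (Prod.ext this.1 (Subtype.ext this.2))
  refine ⟨j, fun u v =>
    blockSign (e.symm u) (e.symm v), fun a => (i a).1, ?_, fun u v => ?_, fun v => ?_, fun a => ?_,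
    fun a b hab u => ?_, fun a => ?_⟩
  · ext u w
    rw [Matrix.mul_apply]
    simp only [Matrix.of_apply, Matrix.transpose_apply]
    have hs : √(2 ^ l : ℝ) * √(2 ^ l) = 2 ^ l := Real.mul_self_sqrt (by positivity)
    have h2 : ∑ v, (blockSign (e.symm u) (e.symm v) : ℝ) * blockSign (e.symm w) (e.symm v) =
        if e.symm u = e.symm w then 2 ^ l else 0 := by
      rw [Equiv.sum_comp e.symm fun s => (blockSign (e.symm u) s : ℝ) * blockSign (e.symm w) s]
      have := sum_blockSign_mul (e.symm u) (e.symm w)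
      have := congrArg (Int.cast : ℤ → ℝ) this
      push_cast at this
      exact this
    simp_rw [div_mul_div_comm, hs]
    rw [← Finset.sum_div, h2, Matrix.one_apply]
    simp only [EmbeddingLike.apply_eq_iff_eq]
    split_ifs <;> simp
  · rw [abs_blockSign]; split_ifs <;> simp
  · rw [Equiv.sum_comp e.symm fun s => |blockSign s (e.symm v)|]
    exact sum_abs_blockSign _
  · rw [Equiv.sum_comp e.symm fun s => blockSign s _]
    refine sum_blockSign ?_
    rw [hj]
    exact (i a).2.2
  · by_contra! h
    simp only [blockSign, hj] at h
    exact hab ((by by_contra h'; exact h.1 (if_neg fun h => h' h.symm) : (i a).1 = (e.symm u).1).trans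
      (by by_contra h'; exact h.2 (if_neg h')))
  · calc _ ≤ (Finset.univ : Finset {v : Fin l → Bool // v ≠ fun _ => false}).card := by
          refine Finset.card_le_card_of_injOn (fun b => (i b).2) (fun _ _ => Finset.mem_univ _) ?_
          intro b hb b' hb' h
          simp only [Finset.coe_filter, Finset.mem_univ, true_and, Set.mem_ofPred_eq] at hb hb'
          exact i.injective (Prod.ext (hb.trans hb'.symm) h)
      _ ≤ Fintype.card (Fin l → Bool) := by
          rw [Finset.card_univ]; exact Fintype.card_subtype_le _
      _ = 2 ^ l := by simp

/-! ### Concentration of the planted set -/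

theorem hadamardSign_single {l : ℕ} (a : Fin l) (v : Fin l → Bool) :
    hadamardSign (fun i => decide (i = a)) v = if v a then -1 else 1 := by
  rw [hadamardSign, Finset.prod_eq_single_of_mem a (Finset.mem_univ a) fun i _ hi => by simp [hi]]
  simp

/-- The variance of a binomial variable with `2 * k` fair trials. The centred indicators are
multiples of distinct Walsh characters, so orthogonality of `hadamardSign` removes the cross terms.
-/
theorem sum_sq_card_inter_trueSet {n k : ℕ} {C : Finset (Fin n)} (hC : C.card = 2 * k) :
    ∑ D : Fin n → Bool, (((C ∩ trueSet D).card : ℝ) - k) ^ 2 = 2 ^ n * (k / 2) := by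
  set s : Fin n → (Fin n → Bool) → ℤ := fun a => hadamardSign fun i => decide (i = a) with hs
  have h1 : ∀ D : Fin n → Bool, (((C ∩ trueSet D).card : ℝ) - k) ^ 2 =
      4⁻¹ * ∑ a ∈ C, ∑ b ∈ C, (s a D * s b D : ℝ) := fun D => by
    have h2 : ((C ∩ trueSet D).card : ℝ) = ∑ a ∈ C, (1 - (s a D : ℝ)) / 2 := by
      have : C ∩ trueSet D = C.filter fun a => D a = true := by ext; simp [trueSet]
      rw [this, Finset.card_filter]
      push_cast
      refine Finset.sum_congr rfl fun a _ => ?_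
      simp only [hs, hadamardSign_single]
      split_ifs <;> norm_num
    rw [h2, ← Finset.sum_mul_sum, ← Finset.sum_div, Finset.sum_sub_distrib, Finset.sum_const, hC]
    push_cast [nsmul_eq_mul]
    ring
  have h3 : ∀ a b, ∑ D, (s a D * s b D : ℝ) = if a = b then 2 ^ n else 0 := fun a b => by
    have := congrArg (Int.cast : ℤ → ℝ)
      (sum_hadamardSign_mul (fun i => decide (i = a)) fun i => decide (i = b))
    push_cast at this
    rw [this]
    refine if_congr ⟨fun h => ?_, fun h => h ▸ rfl⟩ rfl rfl
    simpa using congrFun h a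
  simp_rw [h1]
  rw [← Finset.mul_sum, Finset.sum_comm]
  simp_rw [Finset.sum_comm (s := Finset.univ) (t := C), h3]
  rw [Finset.sum_congr rfl fun a ha => by rw [Finset.sum_ite_eq C a, if_pos ha], Finset.sum_const, hC]
  push_cast [nsmul_eq_mul]
  ring

/-- The ordered pairs of distinct elements of `S` with the same value of `c`. -/
def collisions {V W : Type*} [DecidableEq V] [DecidableEq W] (c : V → W) (S : Finset V) :
    Finset (V × V) :=
  (S ×ˢ S).filter fun p => p.1 ≠ p.2 ∧ c p.1 = c p.2

theorem collisions_mono {V W : Type*} [DecidableEq V] [DecidableEq W] (c : V → W) {S T : Finset V}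
    (h : S ⊆ T) : collisions c S ⊆ collisions c T :=
  Finset.filter_subset_filter _ (Finset.product_subset_product h h)

/-- `L` consists of the elements alone in their class; every other element is the first component of
some collision. -/
theorem exists_alone_card_le {V W : Type*} [DecidableEq V] [DecidableEq W]
    (c : V → W) (S : Finset V) :
    ∃ L ⊆ S, (∀ a ∈ L, ∀ b ∈ S, b ≠ a → c a ≠ c b) ∧ S.card ≤ L.card + (collisions c S).card := by
  refine ⟨S.filter fun a => ∀ b ∈ S, b ≠ a → c a ≠ c b, Finset.filter_subset _ _,
    fun a ha => (Finset.mem_filter.1 ha).2, ?_⟩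
  rw [← Finset.card_filter_add_card_filter_not (s := S) fun a => ∀ b ∈ S, b ≠ a → c a ≠ c b]
  refine Nat.add_le_add_left ?_ _
  refine (Finset.card_le_card (t := (collisions c S).image Prod.fst) fun a ha => ?_).trans
    Finset.card_image_le
  simp only [Finset.mem_filter] at ha
  obtain ⟨ha, h⟩ := ha
  push Not at h
  obtain ⟨b, hb, hne, hc⟩ := h
  exact Finset.mem_image.2 ⟨(a, b), by simp [collisions, ha, hb, hne.symm, hc], rfl⟩

/-- There are at most `n * m` ordered colliding pairs in total, each contained in a random `k`-set
with probability at most `(k / n) ^ 2`. -/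
theorem sum_card_collisions_le {n k m : ℕ} {W : Type*} [DecidableEq W] (c : Fin n → W)
    (hc : ∀ a, (Finset.univ.filter fun b => c b = c a).card ≤ m) (hk : 2 ≤ k) (hkn : k ≤ n) :
    (∑ C ∈ Finset.univ.powersetCard k, ((collisions c C).card : ℝ)) ≤
      n.choose k * (m * k ^ 2 / n) := by
  have hn : (0 : ℝ) < n := by exact_mod_cast (by omega : 0 < n)
  have h1 : ∀ C : Finset (Fin n), ((collisions c C).card : ℝ) =
      ∑ p ∈ collisions c Finset.univ, if {p.1, p.2} ⊆ C then 1 else 0 := fun C => by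
    rw [Finset.sum_boole]
    congr 2
    ext p
    simp only [collisions, Finset.mem_filter, Finset.mem_product, Finset.mem_univ,
      Finset.insert_subset_iff, Finset.singleton_subset_iff]
    tauto
  have h2 : ∀ p ∈ collisions c Finset.univ, (∑ C ∈ Finset.univ.powersetCard k,
      if ({p.1, p.2} : Finset (Fin n)) ⊆ C then (1 : ℝ) else 0) ≤ n.choose k * (k ^ 2 / n ^ 2) :=
    fun p hp => by
    have hne : p.1 ≠ p.2 := (Finset.mem_filter.1 hp).2.1
    rw [Finset.sum_boole, card_filter_superset_powersetCard (Finset.subset_univ _)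
      (by rw [Finset.card_pair hne]; exact hk), Finset.card_pair hne, Finset.card_univ,
      Fintype.card_fin, ← mul_div_assoc, le_div_iff₀ (by positivity)]
    exact choose_sub_mul_pow_le hkn 2 hk
  have h3 : ((collisions c (Finset.univ : Finset (Fin n))).card : ℝ) ≤ n * m := by
    have : (collisions c (Finset.univ : Finset (Fin n))).card ≤
        ∑ a : Fin n, (Finset.univ.filter fun b => c b = c a).card := by
      rw [← Finset.card_sigma]
      refine Finset.card_le_card_of_injOn (fun p => ⟨p.1, p.2⟩) (fun p hp => ?_) ?_
      · simp only [Finset.mem_coe, collisions, Finset.mem_filter] at hp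
        simp [hp.2.2]
      · rintro ⟨a, b⟩ - ⟨a', b'⟩ - h
        simpa using h
    have h4 := this.trans (Finset.sum_le_sum fun a _ => hc a)
    simp only [Finset.sum_const, Finset.card_univ, Fintype.card_fin, smul_eq_mul] at h4
    exact_mod_cast h4
  simp_rw [h1]
  rw [Finset.sum_comm]
  refine (Finset.sum_le_sum h2).trans ?_
  rw [Finset.sum_const, nsmul_eq_mul]
  calc _ ≤ (n * m : ℝ) * (n.choose k * (k ^ 2 / n ^ 2)) := by gcongr
    _ = _ := by field_simp

/-- Chebyshev for the size of `C ∩ D`, Markov for its collisions; the latter are bounded by those of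
`C`. -/
theorem sum_lintegral_bad_le {n k m : ℕ} {W : Type*} [DecidableEq W] (c : Fin n → W)
    (hc : ∀ a, (Finset.univ.filter fun b => c b = c a).card ≤ m) (hk : 1 ≤ k) (hkn : 2 * k ≤ n)
    {τ : ℝ} (hτ : 0 < τ)
    [DecidablePred fun S : Finset (Fin n) => |(S.card : ℝ) - k| ≤ τ ∧ (collisions c S).card ≤ τ] :
    (n.choose (2 * k) : ℝ≥0∞)⁻¹ * ∑ C ∈ Finset.univ.powersetCard (2 * k),
      ∫⁻ D, (if |((C ∩ trueSet D).card : ℝ) - k| ≤ τ ∧ (collisions c (C ∩ trueSet D)).card ≤ τ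
        then 0 else 1) ∂(Measure.pi fun _ => fairCoin) ≤
      ENNReal.ofReal (k / (2 * τ ^ 2) + m * (2 * k) ^ 2 / (n * τ)) := by
  have hc0 : (n.choose (2 * k) : ℝ≥0∞) ≠ 0 := by
    exact_mod_cast (Nat.choose_pos hkn).ne'
  have hct : (n.choose (2 * k) : ℝ≥0∞) ≠ ∞ := ENNReal.natCast_ne_top _
  have h1 : ∀ C ∈ Finset.univ.powersetCard (2 * k),
      ∫⁻ D, (if |((C ∩ trueSet D).card : ℝ) - k| ≤ τ ∧ (collisions c (C ∩ trueSet D)).card ≤ τ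
        then 0 else 1) ∂(Measure.pi fun _ => fairCoin) ≤
      ENNReal.ofReal (k / (2 * τ ^ 2) + (collisions c C).card / τ) := fun C hC => by
    have h2 : ∀ D : Fin n → Bool, (if |((C ∩ trueSet D).card : ℝ) - k| ≤ τ ∧
        (collisions c (C ∩ trueSet D)).card ≤ τ then (0 : ℝ≥0∞) else 1) ≤
        ENNReal.ofReal ((((C ∩ trueSet D).card : ℝ) - k) ^ 2 / τ ^ 2 + (collisions c C).card / τ) :=
      fun D => by
      split_ifs with h
      · exact zero_le
      · rw [ENNReal.one_le_ofReal]
        rw [not_and_or, not_le, not_le] at h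
        rcases h with h | h
        · have : 1 ≤ (((C ∩ trueSet D).card : ℝ) - k) ^ 2 / τ ^ 2 := by
            rw [le_div_iff₀ (by positivity), one_mul, ← sq_abs (((C ∩ trueSet D).card : ℝ) - k)]
            exact pow_le_pow_left₀ hτ.le h.le 2
          have : 0 ≤ ((collisions c C).card : ℝ) / τ := by positivity
          linarith
        · have h3 : ((collisions c (C ∩ trueSet D)).card : ℝ) ≤ (collisions c C).card := by
            exact_mod_cast Finset.card_le_card (collisions_mono c Finset.inter_subset_left)
          have : 1 ≤ ((collisions c C).card : ℝ) / τ := by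
            rw [le_div_iff₀ hτ]; linarith
          have : 0 ≤ (((C ∩ trueSet D).card : ℝ) - k) ^ 2 / τ ^ 2 := by positivity
          linarith
    refine (lintegral_mono h2).trans (le_of_eq ?_)
    rw [lintegral_pi_fairCoin, Fintype.card_fin, ← ENNReal.ofReal_sum_of_nonneg fun D _ => by
      positivity, Finset.sum_add_distrib, ← Finset.sum_div,
      sum_sq_card_inter_trueSet (Finset.mem_powersetCard.1 hC).2, Finset.sum_const,
      Finset.card_univ, Fintype.card_fun, Fintype.card_bool, Fintype.card_fin, nsmul_eq_mul]
    have : (2 : ℝ≥0∞) ^ n = ENNReal.ofReal (2 ^ n) := by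
      rw [ENNReal.ofReal_pow (by norm_num), ENNReal.ofReal_ofNat]
    rw [this, ← ENNReal.ofReal_div_of_pos (by positivity)]
    congr 1
    push_cast
    field_simp
  calc _ ≤ (n.choose (2 * k) : ℝ≥0∞)⁻¹ * ∑ C ∈ Finset.univ.powersetCard (2 * k),
        ENNReal.ofReal (k / (2 * τ ^ 2) + (collisions c C).card / τ) :=
        mul_le_mul' le_rfl (Finset.sum_le_sum h1)
    _ ≤ (n.choose (2 * k) : ℝ≥0∞)⁻¹ * ENNReal.ofReal (n.choose (2 * k) *
        (k / (2 * τ ^ 2) + m * (2 * k) ^ 2 / (n * τ))) := by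
        rw [← ENNReal.ofReal_sum_of_nonneg fun D _ => by positivity]
        refine mul_le_mul' le_rfl (ENNReal.ofReal_le_ofReal ?_)
        rw [Finset.sum_add_distrib, Finset.sum_const, ← Finset.sum_div, Finset.card_powersetCard,
          Finset.card_univ, Fintype.card_fin, nsmul_eq_mul, mul_add]
        have := sum_card_collisions_le c hc (by omega : 2 ≤ 2 * k) hkn
        refine add_le_add le_rfl ?_
        rw [div_le_iff₀ hτ]
        refine this.trans (le_of_eq ?_)
        push_cast
        field_simp
    _ = _ := by
        rw [ENNReal.ofReal_mul (Nat.cast_nonneg _), ENNReal.ofReal_natCast, ← mul_assoc,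
          ENNReal.inv_mul_cancel hc0 hct, one_mul]

/-! ### The reduction to the subgraph stochastic block model -/

instance {n : ℕ} (P : Measure (SimpleGraph (Fin n))) [IsProbabilityMeasure P] :
    IsProbabilityMeasure (randomlyPermuted P) := by
  constructor
  rw [← lintegral_one, lintegral_randomlyPermuted, lintegral_const, measure_univ, mul_one]
  exact factorial_inv_mul_sum_const n 1

theorem isProbabilityMeasure_of_mem_subgraphSBM {δ q ρ : ℝ} {n k : ℕ}
    {P : Measure (SimpleGraph (Fin n))} (hP : P ∈ subgraphSBM δ n k q ρ) :
    IsProbabilityMeasure P := by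
  obtain ⟨_, _, _, _, _, _, _, _, _, p, _, rfl⟩ := hP
  infer_instance

/-- A set is `good` when its size is within `τ` of `k` and it has at most `τ` collisions. The value
of `τ` spends the size tolerance of the model exactly: together the two conditions cost at most `2 *
τ` columns, and a column contributes `2 ^ l / 2` vertices to each community. -/
theorem exists_ssbm_reduction {n g l k W : ℕ} {δ t μ M η B ρ τ : ℝ} (hn : n ≤ g * (2 ^ l - 1))
    (hk : 1 ≤ k) (hkn : 4 * k ≤ n)
    (hτ : τ = ((k * 2 ^ l : ℕ) : ℝ) ^ (1 - δ) / 2 ^ l)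
    (hK : ((k * 2 ^ l : ℕ) : ℝ) ^ (1 - δ) < ((k * 2 ^ l : ℕ) : ℝ) / 2)
    (hM : 0 ≤ M) (hη : 0 < η) (hμ₀ : 0 ≤ μ) (hμ₁ : μ ≤ 1) (hμB : Real.exp (μ * B) ≤ 3 / 2)
    (hB : Real.exp (4 - 2 * B) ≤ 1 / 4) (hB₀ : 0 ≤ B) (hW : M / η + 1 ≤ W)
    (hρ : ρ ≤ ProbabilityTheory.gaussianPDFReal 0 1 (|t| + 1) * (μ / 2 ^ l))
    (φ : GraphAlgorithm (g * 2 ^ l)) :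
    ∃ A : GraphAlgorithm n, A.time ≤ seedCost (g * 2 ^ l) W + 1 + φ.time ∧
      (plantedCliqueDetection n (2 * k) ⟨1 / 2, by norm_num, by norm_num⟩).error A ≤
        (ssbmDetection δ (g * 2 ^ l) (k * 2 ^ l) (gaussianTail t 0) ρ).error φ +
        ENNReal.ofReal (((1 + 2 * Real.exp (4 - 2 * B)) ^ ((2 * k) ^ 2) - 1) +
          2 * (1 + 2 * Real.exp (4 - 2 * B)) ^ ((2 * k) ^ 2) *
            roundingError (g * 2 ^ l * (g * 2 ^ l)) (Fintype.card (Sym2 (Fin (g * 2 ^ l)))) M η +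
          √(Real.exp (2 * ((2 * k : ℕ) : ℝ) ^ 2 / n) - 1) +
          (k / (2 * τ ^ 2) + ((2 ^ l : ℕ) : ℝ) * (2 * k) ^ 2 / (n * τ))) := by
  classical
  obtain ⟨j, h, c, hR, h1, habs, hsum, hdisj, hc⟩ := exists_sparse_sign_matrix hn
  set K := k * 2 ^ l with hKdef
  have hm0 : (0 : ℝ) < 2 ^ l := by positivity
  have hK0 : (0 : ℝ) < (K : ℝ) := by rw [hKdef]; push_cast; positivity
  have hτ0 : 0 < τ := by rw [hτ]; positivity
  have hτm : τ * 2 ^ l = (K : ℝ) ^ (1 - δ) := by rw [hτ]; field_simp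
  refine exists_reduction (by omega) j (symConj_mul_transpose hR) hM hη hμ₀ hμ₁ hμB hB hB₀ hW
    (fun P hP => isProbabilityMeasure_of_mem_subgraphSBM hP)
    (H₁ := subgraphSBM δ (g * 2 ^ l) K (gaussianTail t 0) ρ) (good := fun S => |(S.card : ℝ) - k| ≤ τ ∧ (collisions c S).card ≤ τ) ?_ (by positivity)
    (sum_lintegral_bad_le c hc hk (by omega) hτ0) φ
  rintro S ⟨hS1, hS2⟩
  set A : Fin (g * 2 ^ l) → ℤ := fun u => ∑ a ∈ S, h u (j a) with hA
  have hmean : ∀ u v, u ≠ v → (symConj (Matrix.of fun u v => (h u v : ℝ) / √(2 ^ l))).mulVec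
      (plantedMean μ (S.map j)) s(u, v) = μ / 2 ^ l * (A u * A v) := fun u v huv => by
    have hs : √(2 ^ l : ℝ) * √(2 ^ l) = 2 ^ l := Real.mul_self_sqrt (by positivity)
    rw [symConj_mulVec_plantedMean _ _ _ huv]
    simp only [Matrix.of_apply, Finset.sum_map, ← Finset.sum_div, hA]
    push_cast
    rw [div_mul_div_comm, hs]
    ring
  have hν1 : μ / 2 ^ l ≤ 1 := (div_le_self hμ₀ (one_le_pow₀ one_le_two)).trans hμ₁
  obtain ⟨p, hp, hperm⟩ := exists_isBlockProbability (by positivity) hν1 rfl hρ A _ hmean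
  rw [hperm]
  obtain ⟨L, hLS, hLa, hLcard⟩ := exists_alone_card_le c S
  have hLcard' : (S.card : ℝ) ≤ L.card + (collisions c S).card := by exact_mod_cast hLcard
  have hLd : ∀ i ∈ L, ∀ i' ∈ S, i' ≠ i → ∀ u, h u (j i) = 0 ∨ h u (j i') = 0 :=
    fun i hi i' hi' hne => hdisj _ _ (hLa i hi i' hi' hne)
  have hpos := mul_card_le_two_mul_card_pos (fun u a => h u (j a)) (2 ^ l) hLS (fun u a => h1 _ _)
    (fun a => by rw [habs]; norm_cast) (fun a _ => hsum a) hLd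
  -- The negative community is the positive one for `-h`.
  have hneg := mul_card_le_two_mul_card_pos (fun u a => -h u (j a)) (2 ^ l) hLS
    (fun u a => by rw [abs_neg]; exact h1 _ _)
    (fun a => by simp only [abs_neg]; rw [habs]; norm_cast)
    (fun a _ => by rw [Finset.sum_neg_distrib, hsum, neg_zero])
    (fun i hi i' hi' hne u => by simpa using hLd i hi i' hi' hne u)
  simp only [Finset.sum_neg_distrib, Left.neg_pos_iff] at hneg
  -- Here `|L| ≥ |S| - τ ≥ k - 2 * τ` and `|S| ≤ k + τ`, while `2 ^ l * τ = K ^ (1 - δ)`; positivity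
  -- of `k'` comes from `hK`.
  have hsize : ∀ k' : ℕ, 2 ^ l * L.card ≤ 2 * k' ∧ 2 * k' ≤ 2 ^ l * S.card →
      0 < k' ∧ (K : ℝ) / 2 - (K : ℝ) ^ (1 - δ) ≤ k' ∧ (k' : ℝ) ≤ (K : ℝ) / 2 + (K : ℝ) ^ (1 - δ) := by
    rintro k' ⟨ha, hb⟩
    have ha' : (2 : ℝ) ^ l * L.card ≤ 2 * k' := by exact_mod_cast ha
    have hb' : 2 * (k' : ℝ) ≤ 2 ^ l * S.card := by exact_mod_cast hb
    have hS := abs_le.1 hS1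
    have hKc : (K : ℝ) = k * 2 ^ l := by rw [hKdef]; push_cast; ring
    have hl1 : (2 : ℝ) ^ l * (k - 2 * τ) ≤ 2 ^ l * L.card :=
      mul_le_mul_of_nonneg_left (by linarith) hm0.le
    have hl2 : (2 : ℝ) ^ l * S.card ≤ 2 ^ l * (k + τ) :=
      mul_le_mul_of_nonneg_left (by linarith) hm0.le
    have hτK : 0 < (K : ℝ) ^ (1 - δ) := by positivity
    have hlow : (K : ℝ) / 2 - (K : ℝ) ^ (1 - δ) ≤ k' := by rw [← hτm]; linarith
    refine ⟨?_, hlow, by rw [← hτm]; linarith⟩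
    have : (0 : ℝ) < k' := by linarith
    exact_mod_cast this
  obtain ⟨a1, a2, a3⟩ := hsize _ hpos
  obtain ⟨b1, b2, b3⟩ := hsize _ hneg
  refine ⟨_, _, a1, b1, ?_, a2, a3, b2, b3, p, hp, rfl⟩
  rw [← Finset.card_union_of_disjoint]
  · exact (Finset.card_le_univ _).trans_eq (Fintype.card_fin _)
  · rw [Finset.disjoint_left]
    intro u h1 h2
    simp only [Finset.mem_filter, Finset.mem_univ, true_and] at h1 h2
    exact absurd h1 h2.not_gt

/-! ### Choice of the parameters -/

theorem subgraphSBM_nonempty {δ q ν t ρ : ℝ} {N h : ℕ} (hν₀ : 0 ≤ ν) (hν₁ : ν ≤ 1)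
    (hq : (gaussianTail t 0 : ℝ) = q)
    (hρ : ρ ≤ ProbabilityTheory.gaussianPDFReal 0 1 (|t| + 1) * ν) (hh : 0 < h) (hN : 2 * h ≤ N) :
    (subgraphSBM δ N (2 * h) q ρ).Nonempty := by
  set A : Fin N → ℤ := fun u => if u.val < h then 1 else if u.val < 2 * h then -1 else 0 with hA
  obtain ⟨p, hp, -⟩ := exists_isBlockProbability hν₀ hν₁ hq hρ A
    (fun e => Sym2.lift ⟨fun u v => ν * (A u * A v), fun u v => by ring⟩ e) fun u v _ => rfl
  have h1 : (Finset.univ.filter fun u => 0 < A u).card = h := by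
    have : (Finset.univ.filter fun u => 0 < A u) = Finset.univ.filter fun u : Fin N => u.val < h := by
      ext u
      simp only [hA, Finset.mem_filter, Finset.mem_univ, true_and]
      split_ifs <;> simp_all
    rw [this, Fin.card_filter_val_lt]; omega
  have h2 : (Finset.univ.filter fun u => A u < 0).card = h := by
    have : (Finset.univ.filter fun u => A u < 0) =
        (Finset.univ.filter fun u : Fin N => u.val < 2 * h) \
          Finset.univ.filter fun u : Fin N => u.val < h := by
      ext u
      simp only [hA, Finset.mem_filter, Finset.mem_univ, true_and, Finset.mem_sdiff]
      split_ifs <;> simp_all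
    rw [this, Finset.card_sdiff_of_subset, Fin.card_filter_val_lt, Fin.card_filter_val_lt]
    · omega
    · intro u
      simp only [Finset.mem_filter, Finset.mem_univ, true_and]
      omega
  rw [h1, h2] at hp
  have h0 : (0 : ℝ) ≤ ((2 * h : ℕ) : ℝ) ^ (1 - δ) := by positivity
  have h3 : ((2 * h : ℕ) : ℝ) / 2 = h := by push_cast; ring
  refine ⟨_, h, h, hh, hh, by omega, ?_, ?_, ?_, ?_, p, hp, rfl⟩ <;> rw [h3] <;> linarith

theorem exists_two_pow_between {y : ℝ} (hy : 1 ≤ y) : ∃ l : ℕ, 1 ≤ l ∧ y ≤ 2 ^ l ∧ 2 ^ l ≤ 2 * y := by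
  refine ⟨⌊Real.logb 2 y⌋₊ + 1, by omega, ?_, ?_⟩
  · rw [← Real.rpow_natCast, ← Real.logb_le_iff_le_rpow one_lt_two (by linarith)]
    push_cast
    exact (Nat.lt_floor_add_one _).le
  · rw [pow_succ, mul_comm]
    refine mul_le_mul_of_nonneg_left ?_ zero_le_two
    rw [← Real.rpow_natCast, ← Real.le_logb_iff_rpow_le one_lt_two (by linarith)]
    exact Nat.floor_le (Real.logb_nonneg one_lt_two hy)

/-- With `d = 2 ^ l - 1`, the choice `g = n / d + 1` is the least convenient number of blocks with
room for `n` nonconstant columns; `2 ^ l ≤ 2 * n` keeps the total below `4 * n`. The requirement `l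
≥ 1` makes `d` positive. -/
theorem exists_scales {x κ : ℝ} (hx₀ : 0 ≤ x) (hx₁ : x ≤ 1) (hκ : 0 ≤ κ) :
    ∃ l k g : ℕ → ℕ, ∀ n : ℕ, 1 ≤ n → 1 ≤ l n ∧ (n : ℝ) ^ x ≤ 2 ^ l n ∧ 2 ^ l n ≤ 2 * (n : ℝ) ^ x ∧
      1 ≤ k n ∧ (n : ℝ) ^ κ ≤ k n ∧ (k n : ℝ) ≤ 2 * (n : ℝ) ^ κ ∧ n ≤ g n * (2 ^ l n - 1) ∧
      n ≤ g n * 2 ^ l n ∧ g n * 2 ^ l n ≤ 4 * n := by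
  have key : ∀ n : ℕ, ∃ l k g : ℕ, 1 ≤ n → 1 ≤ l ∧ (n : ℝ) ^ x ≤ 2 ^ l ∧ 2 ^ l ≤ 2 * (n : ℝ) ^ x ∧
      1 ≤ k ∧ (n : ℝ) ^ κ ≤ k ∧ (k : ℝ) ≤ 2 * (n : ℝ) ^ κ ∧ n ≤ g * (2 ^ l - 1) ∧
      n ≤ g * 2 ^ l ∧ g * 2 ^ l ≤ 4 * n := by
    intro n
    by_cases hn : 1 ≤ n
    · have hn' : (1 : ℝ) ≤ n := by exact_mod_cast hn
      obtain ⟨l, hl, h1, h2⟩ := exists_two_pow_between (Real.one_le_rpow hn' hx₀)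
      have hκ1 := Real.one_le_rpow hn' hκ
      have h3 : (2 : ℝ) ^ l ≤ 2 * n := h2.trans (by
        have := Real.rpow_le_rpow_of_exponent_le hn' hx₁
        rw [Real.rpow_one] at this; linarith)
      have h3' : 2 ^ l ≤ 2 * n := by exact_mod_cast h3
      have h4 : 2 ≤ 2 ^ l := by
        calc 2 = 2 ^ 1 := rfl
          _ ≤ 2 ^ l := Nat.pow_le_pow_right two_pos hl
      set m := 2 ^ l with hm
      obtain ⟨d, hd⟩ : ∃ d, m = d + 1 := ⟨m - 1, by omega⟩
      have h5 : n ≤ (n / d + 1) * d := by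
        rw [mul_comm]; exact (Nat.lt_mul_div_succ n (by omega : 0 < d)).le
      refine ⟨l, ⌈(n : ℝ) ^ κ⌉₊, n / d + 1, fun _ => ⟨hl, h1, h2, Nat.one_le_ceil_iff.2
        (by linarith), Nat.le_ceil _, ?_, ?_, ?_, ?_⟩⟩
      · have := Nat.ceil_lt_add_one (by linarith : 0 ≤ (n : ℝ) ^ κ)
        linarith
      · rw [← hm, hd]; exact h5
      · rw [← hm, hd]; nlinarith
      · rw [← hm, hd]
        have h6 : n / d * d ≤ n := Nat.div_mul_le_self n d
        have h7 : n / d ≤ n / d * d := Nat.le_mul_of_pos_right _ (by omega)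
        nlinarith
    · exact ⟨0, 0, 0, fun h => absurd h hn⟩
  choose l k g h using key
  exact ⟨l, k, g, h⟩

/-! ### Asymptotics -/

theorem tendsto_natCast_rpow_zero {a : ℝ} (ha : a < 0) (c : ℝ) :
    Tendsto (fun n : ℕ => c * (n : ℝ) ^ a) atTop (𝓝 0) := by
  have := (tendsto_rpow_neg_atTop (neg_pos.2 ha)).comp (tendsto_natCast_atTop_atTop (R := ℝ))
  simpa [Function.comp_def] using this.const_mul c

theorem eventually_mul_rpow_le {a b : ℝ} (hab : a < b) (c : ℝ) :
    ∀ᶠ n : ℕ in atTop, c * (n : ℝ) ^ a ≤ (n : ℝ) ^ b := by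
  filter_upwards [(tendsto_natCast_rpow_zero (sub_neg.2 hab) c).eventually_le_const zero_lt_one,
    eventually_ge_atTop 1] with n hn hn1
  have hn0 : (0 : ℝ) < n := by exact_mod_cast hn1
  rw [Real.rpow_sub hn0, ← mul_div_assoc, div_le_one (Real.rpow_pos_of_pos hn0 _)] at hn
  exact hn

theorem tendsto_log_natCast : Tendsto (fun n : ℕ => Real.log n) atTop atTop :=
  Real.tendsto_log_atTop.comp tendsto_natCast_atTop_atTop

theorem tendsto_log_div_log_of_between {a c : ℝ} {f : ℕ → ℝ} (hc : 0 < c)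
    (h : ∀ᶠ n : ℕ in atTop, (n : ℝ) ^ a ≤ f n ∧ f n ≤ c * (n : ℝ) ^ a) :
    Tendsto (fun n : ℕ => Real.log (f n) / Real.log n) atTop (𝓝 a) := by
  have h1 : Tendsto (fun n : ℕ => a + Real.log c / Real.log n) atTop (𝓝 a) := by
    simpa using tendsto_const_nhds.add (tendsto_log_natCast.const_div_atTop (Real.log c))
  refine tendsto_of_tendsto_of_tendsto_of_le_of_le' tendsto_const_nhds h1 ?_ ?_
  · filter_upwards [h, eventually_ge_atTop 2] with n hn hn2
    have hn1 : (1 : ℝ) < n := by exact_mod_cast hn2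
    rw [le_div_iff₀ (Real.log_pos hn1), ← Real.log_rpow (by linarith)]
    exact Real.log_le_log (by positivity) hn.1
  · filter_upwards [h, eventually_ge_atTop 2] with n hn hn2
    have hn1 : (1 : ℝ) < n := by exact_mod_cast hn2
    have hp : (0 : ℝ) < (n : ℝ) ^ a := by positivity
    have hl := Real.log_pos hn1
    rw [div_le_iff₀ hl, add_mul, div_mul_cancel₀ _ hl.ne', ← Real.log_rpow (by linarith), add_comm,
      ← Real.log_mul hc.ne' hp.ne']
    exact Real.log_le_log (by linarith) hn.2

theorem tendsto_log_log_div_log :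
    Tendsto (fun n : ℕ => Real.log (Real.log (n + 3)) / Real.log n) atTop (𝓝 0) := by
  have h1 : Tendsto (fun n : ℕ => Real.log ((n : ℝ) + 3)) atTop atTop :=
    Real.tendsto_log_atTop.comp (tendsto_atTop_add_const_right _ _ tendsto_natCast_atTop_atTop)
  have h2 : Tendsto (fun n : ℕ => Real.log (Real.log (n + 3)) / Real.log (n + 3)) atTop (𝓝 0) :=
    (Real.isLittleO_log_id_atTop.tendsto_div_nhds_zero).comp h1
  have h3 : Tendsto (fun n : ℕ => Real.log ((n : ℝ) + 3) / Real.log n) atTop (𝓝 1) := by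
    refine tendsto_log_div_log_of_between (c := 4) (by norm_num) ?_
    filter_upwards [eventually_ge_atTop 1] with n hn
    have : (1 : ℝ) ≤ n := by exact_mod_cast hn
    rw [Real.rpow_one]
    constructor <;> linarith
  have := h2.mul h3
  rw [zero_mul] at this
  refine this.congr fun n => ?_
  have : Real.log ((n : ℝ) + 3) ≠ 0 := (Real.log_pos (by linarith [n.cast_nonneg (α := ℝ)])).ne'
  field_simp

/-- At most `N ^ 2` thresholds, each with a margin of order `N ^ 2 * η`, are beaten by `η = (N + 1)
^ (-5)`; truncation at level `N` costs an exponentially small amount. -/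
theorem tendsto_roundingError : Tendsto (fun N : ℕ => roundingError (N * N)
    (Fintype.card (Sym2 (Fin N))) N (((N : ℝ) + 1) ^ 5)⁻¹) atTop (𝓝 0) := by
  have h1 : Tendsto (fun N : ℕ => 2 * Real.exp 4 * ((2 * (N : ℝ)) ^ 2 * Real.exp (-(2 * (N : ℝ)))))
      atTop (𝓝 0) := by
    have : Tendsto (fun N : ℕ => 2 * (N : ℝ)) atTop atTop :=
      tendsto_natCast_atTop_atTop.const_mul_atTop two_pos
    have := ((Real.tendsto_pow_mul_exp_neg_atTop_nhds_zero 2).comp this).const_mul (2 * Real.exp 4)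
    simpa using this
  have h2 : Tendsto (fun N : ℕ => 2 * (1 / ((N : ℝ) + 1))) atTop (𝓝 0) := by
    simpa using tendsto_one_div_add_atTop_nhds_zero_nat.const_mul (2 : ℝ)
  have h3 := h1.add h2
  rw [add_zero] at h3
  refine squeeze_zero (fun N => roundingError_nonneg _ _ _ (by positivity)) (fun N => ?_) h3
  rw [roundingError]
  refine add_le_add ?_ ?_
  · rw [sub_eq_add_neg, Real.exp_add]
    push_cast
    have : 0 ≤ (N : ℝ) ^ 2 * (Real.exp 4 * Real.exp (-(2 * N))) := by positivity
    nlinarith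
  · have hc : (Fintype.card (Sym2 (Fin N)) : ℝ) ≤ (N : ℝ) * N := by
      have := Fintype.card_le_of_surjective (fun p : Fin N × Fin N => s(p.1, p.2)) Sym2.mk_surjective
      rw [Fintype.card_prod, Fintype.card_fin] at this
      exact_mod_cast this
    have hN : (0 : ℝ) ≤ N := Nat.cast_nonneg N
    calc _ ≤ (N : ℝ) * N * (2 * (((N * N : ℕ) + 1) * (((N : ℝ) + 1) ^ 5)⁻¹)) := by gcongr
      _ = 2 * ((N : ℝ) * N * (N * N + 1)) / ((N : ℝ) + 1) ^ 5 := by push_cast; field_simp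
      _ ≤ 2 * ((N : ℝ) + 1) ^ 4 / ((N : ℝ) + 1) ^ 5 := by
          gcongr
          nlinarith [mul_nonneg hN hN, mul_nonneg hN (mul_nonneg hN hN)]
      _ = 2 * (1 / ((N : ℝ) + 1)) := by field_simp

theorem one_le_log_add_three (n : ℕ) : 1 ≤ Real.log ((n : ℝ) + 3) := by
  rw [Real.le_log_iff_exp_le (by positivity)]
  linarith [Real.exp_one_lt_d9, n.cast_nonneg (α := ℝ)]

theorem exp_four_sub_le (n : ℕ) :
    Real.exp (4 - 2 * (3 + Real.log ((n : ℝ) + 3))) ≤ 4⁻¹ / ((n : ℝ) + 3) ^ 2 := by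
  have h0 : (0 : ℝ) < (n : ℝ) + 3 := by positivity
  have h1 : 4 - 2 * (3 + Real.log ((n : ℝ) + 3)) = -2 - Real.log (((n : ℝ) + 3) ^ 2) := by
    rw [Real.log_pow]; push_cast; ring
  rw [h1, Real.exp_sub, Real.exp_log (by positivity)]
  gcongr
  rw [Real.exp_neg]
  refine inv_anti₀ (by norm_num) ?_
  have : Real.exp 2 = Real.exp 1 * Real.exp 1 := by rw [← Real.exp_add]; norm_num
  rw [this]
  nlinarith [Real.add_one_le_exp (1 : ℝ)]

/-- Each planted pair costs a factor `1 + O(n ^ (-2))`, and there are `O(n ^ (2 * κ))` of them. -/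
theorem tendsto_pow_planting_cost {κ : ℝ} (hκ : κ < 1) {k : ℕ → ℕ}
    (hk : ∀ n : ℕ, 1 ≤ n → (k n : ℝ) ≤ 2 * (n : ℝ) ^ κ) :
    Tendsto (fun n : ℕ => (1 + 2 * Real.exp (4 - 2 * (3 + Real.log ((n : ℝ) + 3)))) ^ ((2 * k n) ^ 2))
      atTop (𝓝 1) := by
  have h1 : Tendsto (fun n : ℕ => Real.exp (8 * (n : ℝ) ^ (2 * κ - 2))) atTop (𝓝 1) := by
    have := (Real.continuous_exp.tendsto 0).comp
      (tendsto_natCast_rpow_zero (by linarith : 2 * κ - 2 < 0) 8)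
    rwa [Real.exp_zero] at this
  refine tendsto_of_tendsto_of_tendsto_of_le_of_le' tendsto_const_nhds h1 ?_ ?_
  · exact Eventually.of_forall fun n => one_le_pow₀
      (by linarith [Real.exp_pos (4 - 2 * (3 + Real.log ((n : ℝ) + 3)))])
  · filter_upwards [eventually_ge_atTop 1] with n hn
    have hn0 : (0 : ℝ) < n := by exact_mod_cast hn
    have hE := exp_four_sub_le n
    set E := Real.exp (4 - 2 * (3 + Real.log ((n : ℝ) + 3))) with hEdef
    have hE0 : 0 < E := Real.exp_pos _
    have hE1 : E ≤ 4⁻¹ / (n : ℝ) ^ 2 := hE.trans (by gcongr; linarith)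
    calc (1 + 2 * E) ^ ((2 * k n) ^ 2) ≤ Real.exp (2 * E) ^ ((2 * k n) ^ 2) := by
          gcongr
          linarith [Real.add_one_le_exp (2 * E)]
      _ = Real.exp ((((2 * k n) ^ 2 : ℕ) : ℝ) * (2 * E)) := by rw [Real.exp_nat_mul]
      _ ≤ Real.exp (8 * (n : ℝ) ^ (2 * κ - 2)) := by
          refine Real.exp_le_exp.2 ?_
          have h2 : (n : ℝ) ^ (2 * κ - 2) = ((n : ℝ) ^ κ) ^ 2 / (n : ℝ) ^ 2 := by
            rw [Real.rpow_sub hn0, ← Real.rpow_natCast ((n : ℝ) ^ κ), ← Real.rpow_mul hn0.le]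
            norm_num [mul_comm]
          rw [h2]
          push_cast
          calc (2 * (k n : ℝ)) ^ 2 * (2 * E) ≤
                (2 * (2 * (n : ℝ) ^ κ)) ^ 2 * (2 * (4⁻¹ / (n : ℝ) ^ 2)) := by
                gcongr
                exact hk n hn
            _ = _ := by ring

/-- Hiding `C \ D` is free in the limit exactly because `k ^ 2 / n` tends to zero, hence `κ < 1 /
2`. -/
theorem tendsto_sqrt_exp_sub_one {κ : ℝ} (hκ : κ < 1 / 2) {k : ℕ → ℕ}
    (hk : ∀ n : ℕ, 1 ≤ n → (k n : ℝ) ≤ 2 * (n : ℝ) ^ κ) :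
    Tendsto (fun n : ℕ => √(Real.exp (2 * ((2 * k n : ℕ) : ℝ) ^ 2 / n) - 1)) atTop (𝓝 0) := by
  have h1 : Tendsto (fun n : ℕ => 2 * ((2 * k n : ℕ) : ℝ) ^ 2 / n) atTop (𝓝 0) := by
    refine tendsto_of_tendsto_of_tendsto_of_le_of_le' tendsto_const_nhds
      (tendsto_natCast_rpow_zero (by linarith : 2 * κ - 1 < 0) 32) ?_ ?_
    · exact Eventually.of_forall fun n => by positivity
    · filter_upwards [eventually_ge_atTop 1] with n hn
      have hn0 : (0 : ℝ) < n := by exact_mod_cast hn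
      have h2 : (n : ℝ) ^ (2 * κ - 1) = ((n : ℝ) ^ κ) ^ 2 / n := by
        rw [Real.rpow_sub hn0, ← Real.rpow_natCast ((n : ℝ) ^ κ), ← Real.rpow_mul hn0.le]
        norm_num [mul_comm]
      rw [h2]
      push_cast
      calc _ ≤ 2 * (2 * (2 * (n : ℝ) ^ κ)) ^ 2 / n := by
            gcongr
            exact hk n hn
        _ = _ := by ring
  have h2 : Continuous fun y : ℝ => √(Real.exp y - 1) := by fun_prop
  have h3 := (h2.tendsto 0).comp h1
  simp only [Real.exp_zero, sub_self, Real.sqrt_zero] at h3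
  exact h3

/-- `τ` is of order `n ^ (κ - δ * (x + κ))`. The Chebyshev term `k / τ ^ 2` then has exponent `2 * δ
* (x + κ) - κ`, and the collision term `2 ^ l * k ^ 2 / (n * τ)` has exponent `(x + κ) * (1 + δ) -
1`; `h₁` and `h₂` make both negative. -/
theorem tendsto_bad_probability {x κ δ : ℝ} (h₁ : 2 * (δ * (x + κ)) < κ)
    (h₂ : (x + κ) * (1 + δ) < 1) (hδ : δ ≤ 1) {l k : ℕ → ℕ} {τ : ℕ → ℝ}
    (hl : ∀ n : ℕ, 1 ≤ n → (n : ℝ) ^ x ≤ 2 ^ l n ∧ 2 ^ l n ≤ 2 * (n : ℝ) ^ x)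
    (hk : ∀ n : ℕ, 1 ≤ n → (n : ℝ) ^ κ ≤ k n ∧ (k n : ℝ) ≤ 2 * (n : ℝ) ^ κ)
    (hτ : ∀ n, τ n = ((k n * 2 ^ l n : ℕ) : ℝ) ^ (1 - δ) / 2 ^ l n) :
    Tendsto (fun n : ℕ => (k n : ℝ) / (2 * τ n ^ 2) +
      ((2 ^ l n : ℕ) : ℝ) * (2 * k n) ^ 2 / (n * τ n)) atTop (𝓝 0) := by
  have h3 : ∀ n : ℕ, 1 ≤ n → (n : ℝ) ^ (κ - δ * (x + κ)) / 2 ≤ τ n := fun n hn => by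
    have hn0 : (0 : ℝ) < n := by exact_mod_cast hn
    obtain ⟨hl1, hl2⟩ := hl n hn
    have hkn := (hk n hn).1
    rw [hτ]
    have h4 : (n : ℝ) ^ (κ - δ * (x + κ)) / 2 =
        ((n : ℝ) ^ κ * (n : ℝ) ^ x) ^ (1 - δ) / (2 * (n : ℝ) ^ x) := by
      rw [← Real.rpow_add hn0, ← Real.rpow_mul hn0.le, mul_comm 2, ← div_div, ← Real.rpow_sub hn0]
      congr 2
      ring
    rw [h4]
    push_cast
    gcongr
  have hA : Tendsto (fun n : ℕ => 4 * (n : ℝ) ^ (2 * (δ * (x + κ)) - κ) +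
      64 * (n : ℝ) ^ ((x + κ) * (1 + δ) - 1)) atTop (𝓝 0) := by
    simpa using (tendsto_natCast_rpow_zero (sub_neg.2 h₁) 4).add
      (tendsto_natCast_rpow_zero (sub_neg.2 h₂) 64)
  refine tendsto_of_tendsto_of_tendsto_of_le_of_le' tendsto_const_nhds hA ?_ ?_
  · filter_upwards [eventually_ge_atTop 1] with n hn
    have hn0 : (0 : ℝ) < n := by exact_mod_cast hn
    have : 0 < τ n := lt_of_lt_of_le (by positivity) (h3 n hn)
    positivity
  · filter_upwards [eventually_ge_atTop 1] with n hn
    have hn0 : (0 : ℝ) < n := by exact_mod_cast hn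
    obtain ⟨hl1, hl2⟩ := hl n hn
    obtain ⟨hk1, hk2⟩ := hk n hn
    have hτn := h3 n hn
    set y := (n : ℝ) ^ (κ - δ * (x + κ)) with hy
    have hy0 : 0 < y := by positivity
    have e1 : (n : ℝ) ^ (2 * (δ * (x + κ)) - κ) = (n : ℝ) ^ κ / y ^ 2 := by
      rw [hy, ← Real.rpow_natCast (_ ^ _), ← Real.rpow_mul hn0.le, ← Real.rpow_sub hn0]
      congr 1
      push_cast
      ring
    have e2 : (n : ℝ) ^ ((x + κ) * (1 + δ) - 1) = (n : ℝ) ^ x * ((n : ℝ) ^ κ) ^ 2 / (n * y) := by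
      rw [hy, ← Real.rpow_natCast (_ ^ _), ← Real.rpow_mul hn0.le, ← Real.rpow_add hn0]
      nth_rewrite 3 [← Real.rpow_one (n : ℝ)]
      rw [← Real.rpow_add hn0, ← Real.rpow_sub hn0]
      congr 1
      push_cast
      ring
    rw [e1, e2]
    refine add_le_add ?_ ?_
    · calc (k n : ℝ) / (2 * τ n ^ 2) ≤ 2 * (n : ℝ) ^ κ / (2 * (y / 2) ^ 2) := by gcongr
        _ = _ := by field_simp; norm_num
    · push_cast
      calc _ ≤ 2 * (n : ℝ) ^ x * (2 * (2 * (n : ℝ) ^ κ)) ^ 2 / (n * (y / 2)) := by gcongr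
        _ = _ := by field_simp; norm_num

theorem Polynomial.eval_mono_nat (p : Polynomial ℕ) : Monotone fun x => p.eval x := by
  intro a b hab
  simp only [Polynomial.eval_eq_sum_range]
  gcongr

theorem exists_polynomial_seedCost_le (p : Polynomial ℕ) : ∃ r : Polynomial ℕ, ∀ n N : ℕ,
    N ≤ 4 * n → seedCost N (N * (N + 1) ^ 5 + 1) + 1 + p.eval N ≤ r.eval n := by
  let Q : Polynomial ℕ := 4 * Polynomial.X
  refine ⟨Q * Q * ((Q * Q + 1) * ((2 * (Q * Q * (Q * (Q + 1) ^ 5 + 1)) + 1) * 3 + 1)) + 1 + p.comp Q,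
    fun n N hN => ?_⟩
  have h1 : seedCost N (N * (N + 1) ^ 5 + 1) ≤
      seedCost (4 * n) (4 * n * (4 * n + 1) ^ 5 + 1) := by
    unfold seedCost
    gcongr
  have h2 := p.eval_mono_nat hN
  simp only [seedCost] at h1
  simp only [Q, Polynomial.eval_add, Polynomial.eval_mul, Polynomial.eval_pow, Polynomial.eval_comp,
    Polynomial.eval_X, Polynomial.eval_ofNat, Polynomial.eval_one] at h2 ⊢
  simp only [seedCost]
  omega

/-- The scales of the reduction: an edge of a planted clique of size `n ^ κ` is spread over
`n ^ x` positions. -/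
theorem exists_exponents {α β δ : ℝ} (hδ : 0 < δ) (hα : 0 ≤ α) (hβ₀ : δ < β)
    (hβ₁ : β < 1 - 3 * δ) (hβα : β < 1 / 2 + α) :
    ∃ x κ : ℝ, x + κ = β ∧ 0 ≤ x ∧ x ≤ α ∧ x ≤ 1 ∧ 0 < κ ∧ κ < 1 / 2 ∧
      2 * (δ * (x + κ)) < κ ∧ (x + κ) * (1 + δ) < 1 := by
  -- A larger `x` allows a smaller clique, but the rotation weakens the signal to `n ^ (-x)`, whence
  -- `x ≤ α`. The cap `β / 2` keeps `κ ≥ β / 2`, so that the community sizes concentrate within the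
  -- tolerance; `δ < 1 / 4` follows from `δ < β < 1 - 3 * δ`.
  refine ⟨min α (β / 2), β - min α (β / 2), by ring, le_min hα (by linarith), min_le_left _ _,
    (min_le_right _ _).trans (by linarith), ?_, ?_, ?_, ?_⟩
  · linarith [min_le_right α (β / 2)]
  · rcases min_choice α (β / 2) with h | h <;> rw [h] <;> linarith
  · have := min_le_right α (β / 2)
    nlinarith
  · nlinarith

theorem tendsto_log_inv_div_log {α c : ℝ} (hc : 0 < c) :
    Tendsto (fun n : ℕ => Real.log (c * (n : ℝ) ^ (-α) / Real.log (n + 3))⁻¹ / Real.log n) atTop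
      (𝓝 α) := by
  have h1 := ((tendsto_const_nhds (x := α)).sub (tendsto_log_natCast.const_div_atTop
    (Real.log c))).add tendsto_log_log_div_log
  rw [sub_zero, add_zero] at h1
  refine h1.congr' ?_
  filter_upwards [eventually_ge_atTop 2] with n hn
  have hn1 : (1 : ℝ) < n := by exact_mod_cast hn
  have hL := one_le_log_add_three n
  have hl := Real.log_pos hn1
  rw [Real.log_inv, Real.log_div (by positivity) (by linarith), Real.log_mul hc.ne' (by positivity),
    Real.log_rpow (by linarith)]
  field_simp
  ring

/-- With `L = log (n + 3) ≥ 1`, the exponent `(3 + L) / (12 * L)` is at most `1 / 3 ≤ log (3 / 2)`;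
this is the origin of the `12`. -/
theorem exp_planting_le (n : ℕ) :
    Real.exp (1 / (12 * Real.log ((n : ℝ) + 3)) * (3 + Real.log ((n : ℝ) + 3))) ≤ 3 / 2 := by
  have hL := one_le_log_add_three n
  rw [← Real.le_log_iff_exp_le (by norm_num)]
  have h1 := Real.one_sub_inv_le_log_of_pos (by norm_num : (0 : ℝ) < 3 / 2)
  refine le_trans ?_ h1
  rw [one_div_mul_eq_div, div_le_iff₀ (by linarith)]
  norm_num
  linarith

theorem mainTheorem8 (δ α β q : ℝ) (hδ : 0 < δ) (hα₀ : 0 ≤ α) (hα₂ : α < 2)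
    (hβ₀ : δ < β) (hβ₁ : β < 1 - 3 * δ) (hβα : β < 1 / 2 + α) (hq₀ : 0 < q) (hq₁ : q < 1) :
    ∃ (N K : ℕ → ℕ) (qs : ℕ → I) (ρ : ℕ → ℝ),
      -- the parameters are admissible
      (∀ n, 0 < K n ∧ K n ≤ N n) ∧
      (∀ n, 0 < ρ n ∧ 0 ≤ (qs n : ℝ) - ρ n ∧ (qs n : ℝ) + ρ n ≤ 1) ∧
      (∀ n, (ssbmDetection δ (N n) (K n) (qs n) (ρ n)).H₁.Nonempty) ∧
      -- the parameters are in the stated regime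
      Tendsto N atTop atTop ∧
      Tendsto (fun n => Real.log (ρ n)⁻¹ / Real.log (N n)) atTop (𝓝 α) ∧
      Tendsto (fun n => Real.log (K n) / Real.log (N n)) atTop (𝓝 β) ∧
      Tendsto (fun n => (qs n : ℝ)) atTop (𝓝 q) ∧
      -- hardness for polynomial-time tests
      (PlantedCliqueConjecture ⟨1 / 2, by norm_num, by norm_num⟩ →
        ∀ φ : ∀ n, GraphAlgorithm (N n), RunsInPolyTime φ →
          1 ≤ liminf (fun n => (ssbmDetection δ (N n) (K n) (qs n) (ρ n)).error (φ n)) atTop) := by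
  obtain ⟨x, κ, hxκ, hx₀, hxα, hx₁, hκ₀, hκ₁, hδκ, hδ1⟩ :=
    exists_exponents hδ hα₀ hβ₀ hβ₁ hβα
  obtain ⟨l, k, g, hscale⟩ := exists_scales hx₀ hx₁ hκ₀.le
  obtain ⟨t, ht⟩ := exists_gaussianReal_quantile hq₀ hq₁
  have hq : (gaussianTail t 0 : ℝ) = q := ht
  set d := ProbabilityTheory.gaussianPDFReal 0 1 (|t| + 1) with hd
  have hd0 : 0 < d := ProbabilityTheory.gaussianPDFReal_pos _ _ _ one_ne_zero
  -- The `24` is the `12` from the planted mean times the `2` lost in `2 ^ l ≤ 2 * n ^ x`; the other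
  -- two bounds keep `q ± ρ` in the unit interval.
  obtain ⟨c, hc0, hcd, hcq, hcq'⟩ : ∃ c : ℝ, 0 < c ∧ c ≤ d / 24 ∧ c ≤ q ∧ c ≤ 1 - q :=
    ⟨min (d / 24) (min q (1 - q)), lt_min (by linarith) (lt_min hq₀ (by linarith)),
      min_le_left _ _, (min_le_right _ _).trans (min_le_left _ _),
      (min_le_right _ _).trans (min_le_right _ _)⟩
  set ρ : ℕ → ℝ := fun n => c * (n : ℝ) ^ (-α) / Real.log (n + 3) with hρ
  set ν : ℕ → ℝ := fun n => 1 / (12 * Real.log ((n : ℝ) + 3)) / 2 ^ l n with hν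
  set N : ℕ → ℕ := fun n => g n * 2 ^ l n with hN
  set K : ℕ → ℕ := fun n => k n * 2 ^ l n with hK
  have hμ1 : ∀ n : ℕ, 1 / (12 * Real.log ((n : ℝ) + 3)) ≤ 1 := fun n => by
    have := one_le_log_add_three n
    rw [div_le_one (by linarith)]; linarith
  have hμ0 : ∀ n : ℕ, 0 ≤ 1 / (12 * Real.log ((n : ℝ) + 3)) := fun n => by
    have := one_le_log_add_three n
    positivity
  have hν0 : ∀ n, 0 ≤ ν n := fun n => div_nonneg (hμ0 n) (by positivity)
  have hν1 : ∀ n, ν n ≤ 1 := fun n =>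
    (div_le_self (hμ0 n) (one_le_pow₀ one_le_two)).trans (hμ1 n)
  have hρ0 : ∀ n : ℕ, 1 ≤ n → 0 < ρ n := fun n hn => by
    have := one_le_log_add_three n
    have : (0 : ℝ) < n := by exact_mod_cast hn
    positivity
  have hρc : ∀ n : ℕ, 1 ≤ n → ρ n ≤ c := fun n hn => by
    have h1 := one_le_log_add_three n
    have h2 : (1 : ℝ) ≤ n := by exact_mod_cast hn
    have h3 := Real.rpow_le_one_of_one_le_of_nonpos h2 (neg_nonpos.2 hα₀)
    rw [hρ, div_le_iff₀ (by linarith)]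
    nlinarith
  have hρν : ∀ n : ℕ, 1 ≤ n → ρ n ≤ d * ν n := fun n hn => by
    have h1 := one_le_log_add_three n
    have h2 : (1 : ℝ) ≤ n := by exact_mod_cast hn
    obtain ⟨-, -, h3, -⟩ := hscale n hn
    have h4 : (n : ℝ) ^ (-α) ≤ (n : ℝ) ^ (-x) :=
      Real.rpow_le_rpow_of_exponent_le h2 (neg_le_neg hxα)
    have h5 : (n : ℝ) ^ (-x) ≤ 2 / 2 ^ l n := by
      rw [Real.rpow_neg (by linarith), inv_le_comm₀ (by positivity) (by positivity), inv_div]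
      linarith
    calc ρ n ≤ d / 24 * (2 / 2 ^ l n) / Real.log (n + 3) := by
          simp only [hρ]
          gcongr
          exact h4.trans h5
      _ = d * ν n := by
          simp only [hν]
          field_simp
          norm_num
  have hKβ : ∀ n : ℕ, 1 ≤ n → (n : ℝ) ^ β ≤ K n ∧ (K n : ℝ) ≤ 4 * (n : ℝ) ^ β := fun n hn => by
    have hn0 : (0 : ℝ) < n := by exact_mod_cast hn
    obtain ⟨-, h1, h2, -, h3, h4, -⟩ := hscale n hn
    rw [← hxκ, Real.rpow_add hn0]
    simp only [hK]
    push_cast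
    constructor
    · rw [mul_comm]; gcongr
    · calc _ ≤ 2 * (n : ℝ) ^ κ * (2 * (n : ℝ) ^ x) := by gcongr
        _ = _ := by ring
  have hβ1 : β < 1 := by linarith
  have hev : ∀ᶠ n : ℕ in atTop, 1 ≤ n ∧ 4 * k n ≤ n ∧ K n ≤ N n ∧
      ((K n : ℕ) : ℝ) ^ (1 - δ) < ((K n : ℕ) : ℝ) / 2 := by
    have hβpos : 0 < β := hδ.trans hβ₀
    have e1 := eventually_mul_rpow_le (by linarith : κ < 1) 8
    have e2 := eventually_mul_rpow_le hβ1 4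
    have e3 := eventually_mul_rpow_le (mul_pos hβpos hδ) 3
    filter_upwards [eventually_ge_atTop 1, e1, e2, e3] with n hn h1 h2 h3
    have hn0 : (0 : ℝ) < n := by exact_mod_cast hn
    obtain ⟨-, -, -, -, -, h4, -, h5, -⟩ := hscale n hn
    obtain ⟨h6, h7⟩ := hKβ n hn
    rw [Real.rpow_one] at h1 h2
    rw [Real.rpow_zero, mul_one, Real.rpow_mul hn0.le] at h3
    refine ⟨hn, ?_, ?_, ?_⟩
    · have : 4 * (k n : ℝ) ≤ n := by linarith
      exact_mod_cast this
    · have : (K n : ℝ) ≤ n := by linarith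
      exact (by exact_mod_cast this : K n ≤ n).trans h5
    · have hK0 : (0 : ℝ) < K n := lt_of_lt_of_le (by positivity) h6
      have h8 : (3 : ℝ) ≤ (K n : ℝ) ^ δ := h3.trans (Real.rpow_le_rpow (by positivity) h6 hδ.le)
      rw [Real.rpow_sub hK0, Real.rpow_one, div_lt_div_iff₀ (by positivity) two_pos]
      nlinarith
  -- Admissibility is required for every index but holds only from `n₀` on, so the parameters are
  -- frozen below `n₀` by means of `max n n₀`; limits are unaffected.
  obtain ⟨n₀, hn₀⟩ := eventually_atTop.1 hev
  have hmax : ∀ n, 1 ≤ max n n₀ ∧ 4 * k (max n n₀) ≤ max n n₀ ∧ K (max n n₀) ≤ N (max n n₀) ∧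
      ((K (max n n₀) : ℕ) : ℝ) ^ (1 - δ) < ((K (max n n₀) : ℕ) : ℝ) / 2 := fun n =>
    hn₀ _ (le_max_right _ _)
  have hcongr : ∀ {X : Type} (f : ℕ → X), f =ᶠ[atTop] fun n => f (max n n₀) := fun f => by
    filter_upwards [eventually_ge_atTop n₀] with n hn
    rw [max_eq_left hn]
  have hlogN : Tendsto (fun n => Real.log (N n) / Real.log n) atTop (𝓝 1) := by
    refine tendsto_log_div_log_of_between (c := 4) (by norm_num) ?_
    filter_upwards [eventually_ge_atTop 1] with n hn
    obtain ⟨-, -, -, -, -, -, -, h1, h2⟩ := hscale n hn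
    rw [Real.rpow_one]
    exact ⟨by exact_mod_cast h1, by exact_mod_cast h2⟩
  have hratio : ∀ {f : ℕ → ℝ} {a : ℝ}, Tendsto (fun n : ℕ => f n / Real.log n) atTop (𝓝 a) →
      Tendsto (fun n => f n / Real.log (N n)) atTop (𝓝 a) := fun {f a} hf => by
    have := hf.div hlogN one_ne_zero
    rw [div_one] at this
    refine this.congr' ?_
    filter_upwards [eventually_ge_atTop 2] with n hn
    have : Real.log n ≠ 0 := (Real.log_pos (by exact_mod_cast hn)).ne'
    simp only [Pi.div_apply]
    field_simp
  have hNtop : Tendsto N atTop atTop := tendsto_atTop_mono' _ (by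
    filter_upwards [eventually_ge_atTop 1] with n hn
    exact (hscale n hn).2.2.2.2.2.2.2.1) tendsto_id
  refine ⟨fun n => N (max n n₀), fun n => K (max n n₀), fun _ => gaussianTail t 0,
    fun n => ρ (max n n₀), fun n => ⟨?_, (hmax n).2.2.1⟩, fun n => ⟨hρ0 _ (hmax n).1, ?_, ?_⟩,
    fun n => ?_, hNtop.congr' (hcongr N), ?_, ?_, ?_, ?_⟩
  · exact Nat.mul_pos (hscale _ (hmax n).1).2.2.2.1 (by positivity)
  · rw [hq]; linarith [hρc _ (hmax n).1]
  · rw [hq]; linarith [hρc _ (hmax n).1]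
  · obtain ⟨h1, h2, h3, h4⟩ := hmax n
    obtain ⟨h5, -, -, h6, -⟩ := hscale _ h1
    -- As `l ≥ 1`, `K` is even, and two communities of exactly equal size show that the model is
    -- nonempty.
    obtain ⟨l', hl'⟩ : ∃ l', l (max n n₀) = l' + 1 := ⟨l (max n n₀) - 1, by omega⟩
    have hKeq : K (max n n₀) = 2 * (k (max n n₀) * 2 ^ l') := by
      simp only [hK, hl', pow_succ]; ring
    simp only [ssbmDetection]
    rw [hKeq] at h3 ⊢
    exact subgraphSBM_nonempty (hν0 _) (hν1 _) rfl (hρν _ h1) (Nat.mul_pos h6 (by positivity)) h3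
  · exact (hratio (tendsto_log_inv_div_log hc0)).congr'
      (hcongr fun n => Real.log (ρ n)⁻¹ / Real.log (N n))
  · refine (hratio (tendsto_log_div_log_of_between (c := 4) (by norm_num) ?_)).congr'
      (hcongr fun n => Real.log (K n) / Real.log (N n))
    filter_upwards [eventually_ge_atTop 1] with n hn
    exact hKβ n hn
  · simp only [hq]; exact tendsto_const_nhds
  · intro hPC φ hφ
    obtain ⟨p, hp⟩ := hφ
    obtain ⟨r, hr⟩ := exists_polynomial_seedCost_le p
    set τ : ℕ → ℝ := fun n => ((k n * 2 ^ l n : ℕ) : ℝ) ^ (1 - δ) / 2 ^ l n with hτ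
    set e : ℕ → ℝ := fun n =>
      ((1 + 2 * Real.exp (4 - 2 * (3 + Real.log ((n : ℝ) + 3)))) ^ ((2 * k n) ^ 2) - 1) +
        2 * (1 + 2 * Real.exp (4 - 2 * (3 + Real.log ((n : ℝ) + 3)))) ^ ((2 * k n) ^ 2) *
          roundingError (N n * N n) (Fintype.card (Sym2 (Fin (N n)))) (N n)
            (((N n : ℝ) + 1) ^ 5)⁻¹ +
        √(Real.exp (2 * ((2 * k n : ℕ) : ℝ) ^ 2 / n) - 1) +
        (k n / (2 * τ n ^ 2) + ((2 ^ l n : ℕ) : ℝ) * (2 * k n) ^ 2 / (n * τ n)) with he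
    have hk2 : ∀ n : ℕ, 1 ≤ n → (k n : ℝ) ≤ 2 * (n : ℝ) ^ κ := fun n hn =>
      (hscale n hn).2.2.2.2.2.1
    have he0 : Tendsto e atTop (𝓝 0) := by
      have h1 := tendsto_pow_planting_cost (by linarith : κ < 1) hk2
      have h2 := tendsto_sqrt_exp_sub_one hκ₁ hk2
      have h3 := tendsto_bad_probability hδκ hδ1 (by linarith) (τ := τ)
        (fun n hn => ⟨(hscale n hn).2.1, (hscale n hn).2.2.1⟩)
        (fun n hn => ⟨(hscale n hn).2.2.2.2.1, hk2 n hn⟩) fun n => rfl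
      have h4 := tendsto_roundingError.comp hNtop
      have := (((h1.sub_const 1).add ((h1.const_mul 2).mul h4)).add h2).add h3
      simp only [sub_self, mul_zero, add_zero] at this
      exact this
    -- Keeping `m` apart from `n` avoids a transport along `max n n₀ = n` in the type of the test.
    have hred : ∀ n m, n₀ ≤ m → m = n → ∀ ψ : GraphAlgorithm (N m), ψ.time ≤ p.eval (N m) →
        ∃ A : GraphAlgorithm n, A.time ≤ r.eval n ∧
          (plantedCliqueDetection n (2 * k m) ⟨1 / 2, by norm_num, by norm_num⟩).error A ≤
            (ssbmDetection δ (N m) (K m) (gaussianTail t 0) (ρ m)).error ψ +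
              ENNReal.ofReal (e n) := by
      rintro n m hn rfl ψ hψ
      obtain ⟨h1, h2, h3, h4⟩ := hn₀ m hn
      obtain ⟨-, -, -, h6, -, -, h7, -, h8⟩ := hscale m h1
      have hB : Real.exp (4 - 2 * (3 + Real.log ((m : ℝ) + 3))) ≤ 1 / 4 := by
        refine (exp_four_sub_le m).trans ?_
        rw [div_le_iff₀ (by positivity)]
        nlinarith [m.cast_nonneg (α := ℝ)]
      obtain ⟨A, hA1, hA2⟩ := exists_ssbm_reduction (δ := δ) (t := t)
        (μ := 1 / (12 * Real.log ((m : ℝ) + 3))) (M := N m) (η := (((N m : ℝ) + 1) ^ 5)⁻¹)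
        (B := 3 + Real.log ((m : ℝ) + 3)) (ρ := ρ m) (W := N m * (N m + 1) ^ 5 + 1)
        h7 h6 h2 rfl h4 (Nat.cast_nonneg _) (by positivity) (hμ0 m) (hμ1 m) (exp_planting_le m)
        hB (by linarith [one_le_log_add_three m]) (by push_cast; rw [div_inv_eq_mul]) (hρν m h1) ψ
      exact ⟨A, (hA1.trans (Nat.add_le_add_left hψ _)).trans (hr m _ h8), hA2⟩
    have key : ∀ n, ∃ A : GraphAlgorithm n, A.time ≤ r.eval n ∧ (n₀ ≤ n →
        (plantedCliqueDetection n (2 * k (max n n₀)) ⟨1 / 2, by norm_num, by norm_num⟩).error A ≤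
          (ssbmDetection δ (N (max n n₀)) (K (max n n₀)) (gaussianTail t 0) (ρ (max n n₀))).error
            (φ n) + ENNReal.ofReal (e n)) := fun n => by
      by_cases hn : n₀ ≤ n
      · obtain ⟨A, hA1, hA2⟩ := hred n _ (le_max_right _ _) (max_eq_left hn) (φ n) (hp n)
        exact ⟨A, hA1, fun _ => hA2⟩
      -- For the finitely many small `n` any program will do.
      · exact ⟨[], Nat.zero_le _, fun h => absurd h hn⟩
    choose A hA1 hA2 using key
    have hlim : Tendsto (fun n : ℕ => Real.log ((2 * k (max n n₀) : ℕ) : ℝ) / Real.log n) atTop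
        (𝓝 κ) := by
      refine tendsto_log_div_log_of_between (c := 4) (by norm_num) ?_
      filter_upwards [eventually_ge_atTop n₀, eventually_ge_atTop 1] with n hn hn1
      have h1 := hk2 n hn1
      have h2 := (hscale n hn1).2.2.2.2.1
      have h3 : (0 : ℝ) ≤ (n : ℝ) ^ κ := by positivity
      rw [max_eq_left hn]
      push_cast
      constructor <;> linarith
    have hPC' := hPC A (fun n => 2 * k (max n n₀)) ⟨r, hA1⟩
      (fun n => Nat.mul_pos two_pos (hscale _ (hmax n).1).2.2.2.1) (by
        have := ((continuous_coe_real_ereal.tendsto κ).comp hlim).limsup_eq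
        simp only [Function.comp_def] at this
        rw [this]
        exact_mod_cast hκ₁)
    have he0' : Tendsto (fun n => ENNReal.ofReal (e n)) atTop (𝓝 0) := by
      simpa using ENNReal.tendsto_ofReal he0
    -- A vanishing loss does not change the lower limit, so the bound from the conjecture passes to
    -- the block model.
    rw [← ENNReal.liminf_add_of_right_tendsto_zero he0']
    refine hPC'.trans (liminf_le_liminf ?_)
    filter_upwards [eventually_ge_atTop n₀] with n hn
    exact hA2 n hn
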